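/- Let $G$ be a finite group. All monoids and rings are commutative with unit. For an equivariant map $f\colon X\to Y$ of finite $G$-sets and $p\colon A\to X$, let $\Pi_f(A)$ be the $G$-set of pairs $(y,\sigma)$ with $y\in Y$ and $\sigma\colon f^{-1}(y)\to A$ a map of sets with $p\sigma=\mathrm{id}$, let $\pi\colon\Pi_f(A)\to Y$, $\pi(y,\sigma)=y$, let $e\colon X\times_Y\Pi_f(A)\to A$, $e(x,(y,\sigma))=\sigma(x)$, and let $f'\colon X\times_Y\Pi_f(A)\to\Pi_f(A)$ be the projection. A *semi-Mackey functor* $M=(M^*,M_*)$ on $G$ consists of a contravariant and a covariant set-valued functor on finite $G$-sets with the same values $M(X)$, such that $M^*$ sends finite coproducts to products and $M_*(x)M^*(f')=M^*(f)M_*(y)$ for every pull-back square $fx=yf'$; the values $M(X)$ are then monoids, and all $M^*(f)$, $M_*(f)$ are homomorphisms. A *Tambara functor* $T=(T^*,T_+,T_\bullet)$ consists of two semi-Mackey functors $T^\alpha=(T^*,T_+)$ and $T^\mu=(T^*,T_\bullet)$ with the same contravariant part, satisfying the distributive law $T_\bullet(f)T_+(p)=T_+(\pi)T_\bullet(f')T^*(e)$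 for all $f,p$ as above, and such that the semi-rings $T(X)$ (addition from $T^\alpha$, multiplication from $T^\mu$) are rings. Morphisms are families of monoid (resp. ring) homomorphisms compatible with all structure morphisms; write $\mathrm{SMack}_G$ and $\mathrm{Tam}_G$ for the categories. For a Tambara functor $T$, a *$T$-Tambara functor* is a pair $(S,\sigma)$ with $S\in\mathrm{Tam}_G$ and $\sigma\colon T\to S$ a morphism; with the morphisms under $T$ these form the category $T\text{-}\mathrm{Tam}_G$. Notation: * $\Omega$ is the Burnside ring functor: $\Omega(X)$ is the Grothendieck ring of finite $G$-sets over $X$; for $f\colon X\to Y$, $f^*$ is pull-back, $f_+$ is composition with $f$, and $f_\bullet(A\xrightarrow{p}X)=(\Pi_f(A)\xrightarrow{\pi}Y)$. * $\Omega[M]$ is the Tambarization of $M\in\mathrm{SMack}_G$, i.e. $M\mapsto\Omega[M]$ is the left adjoint of $(-)^\mu\colon\mathrm{Tam}_G\to\mathrm{SMack}_G$. Explicitly, $\Omega[M](X)$ is the Grothendieck ring of pairs $(A\xrightarrow{p}X,\ m\in M(A))$, with $f^*(B\xrightarrow{q}Y,m)=(X\times_YB\to X,\ M^*(p_B)(m))$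 where $p_B\colon X\times_YB\to B$ is the projection, $f_+(A\xrightarrow{p}X,m)=(A\xrightarrow{fp}Y,m)$ and $f_\bullet(A\xrightarrow{p}X,m)=(\Pi_f(A)\xrightarrow{\pi}Y,\ M_*(f')M^*(e)(m))$. * $T\otimes_\Omega S$ is the tensor product of Tambara functors: $(T\otimes_\Omega S)(X)$ is the quotient of $\bigoplus_{p\colon A\to X}T(A)\otimes_{\mathbb Z}S(A)$ by the subgroup generated by $T^*(a)(t')\otimes s-t'\otimes S_+(a)(s)$ and $T_+(a)(t)\otimes s'-t\otimes S^*(a)(s')$ for all maps $a\colon A\to A'$ over $X$ and all $t\in T(A)$, $s\in S(A)$, $t'\in T(A')$, $s'\in S(A')$. Writing $[t\otimes s]_{(A,p)}$ for the class of $t\otimes s$ in the component of $p$, the structure morphisms are $f^*[t\otimes s]_{(B,q)}=[T^*(p_B)(t)\otimes S^*(p_B)(s)]_{(X\times_YB,\,p_X)}$ with $p_X,p_B$ the projections of $X\times_YB$, $f_+[t\otimes s]_{(A,p)}=[t\otimes s]_{(A,fp)}$ and $f_\bullet[t\otimes s]_{(A,p)}=[T_\bullet(f')T^*(e)(t)\otimes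 S_\bullet(f')S^*(e)(s)]_{(\Pi_f(A),\pi)}$. * For a $G$-monoid $Q$ (a monoid on which $G$ acts by monoid automorphisms), $\mathcal P_Q\in\mathrm{SMack}_G$ is the fixed point functor: $\mathcal P_Q(X)$ is the set of equivariant maps $X\to Q$, restriction along $f$ is $\beta\mapsto\beta\circ f$, and the transfer along $f$ sends $\alpha$ to $y\mapsto\prod_{x\in f^{-1}(y)}\alpha(x)$. * For a Tambara functor $T$ and a finite $G$-monoid $Q$, $T_Q$ is the Dress construction: $T_Q(X)=T(X\times Q)$, $f^*=T^*(f\times Q)$, $f_+=T_+(f\times Q)$ and $f_\bullet=T_+(\mu_f)T_\bullet(f')T^*(e)$, where $f',e$ are taken for the projection $p_X\colon X\times Q\to X$ and $\mu_f\colon\Pi_f(X\times Q)\to Y\times Q$, $\mu_f(y,\sigma)=\bigl(y,\prod_{x\in f^{-1}(y)}p_Q(\sigma(x))\bigr)$, with $p_Q\colon X\times Q\to Q$ the projection. **Theorem.** For every finite group $G$ there is a functor $$\mathcal F\colon\mathrm{Tam}_G\times\mathrm{SMack}_G\to\mathrm{Tam}_G,\qquad \mathcal F(T,M)=T\otimes_\Omega\Omega[M],$$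 with the following properties. 1. If $G$ is trivial, then evaluation at the one-point set gives equivalences of $\mathrm{Tam}_G$ with the category of rings and of $\mathrm{SMack}_G$ with the category of monoids, and under these $\mathcal F$ is naturally isomorphic to the functor $(R,Q)\mapsto R[Q]$ taking semi-group rings with coefficients. 2. There is an isomorphism $\mathcal F(\Omega,M)\cong\Omega[M]$, natural in $M\in\mathrm{SMack}_G$. 3. There is an isomorphism $\mathcal F(T,\mathcal P_Q)\cong T_Q$, natural in the Tambara functor $T$ and in the finite $G$-monoid $Q$. (A morphism $\tau\colon T\to T'$ and a homomorphism $\varphi\colon Q\to Q'$ of $G$-monoids induce $T_Q(X)\to T'_{Q'}(X)$, $t\mapsto T'_+(X\times\varphi)(\tau(t))$.) 4. The coprojections $T\to\mathcal F(T,M)$, $t\mapsto[t\otimes1]_{(X,\mathrm{id})}$ for $t\in T(X)$, are morphisms of Tambara functors, natural in $T$ and $M$, and make $\mathcal F(T,M)$ a $T$-Tambara functor. For each fixed $T$ the resulting functor $\mathcal F(T,-)\colon\mathrm{SMack}_G\to T\text{-}\mathrm{Tam}_G$ is left adjoint to the functor $(S,\sigma)\mapsto S^\mu$. -/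

import Mathlib

universe u

open CategoryTheory

open scoped TensorProduct DirectSum CategoryTheory.Prod

noncomputable section

namespace GBivariant

/-! ### Finite `G`-sets -/

/-- A finite `G`-set. -/
structure FinGSet (G : Type u) [Group G] where
  carrier : Type u
  [finite : Finite carrier]
  [action : MulAction G carrier]

namespace FinGSet

variable {G : Type u} [Group G]

instance : CoeSort (FinGSet G) (Type u) := ⟨FinGSet.carrier⟩

attribute [instance] FinGSet.finite FinGSet.action

/-- The one-point `G`-set `G/G`. -/
def point (G : Type u) [Group G] : FinGSet G :=
  letI : MulAction G PUnit.{u + 1} :=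
    { smul := fun _ x => x, one_smul := fun _ => rfl, mul_smul := fun _ _ _ => rfl }
  { carrier := PUnit.{u + 1} }

/-- The coproduct (disjoint union) `X ⊔ Y`. -/
def sum (X Y : FinGSet G) : FinGSet G :=
  letI : MulAction G (X ⊕ Y) :=
    { smul := fun g => Sum.map (fun x => g • x) (fun y => g • y)
      one_smul := by
        rintro (x | y)
        · exact congrArg Sum.inl (one_smul G x)
        · exact congrArg Sum.inr (one_smul G y)
      mul_smul := by
        rintro g h (x | y)
        · exact congrArg Sum.inl (mul_smul g h x)
        · exact congrArg Sum.inr (mul_smul g h y) }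
  { carrier := X ⊕ Y }

def inl (X Y : FinGSet G) : X →[G] X.sum Y where
  toFun := Sum.inl
  map_smul' _ _ := rfl

def inr (X Y : FinGSet G) : Y →[G] X.sum Y where
  toFun := Sum.inr
  map_smul' _ _ := rfl

/-- The fibre product `X ×_Y B` of `f : X → Y` and `q : B → Y`. -/
def pb {X Y B : FinGSet G} (f : X →[G] Y) (q : B →[G] Y) : FinGSet G :=
  letI : MulAction G {z : X × B // f z.1 = q z.2} :=
    { smul := fun g z => ⟨(g • z.1.1, g • z.1.2), by simp [z.2]⟩
      one_smul := fun z => Subtype.ext (one_smul G z.1)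
      mul_smul := fun g h z => Subtype.ext (mul_smul g h z.1) }
  { carrier := {z : X × B // f z.1 = q z.2} }

def pbFst {X Y B : FinGSet G} (f : X →[G] Y) (q : B →[G] Y) : pb f q →[G] X where
  toFun z := z.1.1
  map_smul' _ _ := rfl

def pbSnd {X Y B : FinGSet G} (f : X →[G] Y) (q : B →[G] Y) : pb f q →[G] B where
  toFun z := z.1.2
  map_smul' _ _ := rfl

/-- The commutative square with sides `f' : X' → Y'`, `x : X' → X`, `y : Y' → Y`, `f : X → Y`
is a pull-back square of finite `G`-sets: it commutes and `X'` maps bijectively onto the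
fibre product of `X` and `Y'` over `Y`. -/
def IsPullbackSquare {X Y X' Y' : FinGSet G} (f' : X' →[G] Y') (x : X' →[G] X)
    (y : Y' →[G] Y) (f : X →[G] Y) : Prop :=
  (∀ c, f (x c) = y (f' c)) ∧ ∀ a b, f a = y b → ∃! c, x c = a ∧ f' c = b

/-- The elements `(y, σ)` of `Π_f(A)`: a point `y` of `Y` together with a map of sets
`σ : f⁻¹(y) → A` such that `p ∘ σ` is the identity of `f⁻¹(y)`. -/
structure FibreSection {X Y A : FinGSet G} (f : X →[G] Y) (p : A →[G] X) where
  base : Y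
  sec : ∀ x : X, f x = base → A
  proj_sec : ∀ (x : X) (h : f x = base), p (sec x h) = x

namespace FibreSection

variable {X Y A : FinGSet G} {f : X →[G] Y} {p : A →[G] X}

theorem ext' {s t : FibreSection f p} (hb : s.base = t.base)
    (hs : ∀ x h h', s.sec x h = t.sec x h') : s = t := by
  cases s with
  | mk b s hs1 =>
    cases t with
    | mk c t ht1 =>
      obtain rfl : b = c := hb
      have : s = t := funext fun x => funext fun h => hs x h h
      subst this
      rfl

theorem sec_congr (s : FibreSection f p) {x x' : X} (e : x = x') (h : f x = s.base)
    (h' : f x' = s.base) : s.sec x h = s.sec x' h' := by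
  subst e; rfl

instance : Finite (FibreSection f p) := by
  classical
  refine Finite.of_injective
    (fun s : FibreSection f p =>
      ((s.base, fun x => if h : f x = s.base then some (s.sec x h) else none) :
        Y × (X → Option A))) ?_
  intro s t hst
  have hb : s.base = t.base := congrArg Prod.fst hst
  refine ext' hb fun x h h' => ?_
  have h2 := congrFun (congrArg Prod.snd hst) x
  simp only [dif_pos h, dif_pos h'] at h2
  exact Option.some.inj h2

/-- `g • (y, σ) = (g • y, x ↦ g • σ(g⁻¹ • x))`. -/
instance : MulAction G (FibreSection f p) where
  smul g s :=
    { base := g • s.base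
      sec := fun x h => g • s.sec (g⁻¹ • x) (by rw [map_smul, h, inv_smul_smul])
      proj_sec := fun x h => by rw [map_smul, s.proj_sec, smul_inv_smul] }
  one_smul s := by
    refine ext' (one_smul G s.base) fun x h h' => ?_
    change (1 : G) • s.sec ((1 : G)⁻¹ • x) _ = s.sec x h'
    rw [one_smul]
    exact s.sec_congr (by simp) _ _
  mul_smul g k s := by
    refine ext' (mul_smul g k s.base) fun x h h' => ?_
    change (g * k) • s.sec ((g * k)⁻¹ • x) _ = g • k • s.sec (k⁻¹ • g⁻¹ • x) _
    rw [mul_smul]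
    exact congrArg _ (congrArg _ (s.sec_congr (by simp [mul_smul]) _ _))

end FibreSection

/-- The finite `G`-set `Π_f(A)` for `f : X → Y` and `p : A → X`. -/
def piSet {X Y A : FinGSet G} (f : X →[G] Y) (p : A →[G] X) : FinGSet G where
  carrier := FibreSection f p

/-- `π : Π_f(A) → Y`, `π(y, σ) = y`. -/
def piProj {X Y A : FinGSet G} (f : X →[G] Y) (p : A →[G] X) : piSet f p →[G] Y where
  toFun s := s.base
  map_smul' _ _ := rfl

/-- `e : X ×_Y Π_f(A) → A`, `e(x, (y, σ)) = σ(x)`. -/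
def piEval {X Y A : FinGSet G} (f : X →[G] Y) (p : A →[G] X) :
    pb f (piProj f p) →[G] A where
  toFun z := FibreSection.sec z.1.2 z.1.1 z.2
  map_smul' g z := by
    change g • FibreSection.sec z.1.2 (g⁻¹ • g • z.1.1) _ =
      g • FibreSection.sec z.1.2 z.1.1 _
    exact congrArg _ (FibreSection.sec_congr _ (inv_smul_smul g _) _ _)

/-- `f' : X ×_Y Π_f(A) → Π_f(A)`, the pull-back of `f` along `π`. -/
def piPull {X Y A : FinGSet G} (f : X →[G] Y) (p : A →[G] X) :
    pb f (piProj f p) →[G] piSet f p :=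
  pbSnd f (piProj f p)

end FinGSet

open FinGSet

/-! ### Semi-Mackey functors -/

/-- A semi-Mackey functor on `G`, written multiplicatively. The monoid structures that the
structure morphisms induce on the values are recorded in the structure; they are determined by
the structure morphisms. Values are sets in the universe `u + 1`, finite `G`-sets have carriers
in the universe `u`. -/
structure SemiMackey (G : Type u) [Group G] where
  obj : FinGSet G → Type (u + 1)
  [mon : ∀ X, CommMonoid (obj X)]
  /-- restriction `f^*` -/
  res : ∀ {X Y : FinGSet G}, (X →[G] Y) → obj Y →* obj X
  /-- transfer `f_*` -/
  tr : ∀ {X Y : FinGSet G}, (X →[G] Y) → obj X →* obj Y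
  res_id : ∀ X (m : obj X), res (MulActionHom.id G) m = m
  res_comp : ∀ {X Y Z : FinGSet G} (f : X →[G] Y) (g : Y →[G] Z) (m : obj Z),
    res (g.comp f) m = res f (res g m)
  tr_id : ∀ X (m : obj X), tr (MulActionHom.id G) m = m
  tr_comp : ∀ {X Y Z : FinGSet G} (f : X →[G] Y) (g : Y →[G] Z) (m : obj X),
    tr (g.comp f) m = tr g (tr f m)
  /-- the contravariant part sends the empty coproduct to a one-point set -/
  additive_empty : ∀ X : FinGSet G, IsEmpty X → Subsingleton (obj X)
  /-- the contravariant part sends binary coproducts to products -/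
  additive_sum : ∀ X Y : FinGSet G,
    Function.Bijective fun m : obj (X.sum Y) => (res (inl X Y) m, res (inr X Y) m)
  mackey : ∀ {X Y X' Y' : FinGSet G} (f' : X' →[G] Y') (x : X' →[G] X) (y : Y' →[G] Y)
    (f : X →[G] Y), IsPullbackSquare f' x y f →
    ∀ m : obj Y', tr x (res f' m) = res f (tr y m)

namespace SemiMackey

variable {G : Type u} [Group G]

attribute [instance] SemiMackey.mon

/-- A morphism of semi-Mackey functors. -/
@[ext]
structure Hom (M N : SemiMackey G) where
  app : ∀ X, M.obj X →* N.obj X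
  res_app : ∀ {X Y : FinGSet G} (f : X →[G] Y) (m : M.obj Y),
    app X (M.res f m) = N.res f (app Y m)
  tr_app : ∀ {X Y : FinGSet G} (f : X →[G] Y) (m : M.obj X),
    app Y (M.tr f m) = N.tr f (app X m)

instance : Category (SemiMackey G) where
  Hom := Hom
  id M :=
    { app := fun X => MonoidHom.id (M.obj X)
      res_app := fun _ _ => rfl
      tr_app := fun _ _ => rfl }
  comp φ ψ :=
    { app := fun X => (ψ.app X).comp (φ.app X)
      res_app := fun f m => by simp [φ.res_app, ψ.res_app]
      tr_app := fun f m => by simp [φ.tr_app, ψ.tr_app] }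

end SemiMackey

/-! ### Tambara functors -/

/-- A Tambara functor `T = (T^*, T_+, T_•)` on `G`. The ring structures that the structure
morphisms induce on the values are recorded in the structure; they are determined by the
structure morphisms. The distributive law is stated for canonical exponential diagrams; for
diagrams isomorphic to these it follows by functoriality. -/
structure Tambara (G : Type u) [Group G] where
  obj : FinGSet G → Type (u + 1)
  [ring : ∀ X, CommRing (obj X)]
  /-- restriction `f^*` -/
  res : ∀ {X Y : FinGSet G}, (X →[G] Y) → obj Y →+* obj X
  /-- additive transfer `f_+` -/
  tr : ∀ {X Y : FinGSet G}, (X →[G] Y) → obj X →+ obj Y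
  /-- multiplicative transfer `f_•` -/
  nm : ∀ {X Y : FinGSet G}, (X →[G] Y) → obj X →* obj Y
  res_id : ∀ X (a : obj X), res (MulActionHom.id G) a = a
  res_comp : ∀ {X Y Z : FinGSet G} (f : X →[G] Y) (g : Y →[G] Z) (a : obj Z),
    res (g.comp f) a = res f (res g a)
  tr_id : ∀ X (a : obj X), tr (MulActionHom.id G) a = a
  tr_comp : ∀ {X Y Z : FinGSet G} (f : X →[G] Y) (g : Y →[G] Z) (a : obj X),
    tr (g.comp f) a = tr g (tr f a)
  nm_id : ∀ X (a : obj X), nm (MulActionHom.id G) a = a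
  nm_comp : ∀ {X Y Z : FinGSet G} (f : X →[G] Y) (g : Y →[G] Z) (a : obj X),
    nm (g.comp f) a = nm g (nm f a)
  /-- the contravariant part sends the empty coproduct to a one-point set -/
  additive_empty : ∀ X : FinGSet G, IsEmpty X → Subsingleton (obj X)
  /-- the contravariant part sends binary coproducts to products -/
  additive_sum : ∀ X Y : FinGSet G,
    Function.Bijective fun a : obj (X.sum Y) => (res (inl X Y) a, res (inr X Y) a)
  tr_mackey : ∀ {X Y X' Y' : FinGSet G} (f' : X' →[G] Y') (x : X' →[G] X) (y : Y' →[G] Y)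
    (f : X →[G] Y), IsPullbackSquare f' x y f →
    ∀ a : obj Y', tr x (res f' a) = res f (tr y a)
  nm_mackey : ∀ {X Y X' Y' : FinGSet G} (f' : X' →[G] Y') (x : X' →[G] X) (y : Y' →[G] Y)
    (f : X →[G] Y), IsPullbackSquare f' x y f →
    ∀ a : obj Y', nm x (res f' a) = res f (nm y a)
  distrib : ∀ {X Y A : FinGSet G} (f : X →[G] Y) (p : A →[G] X) (a : obj A),
    nm f (tr p a) = tr (piProj f p) (nm (piPull f p) (res (piEval f p) a))

namespace Tambara

variable {G : Type u} [Group G]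

attribute [instance] Tambara.ring

/-- A morphism of Tambara functors. -/
@[ext]
structure Hom (T S : Tambara G) where
  app : ∀ X, T.obj X →+* S.obj X
  res_app : ∀ {X Y : FinGSet G} (f : X →[G] Y) (a : T.obj Y),
    app X (T.res f a) = S.res f (app Y a)
  tr_app : ∀ {X Y : FinGSet G} (f : X →[G] Y) (a : T.obj X),
    app Y (T.tr f a) = S.tr f (app X a)
  nm_app : ∀ {X Y : FinGSet G} (f : X →[G] Y) (a : T.obj X),
    app Y (T.nm f a) = S.nm f (app X a)

instance : Category (Tambara G) where
  Hom := Hom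
  id T :=
    { app := fun X => RingHom.id (T.obj X)
      res_app := fun _ _ => rfl
      tr_app := fun _ _ => rfl
      nm_app := fun _ _ => rfl }
  comp φ ψ :=
    { app := fun X => (ψ.app X).comp (φ.app X)
      res_app := fun f m => by simp [φ.res_app, ψ.res_app]
      tr_app := fun f m => by simp [φ.tr_app, ψ.tr_app]
      nm_app := fun f m => by simp [φ.nm_app, ψ.nm_app] }

end Tambara

/-- The multiplicative part `(-)^μ`, `T^μ = (T^*, T_•)`. -/
def muFunctor (G : Type u) [Group G] : Tambara G ⥤ SemiMackey G where
  obj T :=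
    { obj := T.obj
      res := fun f => (T.res f).toMonoidHom
      tr := fun f => T.nm f
      res_id := T.res_id
      res_comp := T.res_comp
      tr_id := T.nm_id
      tr_comp := T.nm_comp
      additive_empty := T.additive_empty
      additive_sum := T.additive_sum
      mackey := T.nm_mackey }
  map φ :=
    { app := fun X => (Tambara.Hom.app φ X).toMonoidHom
      res_app := Tambara.Hom.res_app φ
      tr_app := Tambara.Hom.nm_app φ }
  map_id _ := rfl
  map_comp _ _ := rfl

/-- The forgetful functor `(S, σ) ↦ S^μ` from `T`-Tambara functors (Tambara functors `S` with a
morphism `σ : T ⟶ S`) to semi-Mackey functors. -/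
def underMu {G : Type u} [Group G] (T : Tambara G) : Under T ⥤ SemiMackey G :=
  Under.forget T ⋙ muFunctor G

/-- If `ι` is a natural family of morphisms `T ⟶ F(T, M)`, then `F(T, -)` is a functor to the
category of `T`-Tambara functors. -/
def coeffFunctor {G : Type u} [Group G] {F : Tambara G × SemiMackey G ⥤ Tambara G}
    (ι : CategoryTheory.Prod.fst (Tambara G) (SemiMackey G) ⟶ F) (T : Tambara G) :
    SemiMackey G ⥤ Under T where
  obj M := Under.mk (Y := F.obj (T, M)) (ι.app (T, M))
  map {M N} φ := Under.homMk (F.map (𝟙 T ×ₘ φ)) (by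
    have h := ι.naturality (X := (T, M)) (Y := (T, N)) (𝟙 T ×ₘ φ)
    simpa using h.symm)
  map_id M := by
    apply Under.UnderMorphism.ext
    exact F.map_id (T, M)
  map_comp {M N P} φ ψ := by
    apply Under.UnderMorphism.ext
    have h := F.map_comp (X := (T, M)) (Y := (T, N)) (Z := (T, P)) (𝟙 T ×ₘ φ) (𝟙 T ×ₘ ψ)
    simp at h ⊢

/-! ### The Burnside ring functor and Tambarization

The Grothendieck group of a category with finite coproducts is the abelian group generated by
the objects, in which isomorphic objects are identified and coproducts become sums. -/

section Grothendieck

variable {G : Type u} [Group G]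

/-- Objects of the category of finite `G`-sets over `X`. -/
abbrev SetOver (X : FinGSet G) : Type (u + 1) := Σ A : FinGSet G, (A →[G] X)

/-- The relations defining the Grothendieck group of finite `G`-sets over `X`. -/
inductive BurnsideRel (X : FinGSet G) : FreeAbelianGroup (SetOver X) → Prop
  | iso {A B : FinGSet G} (p : A →[G] X) (q : B →[G] X) (a : A →[G] B)
      (ha : Function.Bijective a) (hp : q.comp a = p) :
      BurnsideRel X (FreeAbelianGroup.of ⟨A, p⟩ - FreeAbelianGroup.of ⟨B, q⟩)
  | sum {A B : FinGSet G} (p : A.sum B →[G] X) :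
      BurnsideRel X (FreeAbelianGroup.of ⟨A.sum B, p⟩ -
        (FreeAbelianGroup.of ⟨A, p.comp (inl A B)⟩ + FreeAbelianGroup.of ⟨B, p.comp (inr A B)⟩))

/-- The Grothendieck group of the category of finite `G`-sets over `X`. -/
abbrev BurnsideGroup (X : FinGSet G) : Type (u + 1) :=
  FreeAbelianGroup (SetOver X) ⧸ AddSubgroup.closure {z | BurnsideRel X z}

/-- The class of `p : A → X`. -/
def bcls {A X : FinGSet G} (p : A →[G] X) : BurnsideGroup X :=
  QuotientAddGroup.mk (FreeAbelianGroup.of ⟨A, p⟩)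

/-- `Ω`, with the identifications `e`, is the Burnside ring functor: `Ω(X)` is the Grothendieck
ring of finite `G`-sets over `X`, with restriction given by pull-back, additive transfer by
composition and multiplicative transfer by `Π_f`. -/
structure IsBurnside (Ω : Tambara G) (e : ∀ X, BurnsideGroup X ≃+ Ω.obj X) : Prop where
  one : ∀ X : FinGSet G, e X (bcls (MulActionHom.id G)) = 1
  mul : ∀ {X A B : FinGSet G} (p : A →[G] X) (q : B →[G] X),
    e X (bcls p) * e X (bcls q) = e X (bcls (p.comp (pbFst p q)))
  res : ∀ {X Y B : FinGSet G} (f : X →[G] Y) (q : B →[G] Y),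
    Ω.res f (e Y (bcls q)) = e X (bcls (pbFst f q))
  tr : ∀ {X Y A : FinGSet G} (f : X →[G] Y) (p : A →[G] X),
    Ω.tr f (e X (bcls p)) = e Y (bcls (f.comp p))
  nm : ∀ {X Y A : FinGSet G} (f : X →[G] Y) (p : A →[G] X),
    Ω.nm f (e X (bcls p)) = e Y (bcls (piProj f p))

/-- Objects `(p : A → X, m ∈ M(A))` of the category of finite `G`-sets over `X` with a
coefficient in `M`. -/
structure PairOver (M : SemiMackey G) (X : FinGSet G) : Type (u + 1) where
  set : FinGSet G
  proj : set →[G] X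
  coeff : M.obj set

/-- The relations defining the Grothendieck group of pairs over `X`. -/
inductive PairRel (M : SemiMackey G) (X : FinGSet G) : FreeAbelianGroup (PairOver M X) → Prop
  | iso {A B : FinGSet G} (p : A →[G] X) (q : B →[G] X) (a : A →[G] B)
      (ha : Function.Bijective a) (hp : q.comp a = p) (m : M.obj B) :
      PairRel M X (FreeAbelianGroup.of ⟨A, p, M.res a m⟩ - FreeAbelianGroup.of ⟨B, q, m⟩)
  | sum {A B : FinGSet G} (p : A.sum B →[G] X) (m : M.obj (A.sum B)) :
      PairRel M X (FreeAbelianGroup.of ⟨A.sum B, p, m⟩ -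
        (FreeAbelianGroup.of ⟨A, p.comp (inl A B), M.res (inl A B) m⟩ +
          FreeAbelianGroup.of ⟨B, p.comp (inr A B), M.res (inr A B) m⟩))

/-- The Grothendieck group of the category of pairs `(p : A → X, m ∈ M(A))`. -/
abbrev PairGroup (M : SemiMackey G) (X : FinGSet G) : Type (u + 1) :=
  FreeAbelianGroup (PairOver M X) ⧸ AddSubgroup.closure {z | PairRel M X z}

/-- The class of `(p : A → X, m)`. -/
def pcls {M : SemiMackey G} {A X : FinGSet G} (p : A →[G] X) (m : M.obj A) : PairGroup M X :=
  QuotientAddGroup.mk (FreeAbelianGroup.of ⟨A, p, m⟩)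

/-- `𝒯`, with the identifications `e`, is the Tambarization functor `M ↦ Ω[M]`: it is left
adjoint to `(-)^μ`, and `Ω[M](X)` is the Grothendieck ring of the category of pairs
`(p : A → X, m ∈ M(A))`, with the structure morphisms given on such pairs as stated. -/
structure IsTambarization (𝒯 : SemiMackey G ⥤ Tambara G)
    (e : ∀ M X, PairGroup M X ≃+ (𝒯.obj M).obj X) : Prop where
  adj : Nonempty (𝒯 ⊣ muFunctor G)
  map : ∀ {M N : SemiMackey G} (φ : M ⟶ N) {X A : FinGSet G} (p : A →[G] X) (m : M.obj A),
    (𝒯.map φ).app X (e M X (pcls p m)) = e N X (pcls p (φ.app A m))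
  one : ∀ M (X : FinGSet G), e M X (pcls (MulActionHom.id G) 1) = 1
  mul : ∀ M {X A B : FinGSet G} (p : A →[G] X) (m : M.obj A) (q : B →[G] X) (n : M.obj B),
    e M X (pcls p m) * e M X (pcls q n) =
      e M X (pcls (p.comp (pbFst p q)) (M.res (pbFst p q) m * M.res (pbSnd p q) n))
  res : ∀ M {X Y B : FinGSet G} (f : X →[G] Y) (q : B →[G] Y) (m : M.obj B),
    (𝒯.obj M).res f (e M Y (pcls q m)) = e M X (pcls (pbFst f q) (M.res (pbSnd f q) m))
  tr : ∀ M {X Y A : FinGSet G} (f : X →[G] Y) (p : A →[G] X) (m : M.obj A),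
    (𝒯.obj M).tr f (e M X (pcls p m)) = e M Y (pcls (f.comp p) m)
  nm : ∀ M {X Y A : FinGSet G} (f : X →[G] Y) (p : A →[G] X) (m : M.obj A),
    (𝒯.obj M).nm f (e M X (pcls p m)) =
      e M Y (pcls (piProj f p) (M.tr (piPull f p) (M.res (piEval f p) m)))

end Grothendieck

/-! ### The tensor product over the Burnside ring functor -/

section Tensor

variable {G : Type u} [Group G]

/-- The direct sum of the `T(A) ⊗_ℤ S(A)` over all `p : A → X`. -/
abbrev TensorSum (T S : Tambara G) (X : FinGSet G) : Type (u + 1) :=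
  ⨁ a : SetOver X, T.obj a.1 ⊗[ℤ] S.obj a.1

open Classical in
/-- The element `t ⊗ s` in the summand of `p : A → X`. -/
def tsum {T S : Tambara G} {X A : FinGSet G} (p : A →[G] X) (t : T.obj A) (s : S.obj A) :
    TensorSum T S X :=
  DirectSum.of (fun a : SetOver X => T.obj a.1 ⊗[ℤ] S.obj a.1) ⟨A, p⟩ (t ⊗ₜ[ℤ] s)

/-- The generators of the submodule to be divided out. -/
inductive TensorRel (T S : Tambara G) (X : FinGSet G) : TensorSum T S X → Prop
  | left {A B : FinGSet G} (p : A →[G] X) (q : B →[G] X) (a : A →[G] B) (h : q.comp a = p)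
      (t : T.obj B) (s : S.obj A) :
      TensorRel T S X (tsum p (T.res a t) s - tsum q t (S.tr a s))
  | right {A B : FinGSet G} (p : A →[G] X) (q : B →[G] X) (a : A →[G] B) (h : q.comp a = p)
      (t : T.obj A) (s : S.obj B) :
      TensorRel T S X (tsum q (T.tr a t) s - tsum p t (S.res a s))

/-- The value at `X` of the tensor product of (the additive parts of) `T` and `S` over the
Burnside ring functor. -/
abbrev TensorGroup (T S : Tambara G) (X : FinGSet G) : Type (u + 1) :=
  TensorSum T S X ⧸ AddSubgroup.closure {z | TensorRel T S X z}

/-- The element `[t ⊗ s]_{(A, p)}`. -/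
def tcls {T S : Tambara G} {X A : FinGSet G} (p : A →[G] X) (t : T.obj A) (s : S.obj A) :
    TensorGroup T S X :=
  QuotientAddGroup.mk (tsum p t s)

/-- `U`, with the identifications `e`, is the Tambara functor `T ⊗_Ω S`. -/
structure IsTensor (T S U : Tambara G) (e : ∀ X, TensorGroup T S X ≃+ U.obj X) : Prop where
  res : ∀ {X Y B : FinGSet G} (f : X →[G] Y) (q : B →[G] Y) (t : T.obj B) (s : S.obj B),
    U.res f (e Y (tcls q t s)) =
      e X (tcls (pbFst f q) (T.res (pbSnd f q) t) (S.res (pbSnd f q) s))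
  tr : ∀ {X Y A : FinGSet G} (f : X →[G] Y) (p : A →[G] X) (t : T.obj A) (s : S.obj A),
    U.tr f (e X (tcls p t s)) = e Y (tcls (f.comp p) t s)
  nm : ∀ {X Y A : FinGSet G} (f : X →[G] Y) (p : A →[G] X) (t : T.obj A) (s : S.obj A),
    U.nm f (e X (tcls p t s)) =
      e Y (tcls (piProj f p) (T.nm (piPull f p) (T.res (piEval f p) t))
        (S.nm (piPull f p) (S.res (piEval f p) s)))

/-- `F`, with the identifications `e`, is the functor `(T, M) ↦ T ⊗_Ω 𝒯(M)`, and `ι` is the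
coprojection `T → T ⊗_Ω 𝒯(M)`, `t ↦ t ⊗ 1`. -/
structure IsTensorFunctor (𝒯 : SemiMackey G ⥤ Tambara G)
    (F : Tambara G × SemiMackey G ⥤ Tambara G)
    (e : ∀ T M X, TensorGroup T (𝒯.obj M) X ≃+ (F.obj (T, M)).obj X)
    (ι : CategoryTheory.Prod.fst (Tambara G) (SemiMackey G) ⟶ F) : Prop where
  obj : ∀ T M, IsTensor T (𝒯.obj M) (F.obj (T, M)) (e T M)
  map : ∀ {T T' : Tambara G} {M M' : SemiMackey G} (τ : T ⟶ T') (φ : M ⟶ M')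
    {X A : FinGSet G} (p : A →[G] X) (t : T.obj A) (s : (𝒯.obj M).obj A),
    (F.map (X := (T, M)) (Y := (T', M')) (τ ×ₘ φ)).app X (e T M X (tcls p t s)) =
      e T' M' X (tcls p (τ.app A t) ((𝒯.map φ).app A s))
  coproj : ∀ T M (X : FinGSet G) (t : T.obj X),
    (ι.app (T, M)).app X t = e T M X (tcls (MulActionHom.id G) t 1)

end Tensor

/-! ### `G`-monoids, fixed point functors and the Dress construction -/

section Dress

variable {G : Type u} [Group G]

/-- Pointwise multiplication of equivariant maps into a `G`-monoid. -/
instance homCommMonoid (X Q : Type*) [MulAction G X] [CommMonoid Q] [MulDistribMulAction G Q] :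
    CommMonoid (X →[G] Q) where
  mul α β := ⟨fun x => α x * β x, fun g x => by simp [smul_mul']⟩
  one := ⟨fun _ => 1, fun g _ => (smul_one g).symm⟩
  mul_assoc α β γ := MulActionHom.ext fun x => mul_assoc (α x) (β x) (γ x)
  one_mul α := MulActionHom.ext fun x => one_mul (α x)
  mul_one α := MulActionHom.ext fun x => mul_one (α x)
  mul_comm α β := MulActionHom.ext fun x => mul_comm (α x) (β x)

/-- The equivariant map `y ↦ ∏_{x ∈ f⁻¹(y)} α(x)`. -/
def fibreProd {X Y : FinGSet G} {Q : Type*} [CommMonoid Q] [MulDistribMulAction G Q]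
    (f : X →[G] Y) (α : X →[G] Q) : Y →[G] Q where
  toFun y := ∏ᶠ x : {x : X // f x = y}, α x
  map_smul' g y := by
    change _ = MulDistribMulAction.toMonoidHom Q g _
    rw [MonoidHom.map_finprod _ (Set.toFinite _)]
    symm
    refine finprod_eq_of_bijective
      (fun x : {x : X // f x = y} => (⟨g • x.1, by rw [map_smul, x.2]⟩ :
        {x : X // f x = g • y})) ⟨?_, ?_⟩ ?_
    · intro a b h
      exact Subtype.ext (smul_left_cancel g (congrArg Subtype.val h))
    · rintro ⟨x, hx⟩
      exact ⟨⟨g⁻¹ • x, by rw [map_smul, hx, inv_smul_smul]⟩,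
        Subtype.ext (smul_inv_smul g x)⟩
    · intro x
      exact (map_smul α g x.1).symm

theorem fibreProd_apply {X Y : FinGSet G} {Q : Type*} [CommMonoid Q] [MulDistribMulAction G Q]
    (f : X →[G] Y) (α : X →[G] Q) (y : Y) :
    fibreProd f α y = ∏ᶠ x : {x : X // f x = y}, α x := rfl

/-- The fixed point functor `𝒫_Q` of a (not necessarily finite) `G`-monoid `Q`. -/
def fixedPoint (Q : Type (u + 1)) [CommMonoid Q] [MulDistribMulAction G Q] : SemiMackey G where
  obj X := X →[G] Q
  res f :=
    { toFun := fun β => β.comp f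
      map_one' := rfl
      map_mul' := fun _ _ => rfl }
  tr f :=
    { toFun := fun α => fibreProd f α
      map_one' := MulActionHom.ext fun y => by
        rw [fibreProd_apply]
        exact finprod_one
      map_mul' := fun α β => MulActionHom.ext fun y => by
        change _ = fibreProd f α y * fibreProd f β y
        simp only [fibreProd_apply]
        exact finprod_mul_distrib (Set.toFinite _) (Set.toFinite _) }
  res_id _ _ := rfl
  res_comp _ _ _ := rfl
  tr_id X α := MulActionHom.ext fun y => by
    change fibreProd _ α y = _
    rw [fibreProd_apply]
    have : Unique {x : X // (MulActionHom.id G : X →[G] X) x = y} :=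
      ⟨⟨⟨y, rfl⟩⟩, fun x => Subtype.ext x.2⟩
    rw [finprod_unique]
    exact congrArg α (default : {x : X // (MulActionHom.id G : X →[G] X) x = y}).2
  tr_comp {X Y Z} f g α := MulActionHom.ext fun z => by
    classical
    let _ := Fintype.ofFinite X
    let _ := Fintype.ofFinite Y
    change fibreProd _ α z = fibreProd g (fibreProd f α) z
    simp only [fibreProd_apply]
    simp only [finprod_eq_prod_of_fintype]
    rw [← Fintype.prod_sigma']
    symm
    refine Fintype.prod_bijective
      (fun w : (Σ y : {y : Y // g y = z}, {x : X // f x = y.1}) =>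
        (⟨w.2.1, by
          rw [MulActionHom.comp_apply, w.2.2, w.1.2]⟩ : {x : X // (g.comp f) x = z}))
      ⟨?_, ?_⟩ _ _ (fun _ => rfl)
    · rintro ⟨⟨y, hy⟩, ⟨x, hx⟩⟩ ⟨⟨y', hy'⟩, ⟨x', hx'⟩⟩ h
      obtain rfl : x = x' := congrArg Subtype.val h
      obtain rfl : y = y' := hx.symm.trans hx'
      rfl
    · rintro ⟨x, hx⟩
      exact ⟨⟨⟨f x, hx⟩, ⟨x, rfl⟩⟩, rfl⟩
  additive_empty X hX := ⟨fun α β => MulActionHom.ext fun x => (hX.false x).elim⟩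
  additive_sum X Y := by
    refine ⟨fun α β h => MulActionHom.ext ?_, fun ⟨α, β⟩ => ?_⟩
    · rintro (x | y)
      · exact DFunLike.congr_fun (congrArg Prod.fst h) x
      · exact DFunLike.congr_fun (congrArg Prod.snd h) y
    · refine ⟨⟨Sum.elim α β, ?_⟩, rfl⟩
      rintro g (x | y)
      · exact map_smul α g x
      · exact map_smul β g y
  mackey {X Y X' Y'} f' x y f h m := MulActionHom.ext fun a => by
    change fibreProd x (m.comp f') a = fibreProd y m (f a)
    simp only [fibreProd_apply]
    refine finprod_eq_of_bijective
      (fun c : {c : X' // x c = a} => (⟨f' c.1, by rw [← h.1, c.2]⟩ :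
        {b : Y' // y b = f a})) ⟨?_, ?_⟩ (fun _ => rfl)
    · rintro ⟨c, hc⟩ ⟨d, hd⟩ hcd
      obtain ⟨w, -, hw⟩ := h.2 a (f' c) (by rw [← h.1, hc])
      exact Subtype.ext ((hw c ⟨hc, rfl⟩).trans
        (hw d ⟨hd, (congrArg Subtype.val hcd).symm⟩).symm)
    · rintro ⟨b, hb⟩
      obtain ⟨w, hw, -⟩ := h.2 a b hb.symm
      exact ⟨⟨w, hw.1⟩, Subtype.ext hw.2⟩

/-- A finite `G`-monoid: a finite commutative monoid on which `G` acts by monoid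
automorphisms. -/
structure FinGMon (G : Type u) [Group G] where
  carrier : Type u
  [finite : Finite carrier]
  [mon : CommMonoid carrier]
  [action : MulDistribMulAction G carrier]

namespace FinGMon

instance : CoeSort (FinGMon G) (Type u) := ⟨FinGMon.carrier⟩

attribute [instance] FinGMon.finite FinGMon.mon FinGMon.action

/-- A morphism of `G`-monoids. -/
@[ext]
structure Hom (Q R : FinGMon G) where
  toFun : Q →* R
  map_smul : ∀ (g : G) (x : Q), toFun (g • x) = g • toFun x

instance : Category (FinGMon G) where
  Hom := Hom
  id Q := ⟨MonoidHom.id Q, fun _ _ => rfl⟩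
  comp φ ψ := ⟨ψ.toFun.comp φ.toFun, fun g x => by simp [φ.map_smul, ψ.map_smul]⟩

/-- The underlying finite `G`-set. -/
def toSet (Q : FinGMon G) : FinGSet G where
  carrier := Q

end FinGMon

/-- The functor `Q ↦ 𝒫_Q` on finite `G`-monoids. -/
def fixedPointFunctor (G : Type u) [Group G] : FinGMon G ⥤ SemiMackey G where
  obj Q := fixedPoint (ULift.{u + 1} Q)
  map {Q R} φ :=
    { app := fun X =>
        { toFun := fun (α : X →[G] ULift.{u + 1} Q) =>
            (⟨fun x => ULift.up (FinGMon.Hom.toFun φ (α x).down), fun g x => by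
              rw [map_smul]
              exact congrArg ULift.up (FinGMon.Hom.map_smul φ g (α x).down)⟩ :
                X →[G] ULift.{u + 1} R)
          map_one' := MulActionHom.ext fun x =>
            congrArg ULift.up (map_one (FinGMon.Hom.toFun φ))
          map_mul' := fun α β => MulActionHom.ext fun x =>
            congrArg ULift.up (map_mul (FinGMon.Hom.toFun φ) _ _) }
      res_app := fun _ _ => rfl
      tr_app := fun {X Y} f (α : X →[G] ULift.{u + 1} Q) => MulActionHom.ext fun y => by
        have h := MonoidHom.map_finprod (f := fun x : {x : X // f x = y} => α x)
          ((MulEquiv.ulift.symm.toMonoidHom.comp (FinGMon.Hom.toFun φ)).comp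
            MulEquiv.ulift.toMonoidHom : ULift.{u + 1} Q →* ULift.{u + 1} R) (Set.toFinite _)
        exact h }
  map_id _ := rfl
  map_comp _ _ := rfl

/-- The product `X × Q`. -/
def timesSet (X Q : FinGSet G) : FinGSet G where
  carrier := X × Q

/-- `f × Q : X × Q → Y × Q`. -/
def timesMap {X Y : FinGSet G} (f : X →[G] Y) (Q : FinGSet G) :
    timesSet X Q →[G] timesSet Y Q where
  toFun z := (f z.1, z.2)
  map_smul' g z := Prod.ext (map_smul f g z.1) rfl

/-- The projection `p_X : X × Q → X`. -/
def timesFst (X Q : FinGSet G) : timesSet X Q →[G] X where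
  toFun z := z.1
  map_smul' _ _ := rfl

/-- The projection `p_Q : X × Q → Q`. -/
def timesSnd (X : FinGSet G) (Q : FinGMon G) : timesSet X Q.toSet →[G] Q where
  toFun z := z.2
  map_smul' _ _ := rfl

/-- `μ_f : Π_f(X × Q) → Y × Q`, `μ_f(y, σ) = (y, ∏_{x ∈ f⁻¹(y)} p_Q(σ(x)))`. -/
def dressMu {X Y : FinGSet G} (Q : FinGMon G) (f : X →[G] Y) :
    piSet f (timesFst X Q.toSet) →[G] timesSet Y Q.toSet where
  toFun s := (FibreSection.base s,
    (∏ᶠ x : {x : X // f x = FibreSection.base s},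
      timesSnd X Q (FibreSection.sec s x.1 x.2) : Q.carrier))
  map_smul' g s := by
    refine Prod.ext rfl ?_
    change _ = MulDistribMulAction.toMonoidHom Q.carrier g _
    rw [MonoidHom.map_finprod _ (Set.toFinite _)]
    symm
    refine finprod_eq_of_bijective
      (fun x : {x : X // f x = FibreSection.base s} =>
        (⟨g • x.1, by rw [map_smul, x.2]; rfl⟩ :
          {x : X // f x = FibreSection.base (g • s)})) ⟨?_, ?_⟩ ?_
    · intro a b h
      exact Subtype.ext (smul_left_cancel g (congrArg Subtype.val h))
    · rintro ⟨x, hx⟩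
      exact ⟨⟨g⁻¹ • x, by
          rw [map_smul, hx]
          exact inv_smul_smul g (FibreSection.base s)⟩,
        Subtype.ext (smul_inv_smul g x)⟩
    · intro x
      change g • timesSnd X Q (FibreSection.sec s x.1 x.2) =
        timesSnd X Q (g • FibreSection.sec s (g⁻¹ • g • x.1) _)
      rw [map_smul]
      exact congrArg _ (congrArg _ (FibreSection.sec_congr _ (inv_smul_smul g _).symm _ _))

/-- Sets with restrictions and additive and multiplicative transfers: the data of a Tambara
functor, without its laws. -/
structure TamData (G : Type u) [Group G] where
  obj : FinGSet G → Type (u + 1)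
  res : ∀ {X Y : FinGSet G}, (X →[G] Y) → obj Y → obj X
  tr : ∀ {X Y : FinGSet G}, (X →[G] Y) → obj X → obj Y
  nm : ∀ {X Y : FinGSet G}, (X →[G] Y) → obj X → obj Y

namespace TamData

/-- Maps of values compatible with all structure morphisms. -/
@[ext]
structure Hom (T S : TamData G) where
  app : ∀ X, T.obj X → S.obj X
  res_app : ∀ {X Y : FinGSet G} (f : X →[G] Y) (a : T.obj Y),
    app X (T.res f a) = S.res f (app Y a)
  tr_app : ∀ {X Y : FinGSet G} (f : X →[G] Y) (a : T.obj X),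
    app Y (T.tr f a) = S.tr f (app X a)
  nm_app : ∀ {X Y : FinGSet G} (f : X →[G] Y) (a : T.obj X),
    app Y (T.nm f a) = S.nm f (app X a)

instance : Category (TamData G) where
  Hom := Hom
  id T :=
    { app := fun _ a => a
      res_app := fun _ _ => rfl
      tr_app := fun _ _ => rfl
      nm_app := fun _ _ => rfl }
  comp φ ψ :=
    { app := fun X a => ψ.app X (φ.app X a)
      res_app := fun f m => by simp [φ.res_app, ψ.res_app]
      tr_app := fun f m => by simp [φ.tr_app, ψ.tr_app]
      nm_app := fun f m => by simp [φ.nm_app, ψ.nm_app] }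

end TamData

/-- The underlying data of a Tambara functor. The ring structures on the values are determined
by these data, so isomorphisms of data between Tambara functors are isomorphisms of Tambara
functors, and data isomorphic to those of a Tambara functor form a Tambara functor. -/
def Tambara.toData (T : Tambara G) : TamData G where
  obj := T.obj
  res f := T.res f
  tr f := T.tr f
  nm f := T.nm f

/-- The Dress construction `T_Q`: `T_Q(X) = T(X × Q)` with `f^* = T^*(f × Q)`,
`f_+ = T_+(f × Q)` and `f_• = T_+(μ_f) ∘ T_•(f') ∘ T^*(e)`. -/
def dress (T : Tambara G) (Q : FinGMon G) : TamData G where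
  obj X := T.obj (timesSet X Q.toSet)
  res f a := T.res (timesMap f Q.toSet) a
  tr f a := T.tr (timesMap f Q.toSet) a
  nm {X _} f a := T.tr (dressMu Q f) (T.nm (piPull f (timesFst X Q.toSet))
    (T.res (piEval f (timesFst X Q.toSet)) a))

/-- `X × φ : X × Q → X × R` for a morphism `φ : Q → R` of finite `G`-monoids. -/
def timesRight (X : FinGSet G) {Q R : FinGMon G} (φ : Q ⟶ R) :
    timesSet X Q.toSet →[G] timesSet X R.toSet where
  toFun z := (z.1, FinGMon.Hom.toFun φ z.2)
  map_smul' g z := Prod.ext rfl (FinGMon.Hom.map_smul φ g z.2)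

/-- The map `T_Q(X) → T'_R(X)` induced by `τ : T ⟶ T'` and `φ : Q ⟶ R`. -/
def dressMap {T T' : Tambara G} (τ : T ⟶ T') {Q R : FinGMon G} (φ : Q ⟶ R) (X : FinGSet G)
    (a : (dress T Q).obj X) : (dress T' R).obj X :=
  T'.tr (timesRight X φ) (τ.app (timesSet X Q.toSet) a)

/-- `i` is an isomorphism `T_Q ≅ F(T, 𝒫_Q)`, natural in the Tambara functor `T` and in the finite
`G`-monoid `Q`. -/
def IsNaturalDress (F : Tambara G × SemiMackey G ⥤ Tambara G)
    (i : ∀ (T : Tambara G) (Q : FinGMon G),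
      dress T Q ≅ (F.obj (T, (fixedPointFunctor G).obj Q)).toData) : Prop :=
  ∀ {T T' : Tambara G} (τ : T ⟶ T') {Q R : FinGMon G} (φ : Q ⟶ R) (X : FinGSet G)
    (a : (dress T Q).obj X),
    (i T' R).hom.app X (dressMap τ φ X a) =
      (F.map (X := (T, (fixedPointFunctor G).obj Q)) (Y := (T', (fixedPointFunctor G).obj R))
        (τ ×ₘ (fixedPointFunctor G).map φ)).app X ((i T Q).hom.app X a)

end Dress

/-! ### The trivial group and semi-group rings -/

/-- Evaluation of semi-Mackey functors at the one-point set. -/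
def evMon (G : Type u) [Group G] : SemiMackey G ⥤ CommMonCat.{u + 1} where
  obj M := CommMonCat.of (M.obj (point G))
  map φ := CommMonCat.ofHom (SemiMackey.Hom.app φ (point G))
  map_id _ := rfl
  map_comp _ _ := rfl

/-- Evaluation of Tambara functors at the one-point set. -/
def evRing (G : Type u) [Group G] : Tambara G ⥤ CommRingCat.{u + 1} where
  obj T := CommRingCat.of (T.obj (point G))
  map φ := CommRingCat.ofHom (Tambara.Hom.app φ (point G))
  map_id _ := rfl
  map_comp _ _ := rfl

/-- The ring homomorphism `R[M] → S[N]` induced by `f : R → S` and `g : M → N`. -/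
def semigroupRingMap {R S M N : Type*} [CommRing R] [CommRing S] [CommMonoid M] [CommMonoid N]
    (f : R →+* S) (g : M →* N) : MonoidAlgebra R M →+* MonoidAlgebra S N :=
  (MonoidAlgebra.mapDomainRingHom S g).comp (MonoidAlgebra.mapRingHom M f)

theorem semigroupRingMap_single {R S M N : Type*} [CommRing R] [CommRing S] [CommMonoid M]
    [CommMonoid N] (f : R →+* S) (g : M →* N) (m : M) (r : R) :
    semigroupRingMap f g (MonoidAlgebra.single m r) = MonoidAlgebra.single (g m) (f r) := by
  simp [semigroupRingMap]

/-- The functor `(R, Q) ↦ R[Q]` taking semi-group rings with coefficients. -/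
def semigroupRing : CommRingCat.{u + 1} × CommMonCat.{u + 1} ⥤ CommRingCat.{u + 1} where
  obj P := CommRingCat.of (MonoidAlgebra P.1 P.2)
  map φ := CommRingCat.ofHom (semigroupRingMap φ.1.hom φ.2.hom)
  map_id P := by
    refine CommRingCat.hom_ext (MonoidAlgebra.ringHom_ext (fun r => ?_) (fun m => ?_))
    all_goals exact semigroupRingMap_single _ _ _ _
  map_comp φ ψ := by
    refine CommRingCat.hom_ext (MonoidAlgebra.ringHom_ext (fun r => ?_) (fun m => ?_))
    all_goals
      refine (semigroupRingMap_single _ _ _ _).trans (Eq.symm ?_)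
      exact (congrArg (semigroupRingMap ψ.1.hom ψ.2.hom)
        (semigroupRingMap_single φ.1.hom φ.2.hom _ _)).trans (semigroupRingMap_single _ _ _ _)

end GBivariant

end

open GBivariant

/-!
# `T`-Tambara functors of the form `T[M]`

The proof does not start from the tensor product. For a Tambara functor `T` and a semi-Mackey
functor `M`, let `T[M](X)` be the set of triples `(p : A → X, t ∈ T(A), m ∈ M(A))` modulo the
relation `(q ∘ a, t, a^* m) ∼ (q, a_+ t, m)` for `a : A → B` over `X` (`Ext`). Disjoint unions and
fibre products make it a commutative ring without any group completion: the negative of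
`[t, m]_p` is `[-t, m]_p`. Restriction is pull-back, additive transfer is composition, and
multiplicative transfer is `Π_f`. The same formulas define operations on triples, which respect the
relation. The identities between them hold on triples up to isomorphism (`PairOver.Iso`), except
that `x + (-x) = 0` needs the relation. For `Π_f` this rests on recognising exponential diagrams by
a pointwise universal property (`IsExponential`). Every class is `p_+(t · m)` (`Ext.mk_eq_tr`), so
morphisms `T[M] ⟶ S` are pairs of a morphism `T ⟶ S` and a morphism `M ⟶ S^μ` (`extLift`,
`ext_hom_ext`), which is the adjunction `extAdjunction`.

The Burnside ring functor is realised by marks. Integer functions of orbits over `X` form a Tambara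
functor (`ghostTambara`), in which `f_•` multiplies the values on the orbits of a fibre product, and
the differences of elements `p_+(1)` form a sub-Tambara functor. Closure under `f_•` holds since
multiplicative transfers are polynomial maps: finite differences of high order vanish in every
Tambara functor (`Tambara.fwdDiff_nm`), so `f_•(a - b)` is a universal integer combination of the
elements `f_•(a + k b)` with `k ≥ 0` (`Tambara.exists_nm_sub`). Its values are the Grothendieck
groups because marks distinguish finite `G`-sets (`exists_iso_of_tr_one_eq`). The same formula for
`f_•(a - b)` shows that the Burnside ring functor `Ω` is initial (`fromBurnside`,
`burnside_hom_ext`), and hence that `Ω[M]` is the Tambarization of `M`.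

The identification `(T ⊗_Ω Ω[M])(X) = T[M](X)` sends `t ⊗ s` in the summand of `p` to `p_+(t · s)`
and has the inverse `[t, m]_p ↦ [t ⊗ m]_p`: the relation that defines `T[M](X)` is one of the two
relations of the tensor product, and the other follows as `Ω[M]` is generated by the elements
`c_+(m)` (`tensorEquiv`). The Dress construction is `t ↦ [t, p_Q]` with the inverse
`[t, m]_p ↦ (p, m)_+ t` (`dressIso`). Over the trivial group an element of `M(X)` is the family of
its values at the points of `X` and transfers are fibrewise products (`SemiMackey.valuesEquiv`,
`SemiMackey.res_pt_tr`), so that `T[M](pt)` is the semi-group ring (`semigroupEquiv`).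
-/

noncomputable section

namespace GBivariant

variable {G : Type u} [Group G]

namespace FinGSet

/-! ### Maps of finite `G`-sets -/

instance (X Y : FinGSet G) : Finite (X →[G] Y) :=
  Finite.of_injective (fun f : X →[G] Y => (f : X → Y)) DFunLike.coe_injective

/-- The map into a fibre product with given components. -/
def pbLift {X Y B Z : FinGSet G} {f : X →[G] Y} {q : B →[G] Y} (u : Z →[G] X) (v : Z →[G] B)
    (h : ∀ z, f (u z) = q (v z)) : Z →[G] pb f q where
  toFun z := ⟨(u z, v z), h z⟩
  map_smul' g z := Subtype.ext (Prod.ext (map_smul u g z) (map_smul v g z))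

/-- The map out of a disjoint union with given components. -/
def desc {A B X : FinGSet G} (u : A →[G] X) (v : B →[G] X) : A.sum B →[G] X where
  toFun := Sum.elim u v
  map_smul' g z := by
    rcases z with a | b
    · exact map_smul u g a
    · exact map_smul v g b

theorem desc_comp {A B X Y : FinGSet G} (u : A →[G] X) (v : B →[G] X) (f : X →[G] Y) :
    f.comp (desc u v) = desc (f.comp u) (f.comp v) := by
  ext z; rcases z with a | b <;> rfl

theorem sum_hom_ext {A B X : FinGSet G} {u v : A.sum B →[G] X}
    (hl : u.comp (inl A B) = v.comp (inl A B)) (hr : u.comp (inr A B) = v.comp (inr A B)) :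
    u = v := by
  ext z
  rcases z with a | b
  · exact DFunLike.congr_fun hl a
  · exact DFunLike.congr_fun hr b

/-- The map of disjoint unions induced by two maps. -/
def sumMap {A B A' B' : FinGSet G} (u : A →[G] A') (v : B →[G] B') : A.sum B →[G] A'.sum B' :=
  desc ((inl A' B').comp u) ((inr A' B').comp v)

/-- The empty `G`-set. -/
def empty (G : Type u) [Group G] : FinGSet G :=
  letI : MulAction G PEmpty.{u + 1} :=
    { smul := fun _ x => x, one_smul := fun _ => rfl, mul_smul := fun _ _ _ => rfl }
  { carrier := PEmpty.{u + 1} }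

instance : IsEmpty (empty G) := inferInstanceAs (IsEmpty PEmpty)

/-- The map out of an empty `G`-set. -/
def elim (E X : FinGSet G) [h : IsEmpty E] : E →[G] X where
  toFun x := h.elim x
  map_smul' _ x := h.elim x

/-- The invariant subset of the points satisfying an invariant predicate. -/
def sub (X : FinGSet G) (P : X → Prop) (hP : ∀ (g : G) x, P x → P (g • x)) : FinGSet G :=
  letI : MulAction G {x : X // P x} :=
    { smul := fun g x => ⟨g • x.1, hP g x.1 x.2⟩
      one_smul := fun x => Subtype.ext (one_smul G x.1)
      mul_smul := fun g h x => Subtype.ext (mul_smul g h x.1) }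
  { carrier := {x : X // P x} }

/-- The inclusion of an invariant subset. -/
def subVal (X : FinGSet G) (P : X → Prop) (hP : ∀ (g : G) x, P x → P (g • x)) :
    X.sub P hP →[G] X where
  toFun x := x.1
  map_smul' _ _ := rfl

/-- The inverse of a bijective equivariant map. -/
def inv {X Y : FinGSet G} (a : X →[G] Y) (ha : Function.Bijective a) : Y →[G] X :=
  a.inverse (Equiv.ofBijective a ha).symm (Equiv.ofBijective a ha).left_inv
    (Equiv.ofBijective a ha).right_inv

@[simp]
theorem apply_inv {X Y : FinGSet G} (a : X →[G] Y) (ha : Function.Bijective a) (y : Y) :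
    a (inv a ha y) = y :=
  (Equiv.ofBijective a ha).right_inv y

@[simp]
theorem inv_apply {X Y : FinGSet G} (a : X →[G] Y) (ha : Function.Bijective a) (x : X) :
    inv a ha (a x) = x :=
  (Equiv.ofBijective a ha).left_inv x

theorem bijective_of_inverse {X Y : FinGSet G} (a : X →[G] Y) (b : Y → X)
    (h₁ : ∀ x, b (a x) = x) (h₂ : ∀ y, a (b y) = y) : Function.Bijective a :=
  Function.bijective_iff_has_inverse.2 ⟨b, h₁, h₂⟩

/-! ### Pull-back squares -/

theorem isPullbackSquare_pb {X Y B : FinGSet G} (f : X →[G] Y) (q : B →[G] Y) :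
    IsPullbackSquare (pbSnd f q) (pbFst f q) q f :=
  ⟨fun c => c.2, fun a b h => ⟨⟨(a, b), h⟩, ⟨rfl, rfl⟩,
    fun _ hc => Subtype.ext (Prod.ext hc.1 hc.2)⟩⟩

theorem IsPullbackSquare.symm {X Y X' Y' : FinGSet G} {f' : X' →[G] Y'} {x : X' →[G] X}
    {y : Y' →[G] Y} {f : X →[G] Y} (h : IsPullbackSquare f' x y f) :
    IsPullbackSquare x f' f y :=
  ⟨fun c => (h.1 c).symm, fun a b e => by
    obtain ⟨c, hc, hu⟩ := h.2 b a e.symm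
    exact ⟨c, hc.symm, fun d hd => hu d hd.symm⟩⟩

theorem IsPullbackSquare.hom_ext {X Y X' Y' : FinGSet G} {f' : X' →[G] Y'} {x : X' →[G] X}
    {y : Y' →[G] Y} {f : X →[G] Y} (h : IsPullbackSquare f' x y f) {c d : X'}
    (h₁ : x c = x d) (h₂ : f' c = f' d) : c = d := by
  obtain ⟨e, -, he⟩ := h.2 (x d) (f' d) (h.1 d)
  exact (he c ⟨h₁, h₂⟩).trans (he d ⟨rfl, rfl⟩).symm

theorem isPullbackSquare_of_bijective {A B : FinGSet G} (a : A →[G] B)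
    (ha : Function.Bijective a) :
    IsPullbackSquare a a (MulActionHom.id G) (MulActionHom.id G) :=
  ⟨fun _ => rfl, fun c d h => by
    obtain rfl : c = d := h
    obtain ⟨x, rfl⟩ := ha.2 c
    exact ⟨x, ⟨rfl, rfl⟩, fun _ he => ha.1 he.1⟩⟩

/-- An injective map is its own pull-back along itself. -/
theorem isPullbackSquare_of_injective {A B : FinGSet G} (a : A →[G] B)
    (ha : Function.Injective a) :
    IsPullbackSquare (MulActionHom.id G) (MulActionHom.id G) a a :=
  ⟨fun _ => rfl, fun c _ h => ⟨c, ⟨rfl, ha h⟩, fun _ he => he.1⟩⟩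

/-- Two maps with disjoint images have empty fibre product. -/
theorem isPullbackSquare_of_disjoint {A B X : FinGSet G} (a : A →[G] X) (b : B →[G] X)
    (h : ∀ x y, a x ≠ b y) :
    IsPullbackSquare (elim (empty G) B) (elim (empty G) A) b a :=
  ⟨fun c => (isEmptyElim c : _), fun x y e => (h x y e).elim⟩

/-! ### Exponential diagrams -/

/-- The maps `A ← E → P → Y` form an exponential diagram over `A → X → Y`: `E` is the fibre
product of `X` and `P` over `Y`, and for every `y` the points of `P` over `y` correspond to the
sections of `p` over `f⁻¹(y)`. The pair `Π_f(A)`, `X ×_Y Π_f(A)` is the standard example. -/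
structure IsExponential {X Y A P E : FinGSet G} (f : X →[G] Y) (p : A →[G] X) (π : P →[G] Y)
    (e : E →[G] A) (f' : E →[G] P) : Prop where
  sq : IsPullbackSquare f' (p.comp e) π f
  univ : ∀ (y : Y) (σ : ∀ x, f x = y → A), (∀ x h, p (σ x h) = x) →
    ∃! b : P, π b = y ∧ ∀ c, f' c = b → ∀ h, e c = σ (p (e c)) h

theorem isExponential_piSet {X Y A : FinGSet G} (f : X →[G] Y) (p : A →[G] X) :
    IsExponential f p (piProj f p) (piEval f p) (piPull f p) where
  sq := by
    have h : p.comp (piEval f p) = pbFst f (piProj f p) :=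
      MulActionHom.ext fun z => FibreSection.proj_sec z.1.2 z.1.1 z.2
    rw [h]
    exact isPullbackSquare_pb f (piProj f p)
  univ y σ hσ := by
    refine ⟨(⟨y, σ, hσ⟩ : FibreSection f p), ⟨rfl, ?_⟩, ?_⟩
    · rintro ⟨⟨x, s⟩, hx⟩ (rfl : s = _) h
      change σ x hx = σ (p (σ x hx)) h
      have : ∀ x' (e : x' = x) h', σ x hx = σ x' h' := by rintro _ rfl _; rfl
      exact this _ (hσ x hx) h
    · rintro s ⟨hb, hs⟩
      refine FibreSection.ext' hb fun x h h' => ?_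
      have h2 := hs ⟨(x, s), h⟩ rfl (by
        change f (p (FibreSection.sec s x h)) = y
        exact (congrArg f (FibreSection.proj_sec s x h)).trans h')
      refine h2.trans ?_
      have : ∀ x' (e : x' = x) h'', σ x' h'' = σ x h' := by rintro _ rfl _; rfl
      exact this _ (FibreSection.proj_sec s x h) _

namespace IsExponential

variable {X Y A P E : FinGSet G} {f : X →[G] Y} {p : A →[G] X} {π : P →[G] Y} {e : E →[G] A}
  {f' : E →[G] P}

/-- The section of `p` over `f⁻¹(π b)` that a point `b` of `P` stands for. -/
def sec (h : IsExponential f p π e f') (b : P) (x : X) (hx : f x = π b) : A :=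
  e (h.sq.2 x b hx).choose

theorem sec_eq (h : IsExponential f p π e f') (c : E) (x : X) (hx : f x = π (f' c))
    (hc : p (e c) = x) : h.sec (f' c) x hx = e c := by
  have h1 := (h.sq.2 x (f' c) hx).choose_spec
  exact congrArg e (h1.2 c ⟨hc, rfl⟩).symm

theorem proj_sec (h : IsExponential f p π e f') (b : P) (x : X) (hx : f x = π b) :
    p (h.sec b x hx) = x :=
  (h.sq.2 x b hx).choose_spec.1.1

theorem sec_congr (h : IsExponential f p π e f') {b : P} {x x' : X} (hxx : x = x')
    (hx : f x = π b) (hx' : f x' = π b) : h.sec b x hx = h.sec b x' hx' := by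
  subst hxx; rfl

theorem smul_sec (h : IsExponential f p π e f') (g : G) (b : P) (x : X) (hx : f x = π b)
    (hx' : f (g • x) = π (g • b)) : h.sec (g • b) (g • x) hx' = g • h.sec b x hx := by
  obtain ⟨c, ⟨rfl, rfl⟩, -⟩ := h.sq.2 x b hx
  refine Eq.trans ?_ (congrArg (g • ·) (h.sec_eq c _ hx rfl).symm)
  have key : ∀ b' (hb : b' = f' (g • c)) hh,
      h.sec b' (g • (p.comp e) c) hh = e (g • c) := by
    rintro _ rfl hh
    refine h.sec_eq (g • c) _ _ ?_
    rw [map_smul, map_smul]; rfl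
  exact (key _ (map_smul f' g c).symm hx').trans (map_smul e g c)

/-- The comparison of `P` with `Π_f(A)`. -/
def toPi (h : IsExponential f p π e f') : P →[G] piSet f p where
  toFun b := (⟨π b, h.sec b, h.proj_sec b⟩ : FibreSection f p)
  map_smul' g b := by
    refine FibreSection.ext' (map_smul π g b) fun x hx hx' => ?_
    have hb : f (g⁻¹ • x) = π b := by
      rw [map_smul, inv_smul_eq_iff, ← map_smul]; exact hx
    have hx'' : f (g • g⁻¹ • x) = π (g • b) := by rw [smul_inv_smul]; exact hx
    exact (h.sec_congr (smul_inv_smul g x).symm hx hx'').trans (h.smul_sec g b _ hb hx'')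

/-- An exponential diagram is isomorphic to the standard one. -/
theorem toPi_bijective (h : IsExponential f p π e f') : Function.Bijective h.toPi := by
  constructor
  · intro b b' hb
    have hπ : π b = π b' := congrArg FibreSection.base hb
    obtain ⟨d, -, hd⟩ := h.univ (π b) (h.sec b) (h.proj_sec b)
    have key : ∀ b₁ : P, h.toPi b = h.toPi b₁ → b₁ = d := by
      intro b₁ hb₁
      have hπ₁ : π b = π b₁ := congrArg FibreSection.base hb₁
      refine hd b₁ ⟨hπ₁.symm, ?_⟩
      rintro c rfl hc
      have h3 : ∀ (s t : FibreSection f p) (_ : s = t) x hs ht, s.sec x hs = t.sec x ht := by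
        rintro s _ rfl x _ _; rfl
      exact (h3 _ _ hb₁ (p (e c)) hc (hc.trans hπ₁) |>.trans (h.sec_eq c _ (hc.trans hπ₁) rfl)).symm
    exact (key b rfl).trans (key b' hb).symm
  · intro s
    obtain ⟨b, ⟨hb, hs⟩, -⟩ := h.univ (FibreSection.base s) (FibreSection.sec s)
      (FibreSection.proj_sec s)
    refine ⟨b, FibreSection.ext' hb fun x hx hx' => ?_⟩
    obtain ⟨c, ⟨rfl, rfl⟩, -⟩ := h.sq.2 x b hx
    exact (h.sec_eq c _ hx rfl).trans (hs c rfl hx')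

/-- The comparison of `E` with `X ×_Y Π_f(A)`. -/
def toPb (h : IsExponential f p π e f') : E →[G] pb f (piProj f p) :=
  pbLift (p.comp e) (h.toPi.comp f') h.sq.1

theorem eval_comp_toPb (h : IsExponential f p π e f') : (piEval f p).comp h.toPb = e :=
  MulActionHom.ext fun c => h.sec_eq c _ (h.sq.1 c) rfl

theorem isPullbackSquare_toPb (h : IsExponential f p π e f') :
    IsPullbackSquare h.toPb f' (piPull f p) h.toPi := by
  refine ⟨fun _ => rfl, ?_⟩
  rintro b ⟨⟨x, s⟩, hx⟩ (hb : h.toPi b = s)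
  subst hb
  obtain ⟨c, ⟨hc₁, hc₂⟩, hu⟩ := h.sq.2 x b hx
  refine ⟨c, ⟨hc₂, Subtype.ext (Prod.ext hc₁ (congrArg h.toPi hc₂))⟩, ?_⟩
  rintro d ⟨hd₁, hd₂⟩
  exact hu d ⟨congrArg (fun z => z.1.1) hd₂, hd₁⟩

end IsExponential

end FinGSet

open FinGSet

/-! ### Calculus in semi-Mackey functors -/

namespace SemiMackey

variable (M : SemiMackey G)

theorem res_congr {X Y : FinGSet G} {f g : X →[G] Y} (h : ∀ x, f x = g x) (m : M.obj Y) :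
    M.res f m = M.res g m := by
  rw [MulActionHom.ext h]

theorem res_res {X Y Z : FinGSet G} (f : X →[G] Y) (g : Y →[G] Z) (m : M.obj Z) :
    M.res f (M.res g m) = M.res (g.comp f) m := (M.res_comp f g m).symm

theorem res_res_eq {X Y Y' Z : FinGSet G} {f : X →[G] Y} {g : Y →[G] Z} {f' : X →[G] Y'}
    {g' : Y' →[G] Z} (h : ∀ x, g (f x) = g' (f' x)) (m : M.obj Z) :
    M.res f (M.res g m) = M.res f' (M.res g' m) := by
  rw [res_res, res_res]
  exact M.res_congr h m

theorem res_res_of {X Y Z : FinGSet G} {f : X →[G] Y} {g : Y →[G] Z} {k : X →[G] Z}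
    (h : ∀ x, g (f x) = k x) (m : M.obj Z) : M.res f (M.res g m) = M.res k m := by
  rw [res_res]
  exact M.res_congr h m

theorem res_tr_of_injective {X Y : FinGSet G} (a : X →[G] Y) (ha : Function.Injective a)
    (m : M.obj X) : M.res a (M.tr a m) = m := by
  rw [← M.mackey _ _ _ _ (isPullbackSquare_of_injective a ha), M.tr_id, M.res_id]

theorem tr_res_of_bijective {X Y : FinGSet G} (a : X →[G] Y) (ha : Function.Bijective a)
    (m : M.obj Y) : M.tr a (M.res a m) = m := by
  rw [M.mackey _ _ _ _ (isPullbackSquare_of_bijective a ha), M.tr_id, M.res_id]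

theorem eq_of_isEmpty {X : FinGSet G} [h : IsEmpty X] (m n : M.obj X) : m = n :=
  (M.additive_empty X h).elim m n

theorem res_tr_of_disjoint {A B X : FinGSet G} (a : A →[G] X) (b : B →[G] X)
    (h : ∀ x y, a x ≠ b y) (m : M.obj B) : M.res a (M.tr b m) = 1 := by
  rw [← M.mackey _ _ _ _ (isPullbackSquare_of_disjoint a b h),
    M.eq_of_isEmpty (M.res _ m) 1, map_one]

theorem sum_ext {A B : FinGSet G} {m n : M.obj (A.sum B)}
    (hl : M.res (inl A B) m = M.res (inl A B) n) (hr : M.res (inr A B) m = M.res (inr A B) n) :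
    m = n :=
  (M.additive_sum A B).1 (Prod.ext hl hr)

theorem inl_injective (A B : FinGSet G) : Function.Injective (inl A B) := Sum.inl_injective

theorem inr_injective (A B : FinGSet G) : Function.Injective (inr A B) := Sum.inr_injective

/-- The element of `M(A ⊔ B)` with given restrictions. -/
def pair {A B : FinGSet G} (m : M.obj A) (n : M.obj B) : M.obj (A.sum B) :=
  M.tr (inl A B) m * M.tr (inr A B) n

@[simp]
theorem res_inl_pair {A B : FinGSet G} (m : M.obj A) (n : M.obj B) :
    M.res (inl A B) (M.pair m n) = m := by
  rw [pair, map_mul, M.res_tr_of_injective _ (inl_injective A B),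
    M.res_tr_of_disjoint _ _ (fun _ _ h => Sum.inl_ne_inr h), mul_one]

@[simp]
theorem res_inr_pair {A B : FinGSet G} (m : M.obj A) (n : M.obj B) :
    M.res (inr A B) (M.pair m n) = n := by
  rw [pair, map_mul, M.res_tr_of_injective _ (inr_injective A B),
    M.res_tr_of_disjoint _ _ (fun _ _ h => Sum.inr_ne_inl h), one_mul]

theorem pair_res {A B : FinGSet G} (m : M.obj (A.sum B)) :
    M.pair (M.res (inl A B) m) (M.res (inr A B) m) = m :=
  M.sum_ext (by simp) (by simp)

theorem tr_desc {A B X : FinGSet G} (u : A →[G] X) (v : B →[G] X) (m : M.obj (A.sum B)) :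
    M.tr (desc u v) m = M.tr u (M.res (inl A B) m) * M.tr v (M.res (inr A B) m) := by
  conv_lhs => rw [← M.pair_res m]
  rw [pair, map_mul, ← M.tr_comp, ← M.tr_comp]
  rfl

/-- The norm of the exponential diagram does not depend on the diagram. -/
theorem res_toPi {X Y A P E : FinGSet G} {f : X →[G] Y} {p : A →[G] X} {π : P →[G] Y}
    {e : E →[G] A} {f' : E →[G] P} (h : IsExponential f p π e f') (m : M.obj A) :
    M.res h.toPi (M.tr (piPull f p) (M.res (piEval f p) m)) = M.tr f' (M.res e m) := by
  rw [← M.mackey _ _ _ _ h.isPullbackSquare_toPb, M.res_res, h.eval_comp_toPb]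

/-- The product of two semi-Mackey functors. -/
abbrev prod (M N : SemiMackey G) : SemiMackey G where
  obj X := M.obj X × N.obj X
  res f := (M.res f).prodMap (N.res f)
  tr f := (M.tr f).prodMap (N.tr f)
  res_id X m := Prod.ext (M.res_id X m.1) (N.res_id X m.2)
  res_comp f g m := Prod.ext (M.res_comp f g m.1) (N.res_comp f g m.2)
  tr_id X m := Prod.ext (M.tr_id X m.1) (N.tr_id X m.2)
  tr_comp f g m := Prod.ext (M.tr_comp f g m.1) (N.tr_comp f g m.2)
  additive_empty X hX :=
    have := M.additive_empty X hX
    have := N.additive_empty X hX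
    inferInstanceAs (Subsingleton (M.obj X × N.obj X))
  additive_sum X Y := by
    constructor
    · intro m n h
      exact Prod.ext
        (M.sum_ext (congrArg (fun z => z.1.1) h) (congrArg (fun z => z.2.1) h))
        (N.sum_ext (congrArg (fun z => z.1.2) h) (congrArg (fun z => z.2.2) h))
    · rintro ⟨⟨m, n⟩, ⟨m', n'⟩⟩
      refine ⟨(M.pair m m', N.pair n n'), ?_⟩
      change ((M.res _ (M.pair m m'), N.res _ (N.pair n n')),
        (M.res _ (M.pair m m'), N.res _ (N.pair n n'))) = _
      simp
  mackey f' x y f h m := Prod.ext (M.mackey f' x y f h m.1) (N.mackey f' x y f h m.2)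

end SemiMackey

/-! ### Calculus in Tambara functors -/

namespace Tambara

variable (T : Tambara G)

/-- The multiplicative part `(T^*, T_•)`. -/
abbrev mu : SemiMackey G where
  obj := T.obj
  res f := (T.res f).toMonoidHom
  tr f := T.nm f
  res_id := T.res_id
  res_comp := T.res_comp
  tr_id := T.nm_id
  tr_comp := T.nm_comp
  additive_empty := T.additive_empty
  additive_sum := T.additive_sum
  mackey := T.nm_mackey

/-- The additive part `(T^*, T_+)`, in multiplicative notation. -/
def alpha : SemiMackey G where
  obj X := Multiplicative (T.obj X)
  res f := AddMonoidHom.toMultiplicative (T.res f).toAddMonoidHom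
  tr f := AddMonoidHom.toMultiplicative (T.tr f)
  res_id := T.res_id
  res_comp := T.res_comp
  tr_id := T.tr_id
  tr_comp := T.tr_comp
  additive_empty := T.additive_empty
  additive_sum := T.additive_sum
  mackey := T.tr_mackey

theorem res_congr {X Y : FinGSet G} {f g : X →[G] Y} (h : ∀ x, f x = g x) (m : T.obj Y) :
    T.res f m = T.res g m := by
  rw [MulActionHom.ext h]

theorem res_res {X Y Z : FinGSet G} (f : X →[G] Y) (g : Y →[G] Z) (m : T.obj Z) :
    T.res f (T.res g m) = T.res (g.comp f) m := (T.res_comp f g m).symm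

theorem tr_tr {X Y Z : FinGSet G} (f : X →[G] Y) (g : Y →[G] Z) (m : T.obj X) :
    T.tr g (T.tr f m) = T.tr (g.comp f) m := (T.tr_comp f g m).symm

theorem tr_res_of_bijective {X Y : FinGSet G} (a : X →[G] Y) (ha : Function.Bijective a)
    (m : T.obj Y) : T.tr a (T.res a m) = m := T.alpha.tr_res_of_bijective a ha m

theorem sum_ext {A B : FinGSet G} {m n : T.obj (A.sum B)}
    (hl : T.res (inl A B) m = T.res (inl A B) n) (hr : T.res (inr A B) m = T.res (inr A B) n) :
    m = n := T.alpha.sum_ext hl hr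

/-- The element of `T(A ⊔ B)` with given restrictions. -/
def pair {A B : FinGSet G} (s : T.obj A) (t : T.obj B) : T.obj (A.sum B) :=
  T.tr (inl A B) s + T.tr (inr A B) t

@[simp]
theorem res_inl_pair {A B : FinGSet G} (s : T.obj A) (t : T.obj B) :
    T.res (inl A B) (T.pair s t) = s := T.alpha.res_inl_pair s t

@[simp]
theorem res_inr_pair {A B : FinGSet G} (s : T.obj A) (t : T.obj B) :
    T.res (inr A B) (T.pair s t) = t := T.alpha.res_inr_pair s t

theorem mu_pair {A B : FinGSet G} (s : T.obj A) (t : T.obj B) :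
    T.mu.pair s t = T.pair s t :=
  T.sum_ext ((T.mu.res_inl_pair s t).trans (T.res_inl_pair s t).symm)
    ((T.mu.res_inr_pair s t).trans (T.res_inr_pair s t).symm)

theorem tr_desc {A B X : FinGSet G} (u : A →[G] X) (v : B →[G] X) (t : T.obj (A.sum B)) :
    T.tr (desc u v) t = T.tr u (T.res (inl A B) t) + T.tr v (T.res (inr A B) t) :=
  T.alpha.tr_desc u v t

theorem nm_desc {A B X : FinGSet G} (u : A →[G] X) (v : B →[G] X) (t : T.obj (A.sum B)) :
    T.nm (desc u v) t = T.nm u (T.res (inl A B) t) * T.nm v (T.res (inr A B) t) :=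
  T.mu.tr_desc u v t

theorem eq_of_isEmpty {X : FinGSet G} [h : IsEmpty X] (s t : T.obj X) : s = t :=
  (T.additive_empty X h).elim s t

/-- The distributive law for arbitrary exponential diagrams. -/
theorem distrib_of_isExponential {X Y A P E : FinGSet G} {f : X →[G] Y} {p : A →[G] X}
    {π : P →[G] Y} {e : E →[G] A} {f' : E →[G] P} (h : IsExponential f p π e f')
    (a : T.obj A) : T.nm f (T.tr p a) = T.tr π (T.nm f' (T.res e a)) := by
  have h1 : T.res h.toPi (T.nm (piPull f p) (T.res (piEval f p) a)) = T.nm f' (T.res e a) :=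
    T.mu.res_toPi h a
  have h2 := T.tr_comp h.toPi (piProj f p)
    (T.res h.toPi (T.nm (piPull f p) (T.res (piEval f p) a)))
  rw [T.tr_res_of_bijective _ h.toPi_bijective, h1] at h2
  rw [T.distrib]
  exact h2.symm

/-- The dependent product along the fold map `B ⊔ B → B` of `id ⊔ a : B ⊔ A → B ⊔ B` is
`a : A → B`: a section over `b` picks `b` itself and a point of `a⁻¹(b)`. The distributive law of
this diagram is the projection formula. -/
theorem isExponential_fold {A B : FinGSet G} (a : A →[G] B) :
    IsExponential (desc (MulActionHom.id G) (MulActionHom.id G) : B.sum B →[G] B)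
      (sumMap (MulActionHom.id G) a) a (sumMap a (MulActionHom.id G))
      (desc (MulActionHom.id G) (MulActionHom.id G) : A.sum A →[G] A) where
  sq := by
    constructor
    · rintro (x | x) <;> rfl
    · rintro (b | b) x (h : b = a x)
      · subst h
        refine ⟨Sum.inl x, ⟨rfl, rfl⟩, ?_⟩
        rintro (y | y) ⟨h1, h2⟩
        · exact congrArg Sum.inl h2
        · exact (Sum.inr_ne_inl h1).elim
      · subst h
        refine ⟨Sum.inr x, ⟨rfl, rfl⟩, ?_⟩
        rintro (y | y) ⟨h1, h2⟩
        · exact (Sum.inl_ne_inr h1).elim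
        · exact congrArg Sum.inr h2
  univ b σ hσ := by
    have h1 := hσ (Sum.inl b) rfl
    have h2 := hσ (Sum.inr b) rfl
    rcases h3 : σ (Sum.inr b) rfl with x | x
    · rw [h3] at h2
      exact (Sum.inl_ne_inr h2).elim
    · rw [h3] at h2
      have hx : a x = b := Sum.inr_injective h2
      subst hx
      have h4 : σ (Sum.inl (a x)) rfl = Sum.inl (a x) := by
        rcases h5 : σ (Sum.inl (a x)) rfl with y | y
        · rw [h5] at h1
          exact congrArg Sum.inl (Sum.inl_injective h1)
        · rw [h5] at h1
          exact (Sum.inr_ne_inl h1).elim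
      refine ⟨x, ⟨rfl, ?_⟩, ?_⟩
      · rintro (y | y) (rfl : y = x) h
        · exact h4.symm
        · exact h3.symm
      · rintro y ⟨hy, hy'⟩
        have h6 := hy' (Sum.inr y) rfl hy
        have : ∀ b' (hb : b' = a x) hh, σ (Sum.inr b') hh = Sum.inr x := by
          rintro _ rfl _; exact h3
        exact Sum.inr_injective (h6.trans (this _ hy hy))

/-- The projection formula. -/
theorem tr_res_mul {A B : FinGSet G} (a : A →[G] B) (x : T.obj B) (y : T.obj A) :
    T.tr a (T.res a x * y) = x * T.tr a y := by
  have h := T.distrib_of_isExponential (isExponential_fold a) (T.pair x y)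
  rw [nm_desc, nm_desc, T.res_res, T.res_res] at h
  have h1 : T.tr (sumMap (MulActionHom.id G) a) (T.pair x y) = T.pair x (T.tr a y) := by
    rw [sumMap, tr_desc, res_inl_pair, res_inr_pair, T.tr_comp, T.tr_comp, T.tr_id, pair]
  have h2 : (sumMap a (MulActionHom.id G)).comp (inl A A) = (inl B A).comp a := rfl
  have h3 : (sumMap a (MulActionHom.id G)).comp (inr A A) = inr B A := rfl
  rw [h1, h2, h3, ← T.res_res, res_inl_pair, res_inr_pair, res_inl_pair, res_inr_pair,
    T.nm_id, T.nm_id, T.nm_id, T.nm_id] at h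
  exact h.symm

theorem tr_mul_res {A B : FinGSet G} (a : A →[G] B) (x : T.obj B) (y : T.obj A) :
    T.tr a (y * T.res a x) = T.tr a y * x := by
  rw [mul_comm, tr_res_mul, mul_comm]

theorem res_tr {X Y B : FinGSet G} (f : X →[G] Y) (q : B →[G] Y) (b : T.obj B) :
    T.res f (T.tr q b) = T.tr (pbFst f q) (T.res (pbSnd f q) b) :=
  (T.tr_mackey _ _ _ _ (isPullbackSquare_pb f q) b).symm

theorem tr_mul_tr {X A B : FinGSet G} (p : A →[G] X) (q : B →[G] X) (a : T.obj A)
    (b : T.obj B) : T.tr p a * T.tr q b =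
      T.tr (p.comp (pbFst p q)) (T.res (pbFst p q) a * T.res (pbSnd p q) b) := by
  rw [← T.tr_mul_res, res_tr, ← T.tr_res_mul, ← T.tr_comp]

/-- Expansion of `f_•(z + a)`: the points of `Π_f(X ⊔ X)` are the decompositions of the fibres of
`f` into two parts. The trivial decomposition contributes `f_•(z)`; in all others the part that
carries `z` is smaller than the fibre. -/
theorem exists_nm_add {X Y : FinGSet G} (f : X →[G] Y) :
    ∃ (P L : FinGSet G) (π : P →[G] Y) (u : L →[G] P) (l : L →[G] X),
      (∀ s, Nat.card {c : L // u c = s} < Nat.card {x : X // f x = π s}) ∧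
      ∀ (T : Tambara G) (a : T.obj X), ∃ c : T.obj P, ∀ z : T.obj X,
        T.nm f (z + a) = T.nm f z + T.tr π (T.nm u (T.res l z) * c) := by
  let fold : X.sum X →[G] X := desc (MulActionHom.id G) (MulActionHom.id G)
  let D := piSet f fold
  let E := pb f (piProj f fold)
  let e : E →[G] X.sum X := piEval f fold
  let f' : E →[G] D := piPull f fold
  have hsmul : ∀ (g : G) (w : X.sum X), (Sum.isLeft (g • w : X ⊕ X)) = Sum.isLeft w := by
    rintro g (x | x) <;> rfl
  let Q : D → Prop := fun s => ∃ c : E, f' c = s ∧ Sum.isLeft (e c) = false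
  have hQ : ∀ (g : G) s, Q s → Q (g • s) := by
    rintro g s ⟨c, rfl, hc⟩
    exact ⟨g • c, map_smul f' g c, by rw [map_smul, hsmul]; exact hc⟩
  let P := D.sub Q hQ
  let j : P →[G] D := subVal D Q hQ
  have side : ∀ b : Bool, ∀ (g : G) (c : E), (Sum.isLeft (e c) = b ∧ Q (f' c)) →
      (Sum.isLeft (e (g • c)) = b ∧ Q (f' (g • c))) := by
    rintro b g c ⟨h1, h2⟩
    rw [map_smul, map_smul, hsmul]
    exact ⟨h1, hQ g _ h2⟩
  let L := E.sub _ (side true)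
  let R := E.sub _ (side false)
  let iL : L →[G] E := subVal E _ (side true)
  let iR : R →[G] E := subVal E _ (side false)
  let u : L →[G] P :=
    { toFun := fun c => ⟨f' c.1, c.2.2⟩
      map_smul' := fun g c => Subtype.ext (map_smul f' g c.1) }
  let v : R →[G] P :=
    { toFun := fun c => ⟨f' c.1, c.2.2⟩
      map_smul' := fun g c => Subtype.ext (map_smul f' g c.1) }
  let l : L →[G] X := fold.comp (e.comp iL)
  let r : R →[G] X := fold.comp (e.comp iR)
  let s₀ : Y →[G] D :=
    { toFun := fun y => (⟨y, fun x _ => Sum.inl x, fun _ _ => rfl⟩ : FibreSection f fold)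
      map_smul' := fun g y => FibreSection.ext' rfl fun x _ _ =>
        congrArg Sum.inl (smul_inv_smul g x).symm }
  let e₀ : X →[G] E := pbLift (MulActionHom.id G) (s₀.comp f) (fun _ => rfl)
  have hfold : ∀ w : X.sum X, (Sum.isLeft w = true → w = inl X X (fold w)) ∧
      (Sum.isLeft w = false → w = inr X X (fold w)) := by
    rintro (x | x)
    · exact ⟨fun _ => rfl, fun h => (Bool.noConfusion h : _)⟩
    · exact ⟨fun h => (Bool.noConfusion h : _), fun _ => rfl⟩
  have hbij : Function.Bijective (desc s₀ j : Y.sum P →[G] D) := by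
    have hdis : ∀ y (s : P), s₀ y ≠ j s := by
      rintro y ⟨s, c, rfl, hc⟩ (h : s₀ y = f' c)
      rcases c with ⟨⟨x, s⟩, hx⟩
      obtain rfl : s₀ y = s := h
      exact Bool.noConfusion (hc : true = false)
    constructor
    · rintro (y | s) (y' | s') h
      · exact congrArg Sum.inl (congrArg FibreSection.base h)
      · exact (hdis _ _ h).elim
      · exact (hdis _ _ h.symm).elim
      · exact congrArg Sum.inr (Subtype.ext h)
    · intro s
      by_cases hs : Q s
      · exact ⟨Sum.inr ⟨s, hs⟩, rfl⟩
      · refine ⟨Sum.inl (FibreSection.base s), FibreSection.ext' rfl fun x h h' => ?_⟩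
        have h1 : Sum.isLeft (FibreSection.sec s x h') = true := by
          by_contra h2
          exact hs ⟨⟨(x, s), h'⟩, rfl, (Bool.not_eq_true _).mp h2⟩
        have h2 := (hfold _).1 h1
        rw [show fold (FibreSection.sec s x h') = x from FibreSection.proj_sec s x h'] at h2
        exact h2.symm
  refine ⟨P, L, (piProj f fold).comp j, u, l, ?_, ?_⟩
  · rintro ⟨s, c₀, rfl, hc₀⟩
    refine Set.ncard_lt_ncard (s := {x : X | ∃ c : L, u c = ⟨f' c₀, c₀, rfl, hc₀⟩ ∧ l c = x})
      (t := {x : X | f x = (piProj f fold) (f' c₀)}) ?_ (Set.toFinite _) |>.trans_le' ?_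
    · constructor
      · rintro _ ⟨⟨⟨⟨x, s⟩, hx⟩, h1, h2⟩, h3, rfl⟩
        have h4 : s = f' c₀ := congrArg Subtype.val h3
        have h5 : fold (FibreSection.sec s x hx) = x := FibreSection.proj_sec s x hx
        change f (fold (FibreSection.sec s x hx)) = _
        rw [h5, ← h4]; exact hx
      · intro h
        have hc : fold (e c₀) = c₀.1.1 := FibreSection.proj_sec c₀.1.2 c₀.1.1 c₀.2
        obtain ⟨⟨c, h1, h2⟩, h3, h4⟩ := @h (fold (e c₀)) (by
          change f (fold (e c₀)) = _
          rw [hc]; exact c₀.2)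
        have h5 : c = c₀ := Subtype.ext (Prod.ext
          ((FibreSection.proj_sec c.1.2 c.1.1 c.2).symm.trans (h4.trans hc))
          (congrArg Subtype.val h3))
        rw [h5, hc₀] at h1
        exact Bool.noConfusion h1
    · rw [← Nat.card_coe_set_eq]
      refine Nat.card_le_card_of_injective
        (fun c => (⟨l c.1, c.1, c.2, rfl⟩ :
          {x : X | ∃ c : L, u c = ⟨f' c₀, c₀, rfl, hc₀⟩ ∧ l c = x})) ?_
      rintro ⟨⟨c, h1, h2⟩, hc⟩ ⟨⟨d, h1', h2'⟩, hd⟩ h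
      refine Subtype.ext (Subtype.ext (Subtype.ext (Prod.ext ?_ ?_)))
      · have h3 : fold (e c) = fold (e d) := congrArg Subtype.val h
        exact (FibreSection.proj_sec c.1.2 c.1.1 c.2).symm.trans
          (h3.trans (FibreSection.proj_sec d.1.2 d.1.1 d.2))
      · exact congrArg Subtype.val (hc.trans hd.symm)
  · intro T a
    refine ⟨T.nm v (T.res r a), fun z => ?_⟩
    have h1 : z + a = T.tr fold (T.pair z a) := by
      rw [T.tr_desc, T.res_inl_pair, T.res_inr_pair, T.tr_id, T.tr_id]
    have h2 := T.tr_res_of_bijective _ hbij (T.nm f' (T.res e (T.pair z a)))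
    have hs₀ : T.res s₀ (T.nm f' (T.res e (T.pair z a))) = T.nm f z := by
      have sq : IsPullbackSquare e₀ f f' s₀ := by
        refine ⟨fun _ => rfl, ?_⟩
        rintro y ⟨⟨x, s⟩, hx⟩ (h : s₀ y = s)
        subst h
        obtain rfl : f x = y := hx
        exact ⟨x, ⟨rfl, rfl⟩, fun x' hx' => congrArg (fun c => c.1.1) hx'.2⟩
      rw [← T.nm_mackey _ _ _ _ sq, T.res_res]
      exact congrArg (T.nm f) (T.res_inl_pair z a)
    have hj : T.res j (T.nm f' (T.res e (T.pair z a))) =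
        T.nm u (T.res l z) * T.nm v (T.res r a) := by
      have sq : IsPullbackSquare (desc iL iR : L.sum R →[G] E) (desc u v) f' j := by
        refine ⟨?_, ?_⟩
        · rintro (c | c) <;> rfl
        · rintro ⟨s, hs⟩ c (h : s = f' c)
          subst h
          by_cases hc : Sum.isLeft (e c) = true
          · refine ⟨Sum.inl ⟨c, hc, hs⟩, ⟨rfl, rfl⟩, ?_⟩
            rintro (d | d) ⟨-, hd⟩
            · exact congrArg Sum.inl (Subtype.ext hd)
            · have h3 : Sum.isLeft (e c) = false := by rw [← hd]; exact d.2.1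
              rw [hc] at h3
              exact Bool.noConfusion h3
          · refine ⟨Sum.inr ⟨c, by simpa using hc, hs⟩, ⟨rfl, rfl⟩, ?_⟩
            rintro (d | d) ⟨-, hd⟩
            · exact (hc (by rw [← hd]; exact d.2.1)).elim
            · exact congrArg Sum.inr (Subtype.ext hd)
      rw [← T.nm_mackey _ _ _ _ sq, T.nm_desc, T.res_res, T.res_res, T.res_res, T.res_res]
      congr 2
      · have : e.comp ((desc iL iR : L.sum R →[G] E).comp (inl L R)) = (inl X X).comp l :=
          MulActionHom.ext fun c => (hfold (e c.1)).1 c.2.1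
        rw [this, ← T.res_res, T.res_inl_pair]
      · have : e.comp ((desc iL iR : L.sum R →[G] E).comp (inr L R)) = (inr X X).comp r :=
          MulActionHom.ext fun c => (hfold (e c.1)).2 c.2.1
        rw [this, ← T.res_res, T.res_inr_pair]
    rw [T.tr_desc, T.res_res, T.res_res] at h2
    have h3 : (desc s₀ j).comp (inl Y P) = s₀ := rfl
    have h4 : (desc s₀ j).comp (inr Y P) = j := rfl
    rw [h3, h4, hs₀, hj] at h2
    rw [h1, T.distrib, ← h2, map_add, T.tr_tr, T.tr_tr]
    congr 1
    exact T.tr_id Y _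

/-- The norm along a map whose fibres have at most `d` elements is polynomial of degree at most
`d`: its differences of order `d + 1` vanish. -/
theorem fwdDiff_nm (T : Tambara G) (d : ℕ) {X Y : FinGSet G} (f : X →[G] Y)
    (hf : ∀ y, Nat.card {x : X // f x = y} ≤ d) (a z : T.obj X) :
    (fwdDiff a)^[d + 1] (T.nm f) z = 0 := by
  induction d generalizing X Y with
  | zero =>
    obtain ⟨P, L, π, u, l, hlt, hT⟩ := exists_nm_add f
    obtain ⟨c, hc⟩ := hT T a
    have hP : IsEmpty P := ⟨fun s => by have := hlt s; have := hf (π s); omega⟩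
    have : T.nm u (T.res l z) * c = 0 := T.eq_of_isEmpty _ _
    simp [fwdDiff, hc, this]
  | succ d ih =>
    obtain ⟨P, L, π, u, l, hlt, hT⟩ := exists_nm_add f
    obtain ⟨c, hc⟩ := hT T a
    -- a linear function of the norm along `u` has the differences of that norm
    have key : ∀ (n : ℕ), (fwdDiff a)^[n + 1] (T.nm f) =
        fun z => T.tr π ((fwdDiff (T.res l a))^[n] (T.nm u) (T.res l z) * c) := by
      intro n
      induction n with
      | zero =>
        funext z
        simp [fwdDiff, hc]
      | succ n ihn =>
        rw [Function.iterate_succ_apply', ihn]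
        funext z
        rw [Function.iterate_succ_apply']
        simp only [fwdDiff, map_add, sub_mul, map_sub]
    rw [key]
    beta_reduce
    rw [ih u (fun s => by have := hlt s; have := hf (π s); omega), zero_mul, map_zero]

end Tambara

namespace FinGSet

/-! ### Constructions of exponential diagrams -/

theorem isExponential_id {X A : FinGSet G} (p : A →[G] X) :
    IsExponential (MulActionHom.id G) p p (MulActionHom.id G) (MulActionHom.id G) where
  sq := ⟨fun _ => rfl, fun _ a h => ⟨a, ⟨h.symm, rfl⟩, fun _ hc => hc.2⟩⟩
  univ y σ hσ := by
    refine ⟨σ y rfl, ⟨hσ y rfl, ?_⟩, ?_⟩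
    · rintro c (rfl : c = _) h
      have : ∀ y' (e : y' = y) h', σ y rfl = σ y' h' := by rintro _ rfl _; rfl
      exact this _ (hσ y rfl) h
    · rintro a ⟨rfl, ha⟩
      exact ha a rfl rfl

/-- The exponential diagram of an identity `p`. -/
theorem isExponential_proj_id {X Y : FinGSet G} (f : X →[G] Y) :
    IsExponential f (MulActionHom.id G) (MulActionHom.id G) (MulActionHom.id G) f where
  sq := ⟨fun _ => rfl, fun x _ h => ⟨x, ⟨rfl, h⟩, fun _ hc => hc.1⟩⟩
  univ y _ hσ := ⟨y, ⟨rfl, fun c _ h => (hσ c h).symm⟩, fun _ hb => hb.1⟩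

/-- Exponential diagrams compose in `f`. -/
theorem IsExponential.comp {X Y Z A P P' E E' : FinGSet G} {f : X →[G] Y} {g : Y →[G] Z}
    {p : A →[G] X} {π : P →[G] Y} {e : E →[G] A} {f' : E →[G] P} {π' : P' →[G] Z}
    {e' : E' →[G] P} {g' : E' →[G] P'} (h : IsExponential f p π e f')
    (h' : IsExponential g π π' e' g') :
    IsExponential (g.comp f) p π' (e.comp (pbFst f' e')) (g'.comp (pbSnd f' e')) where
  sq := by
    refine ⟨?_, ?_⟩
    · rintro ⟨⟨c, c'⟩, hc : f' c = e' c'⟩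
      change g (f (p (e c))) = π' (g' c')
      have h1 : f (p (e c)) = π (f' c) := h.sq.1 c
      have h2 : g (π (e' c')) = π' (g' c') := h'.sq.1 c'
      rw [h1, hc, h2]
    · intro x b hb
      obtain ⟨c', ⟨h1, rfl⟩, hu'⟩ := h'.sq.2 (f x) b hb
      obtain ⟨c, ⟨rfl, h2⟩, hu⟩ := h.sq.2 x (e' c') h1.symm
      refine ⟨⟨(c, c'), h2⟩, ⟨rfl, rfl⟩, ?_⟩
      rintro ⟨⟨d, d'⟩, hd : f' d = e' d'⟩ ⟨hd1 : p (e d) = p (e c), hd2 : g' d' = g' c'⟩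
      have h3 : d' = c' := hu' d' ⟨by
        have h5 : f (p (e d)) = π (f' d) := h.sq.1 d
        change π (e' d') = f (p (e c))
        rw [← hd, ← h5, hd1], hd2⟩
      subst h3
      have h4 : d = c := hu d ⟨hd1, hd⟩
      subst h4
      rfl
  univ z σ hσ := by
    choose τ hτ hτu using fun (y : Y) (hy : g y = z) =>
      h.univ y (fun x hx => σ x ((congrArg g hx).trans hy)) (fun x hx => hσ x _)
    obtain ⟨d, ⟨hd, hd'⟩, hdu⟩ := h'.univ z τ (fun y hy => (hτ y hy).1)
    refine ⟨d, ⟨hd, ?_⟩, ?_⟩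
    · rintro ⟨⟨c, c'⟩, hc : f' c = e' c'⟩ (hcd : g' c' = d) hz
      have h1 : f (p (e c)) = π (f' c) := h.sq.1 c
      have h2 : g (π (e' c')) = z := by rw [← hc, ← h1]; exact hz
      exact (hτ _ h2).2 c (hc.trans (hd' c' hcd h2)) (by rw [h1, hc])
    · rintro d' ⟨hd1, hd2⟩
      refine hdu d' ⟨hd1, ?_⟩
      intro c' hc' h1
      refine hτu _ h1 _ ⟨rfl, ?_⟩
      intro c hc h2
      exact hd2 ⟨(c, c'), hc⟩ hc' _

/-- Exponential diagrams compose in `p`. -/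
theorem IsExponential.comp_proj {X Y A C P P' E E' : FinGSet G} {f : X →[G] Y}
    {p : A →[G] X} {π : P →[G] Y} {e : E →[G] A} {f' : E →[G] P} {q : C →[G] A}
    {π' : P' →[G] P} {e' : E' →[G] pb e q} {f'' : E' →[G] P'} (h : IsExponential f p π e f')
    (h' : IsExponential f' (pbFst e q) π' e' f'') :
    IsExponential f (p.comp q) (π.comp π') ((pbSnd e q).comp e') f'' where
  sq := by
    have hq : ∀ c, q (pbSnd e q (e' c)) = e (pbFst e q (e' c)) := fun c => (e' c).2.symm
    refine ⟨?_, ?_⟩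
    · intro c
      change f (p (q (pbSnd e q (e' c)))) = π (π' (f'' c))
      have h1 : f' (pbFst e q (e' c)) = π' (f'' c) := h'.sq.1 c
      rw [hq, ← h1]
      exact h.sq.1 _
    · intro x b hb
      obtain ⟨c, ⟨rfl, h1⟩, hu⟩ := h.sq.2 x (π' b) hb
      obtain ⟨c', ⟨rfl, rfl⟩, hu'⟩ := h'.sq.2 c b h1
      refine ⟨c', ⟨congrArg p (hq c'), rfl⟩, ?_⟩
      rintro d ⟨hd1 : p (q (pbSnd e q (e' d))) = _, hd2⟩
      refine hu' d ⟨hu _ ⟨?_, ?_⟩, hd2⟩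
      · rw [hq] at hd1
        exact hd1
      · exact (h'.sq.1 d).trans (congrArg π' hd2)
  univ y σ hσ := by
    obtain ⟨b, ⟨hb, hb'⟩, hbu⟩ := h.univ y (fun x hx => q (σ x hx)) (fun x hx => hσ x hx)
    have hf : ∀ c, f' c = b → f (p (e c)) = y := by
      rintro c rfl
      exact (h.sq.1 c).trans hb
    obtain ⟨d, ⟨hd, hd'⟩, hdu⟩ := h'.univ b
      (fun c hc => ⟨(c, σ (p (e c)) (hf c hc)), hb' c hc (hf c hc)⟩) (fun _ _ => rfl)
    refine ⟨d, ⟨(congrArg π hd).trans hb, ?_⟩, ?_⟩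
    · intro c hc hy
      have h1 := hd' c hc ((h'.sq.1 c).trans ((congrArg π' hc).trans hd))
      have h2 := congrArg (pbSnd e q) h1
      refine h2.trans ?_
      have h3 : p (e (pbFst e q (e' c))) = p (q (pbSnd e q (e' c))) := congrArg p (e' c).2
      have : ∀ x x' (hx : x = x') h h', σ x h = σ x' h' := by rintro x _ rfl _ _; rfl
      exact this _ _ h3 _ _
    · rintro d' ⟨hd1, hd2⟩
      have h1 : π' d' = b := by
        refine hbu _ ⟨hd1, ?_⟩
        intro c hc hy
        obtain ⟨c', ⟨rfl, rfl⟩, -⟩ := h'.sq.2 c d' hc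
        have h3 : q (pbSnd e q (e' c')) = e (pbFst e q (e' c')) := (e' c').2.symm
        have h4 : p (q (pbSnd e q (e' c'))) = p (e (pbFst e q (e' c'))) := congrArg p h3
        refine h3.symm.trans (congrArg q ((hd2 c' rfl ((congrArg f h4).trans hy)).trans ?_))
        have : ∀ x x' (hx : x = x') h h', σ x h = σ x' h' := by rintro x _ rfl _ _; rfl
        exact this _ _ h4 _ _
      refine hdu d' ⟨h1, ?_⟩
      intro c hc hy
      refine Subtype.ext (Prod.ext rfl ?_)
      have h3 : p (q (pbSnd e q (e' c))) = p (e (pbFst e q (e' c))) :=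
        congrArg p (e' c).2.symm
      refine (hd2 c hc ((congrArg f h3).trans (hf _ hy))).trans ?_
      have : ∀ x x' (hx : x = x') h h', σ x h = σ x' h' := by rintro x _ rfl _ _; rfl
      exact this _ _ h3 _ _

/-- The map `Π_f(A) → Π_f(B)` induced by a map `a : A → B` over `X`. -/
def piMap {X Y A B : FinGSet G} (f : X →[G] Y) (q : B →[G] X) (a : A →[G] B) :
    piSet f (q.comp a) →[G] piSet f q where
  toFun s := (⟨FibreSection.base s, fun x hx => a (FibreSection.sec s x hx),
    FibreSection.proj_sec s⟩ : FibreSection f q)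
  map_smul' g _ := FibreSection.ext' rfl fun _ _ _ => map_smul a g _

/-- The map `X ×_Y Π_f(A) → X ×_Y Π_f(B)` induced by a map `a : A → B` over `X`. -/
def pbPiMap {X Y A B : FinGSet G} (f : X →[G] Y) (q : B →[G] X) (a : A →[G] B) :
    pb f (piProj f (q.comp a)) →[G] pb f (piProj f q) :=
  pbLift (pbFst _ _) ((piMap f q a).comp (pbSnd _ _)) (fun z => z.2)

theorem isPullbackSquare_piMap {X Y A B : FinGSet G} (f : X →[G] Y) (q : B →[G] X)
    (a : A →[G] B) :
    IsPullbackSquare (pbPiMap f q a) (piPull f (q.comp a)) (piPull f q) (piMap f q a) := by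
  refine ⟨fun _ => rfl, ?_⟩
  rintro s ⟨⟨x, t⟩, hx⟩ (h : _ = t)
  subst h
  refine ⟨⟨(x, s), hx⟩, ⟨rfl, rfl⟩, ?_⟩
  rintro ⟨⟨x', s'⟩, hx'⟩ ⟨h1, h2⟩
  exact Subtype.ext (Prod.ext (congrArg (fun z => z.1.1) h2) h1)

/-- The sections of `p = q ∘ a` that lift a given section of `q`. -/
theorem isExponential_piMap {X Y A B : FinGSet G} (f : X →[G] Y) (q : B →[G] X)
    (a : A →[G] B) :
    IsExponential (piPull f q) (pbFst (piEval f q) a) (piMap f q a)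
      (pbLift (pbPiMap f q a) (piEval f (q.comp a)) (fun _ => rfl)) (piPull f (q.comp a)) where
  sq := (isPullbackSquare_piMap f q a).symm
  univ s σ hσ := by
    have h1 : ∀ x (hx : f x = FibreSection.base s),
        a (pbSnd _ _ (σ ⟨(x, s), hx⟩ rfl)) = FibreSection.sec s x hx := by
      intro x hx
      have h2 := (σ ⟨(x, s), hx⟩ rfl).2
      have h3 : (σ ⟨(x, s), hx⟩ rfl).1.1 = ⟨(x, s), hx⟩ := hσ ⟨(x, s), hx⟩ rfl
      rw [h3] at h2
      exact h2.symm
    refine ⟨(⟨FibreSection.base s, fun x hx => pbSnd _ _ (σ ⟨(x, s), hx⟩ rfl), fun x hx =>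
      (congrArg q (h1 x hx)).trans (FibreSection.proj_sec s x hx)⟩ :
        FibreSection f (q.comp a)), ⟨?_, ?_⟩, ?_⟩
    · exact FibreSection.ext' rfl fun x hx _ => h1 x hx
    · rintro ⟨⟨x, t⟩, hx⟩ (rfl : t = _) hy
      have h2 : ∀ z (hz : z = (⟨(x, s), hx⟩ : pb f (piProj f q))) hh,
          σ z hh = σ ⟨(x, s), hx⟩ rfl := by
        rintro _ rfl _; rfl
      have h3 : pbPiMap f q a ⟨(x, (⟨FibreSection.base s, fun x hx =>
          pbSnd _ _ (σ ⟨(x, s), hx⟩ rfl), fun x hx =>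
          (congrArg q (h1 x hx)).trans (FibreSection.proj_sec s x hx)⟩ :
            FibreSection f (q.comp a))), hx⟩ = ⟨(x, s), hx⟩ :=
        Subtype.ext (Prod.ext rfl (FibreSection.ext' rfl fun x hx _ => h1 x hx))
      refine Eq.trans ?_ (h2 _ h3 hy).symm
      exact Subtype.ext (Prod.ext (h3.trans (hσ ⟨(x, s), hx⟩ rfl).symm) rfl)
    · rintro t ⟨rfl, ht⟩
      refine FibreSection.ext' rfl fun x hx hx' => ?_
      have h2 := ht ⟨(x, t), hx⟩ rfl rfl
      exact congrArg (pbSnd (piEval f q) a) h2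

/-- The map `X ×_Y (Π_f(A) ×_Y Π_f(B)) → A ×_X B` evaluating pairs of sections. -/
def pbEval {X Y A B : FinGSet G} (f : X →[G] Y) (p : A →[G] X) (q : B →[G] X) :
    pb f ((piProj f p).comp (pbFst (piProj f p) (piProj f q))) →[G] pb p q :=
  pbLift
    ((piEval f p).comp (pbLift (pbFst _ _) ((pbFst (piProj f p) (piProj f q)).comp (pbSnd _ _))
      (fun z => z.2)))
    ((piEval f q).comp (pbLift (pbFst _ _) ((pbSnd (piProj f p) (piProj f q)).comp (pbSnd _ _))
      (fun z => z.2.trans z.1.2.2)))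
    (fun _ => (FibreSection.proj_sec _ _ _).trans (FibreSection.proj_sec _ _ _).symm)

/-- `Π_f` commutes with fibre products. -/
theorem isExponential_pb {X Y A B : FinGSet G} (f : X →[G] Y) (p : A →[G] X) (q : B →[G] X) :
    IsExponential f (p.comp (pbFst p q))
      ((piProj f p).comp (pbFst (piProj f p) (piProj f q))) (pbEval f p q) (pbSnd _ _) where
  sq := by
    have h : (p.comp (pbFst p q)).comp (pbEval f p q) = pbFst _ _ :=
      MulActionHom.ext fun _ => FibreSection.proj_sec _ _ _
    rw [h]
    exact isPullbackSquare_pb _ _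
  univ y σ hσ := by
    have hs : ∀ x x' (e : x = x') h h', σ x h = σ x' h' := by rintro x _ rfl _ _; rfl
    refine ⟨⟨((⟨y, fun x hx => pbFst p q (σ x hx), hσ⟩ : FibreSection f p),
      (⟨y, fun x hx => pbSnd p q (σ x hx), fun x hx => (σ x hx).2.symm.trans (hσ x hx)⟩ :
        FibreSection f q)), rfl⟩, ⟨rfl, ?_⟩, ?_⟩
    · rintro ⟨⟨x, s⟩, hx⟩ (rfl : s = _) hy
      refine Eq.trans (b := σ x hx) rfl (hs _ _ ?_ _ _)
      exact (hσ x hx).symm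
    · rintro ⟨⟨s, t⟩, hst⟩ ⟨rfl, h2⟩
      have h3 : ∀ x hx hx', pbEval f p q ⟨(x, ⟨(s, t), hst⟩), hx⟩ = σ x hx' := by
        intro x hx hx'
        have h4 : (p.comp (pbFst p q)) (pbEval f p q ⟨(x, ⟨(s, t), hst⟩), hx⟩) = x :=
          FibreSection.proj_sec s x hx
        exact (h2 ⟨(x, ⟨(s, t), hst⟩), hx⟩ rfl (by rw [h4]; exact hx)).trans (hs _ _ h4 _ _)
      refine Subtype.ext (Prod.ext (FibreSection.ext' rfl fun x hx hx' => ?_)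
        (FibreSection.ext' hst.symm fun x hx hx' => ?_))
      · exact congrArg (pbFst p q) (h3 x hx hx')
      · exact congrArg (pbSnd p q) (h3 x (hx.trans hst.symm) hx')

/-- `Π` commutes with base change along a pull-back square. -/
theorem isExponential_baseChange {X Y X' Y' B : FinGSet G} {f' : X' →[G] Y'} {x : X' →[G] X}
    {y : Y' →[G] Y} {f : X →[G] Y} (h : IsPullbackSquare f' x y f) (p : B →[G] Y') :
    IsExponential x (pbFst f' p) (pbFst f (piProj y p))
      (pbLift (pbFst x (pbFst f (piProj y p)))
        ((piEval y p).comp (pbLift (f'.comp (pbFst _ _)) ((pbSnd _ _).comp (pbSnd _ _))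
          (fun z => (h.1 _).symm.trans ((congrArg f z.2).trans z.1.2.2))))
        (fun _ => (FibreSection.proj_sec _ _ _).symm))
      (pbSnd x (pbFst f (piProj y p))) where
  sq := isPullbackSquare_pb _ _
  univ a σ hσ := by
    have hs : ∀ c c' (e : c = c') h h', σ c h = σ c' h' := by rintro x _ rfl _ _; rfl
    choose c hc hcu using fun (b : Y') (hb : y b = f a) => h.2 a b hb.symm
    have hτ : ∀ b hb, p (pbSnd f' p (σ (c b hb) (hc b hb).1)) = b := fun b hb =>
      ((σ (c b hb) (hc b hb).1).2.symm.trans (congrArg f' (hσ _ _))).trans (hc b hb).2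
    refine ⟨⟨(a, (⟨f a, fun b hb => pbSnd f' p (σ (c b hb) (hc b hb).1), hτ⟩ :
      FibreSection y p)), rfl⟩, ⟨rfl, ?_⟩, ?_⟩
    · rintro ⟨⟨d, s⟩, hd⟩ (rfl : s = _) hy
      refine Subtype.ext (Prod.ext (hσ _ _).symm ?_)
      have hd' : x d = a := hd
      have h1 : y (f' d) = f a := (h.1 d).symm.trans (congrArg f hd)
      have h2 : d = c (f' d) h1 := hcu _ h1 d ⟨hd, rfl⟩
      refine congrArg (pbSnd f' p) (hs _ _ ?_ _ _)
      exact h2.symm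
    · rintro ⟨⟨a', s⟩, has⟩ ⟨rfl, h2⟩
      refine Subtype.ext (Prod.ext rfl (FibreSection.ext' has.symm fun b hb hb' => ?_))
      have h3 := h2 ⟨(c b hb', ⟨(a', s), has⟩), (hc b hb').1⟩ rfl (hc b hb').1
      refine Eq.trans ?_ (congrArg (pbSnd f' p) h3)
      exact FibreSection.sec_congr s (hc b hb').2.symm _ _

end FinGSet

/-! ### Operations on finite `G`-sets with coefficients -/

namespace PairOver

variable {N : SemiMackey G} {X Y Z : FinGSet G}

/-- The disjoint union of two pairs. -/
abbrev sum (x y : PairOver N X) : PairOver N X :=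
  ⟨x.set.sum y.set, desc x.proj y.proj, N.pair x.coeff y.coeff⟩

/-- The fibre product of two pairs. -/
abbrev mul (x y : PairOver N X) : PairOver N X :=
  ⟨pb x.proj y.proj, x.proj.comp (pbFst x.proj y.proj),
    N.res (pbFst x.proj y.proj) x.coeff * N.res (pbSnd x.proj y.proj) y.coeff⟩

/-- The empty pair. -/
abbrev zero (N : SemiMackey G) (X : FinGSet G) : PairOver N X := ⟨empty G, elim (empty G) X, 1⟩

/-- The pair of the identity. -/
abbrev one (N : SemiMackey G) (X : FinGSet G) : PairOver N X := ⟨X, MulActionHom.id G, 1⟩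

/-- Base change of a pair. -/
abbrev res (f : X →[G] Y) (y : PairOver N Y) : PairOver N X :=
  ⟨pb f y.proj, pbFst f y.proj, N.res (pbSnd f y.proj) y.coeff⟩

/-- Composition of a pair with a map. -/
abbrev tr (f : X →[G] Y) (x : PairOver N X) : PairOver N Y := ⟨x.set, f.comp x.proj, x.coeff⟩

/-- The norm of a pair. -/
abbrev nm (f : X →[G] Y) (x : PairOver N X) : PairOver N Y :=
  ⟨piSet f x.proj, piProj f x.proj, N.tr (piPull f x.proj) (N.res (piEval f x.proj) x.coeff)⟩

/-- Isomorphism of pairs. -/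
def Iso (x y : PairOver N X) : Prop :=
  ∃ a : x.set →[G] y.set, Function.Bijective a ∧ y.proj.comp a = x.proj ∧
    x.coeff = N.res a y.coeff

namespace Iso

theorem of_inverse {x y : PairOver N X} (a : x.set →[G] y.set) (b : y.set → x.set)
    (h₁ : ∀ z, b (a z) = z) (h₂ : ∀ z, a (b z) = z) (hp : ∀ z, y.proj (a z) = x.proj z)
    (hc : x.coeff = N.res a y.coeff) : Iso x y :=
  ⟨a, bijective_of_inverse a b h₁ h₂, MulActionHom.ext hp, hc⟩

/-- The norm of a pair can be computed from any exponential diagram. -/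
theorem nm_of_isExponential {f : X →[G] Y} {x : PairOver N X} {P E : FinGSet G}
    {π : P →[G] Y} {e : E →[G] x.set} {f' : E →[G] P} (h : IsExponential f x.proj π e f') :
    Iso ⟨P, π, N.tr f' (N.res e x.coeff)⟩ (nm f x) :=
  ⟨h.toPi, h.toPi_bijective, rfl, (N.res_toPi h x.coeff).symm⟩

theorem sum_assoc (x y z : PairOver N X) : Iso ((x.sum y).sum z) (x.sum (y.sum z)) := by
  refine of_inverse (desc (desc (inl _ _) ((inr _ _).comp (inl _ _))) ((inr _ _).comp (inr _ _)))
    (Sum.elim (fun a => Sum.inl (Sum.inl a))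
      (Sum.elim (fun b => Sum.inl (Sum.inr b)) Sum.inr)) ?_ ?_ ?_ ?_
  · rintro ((a | a) | a) <;> rfl
  · rintro (a | a | a) <;> rfl
  · rintro ((a | a) | a) <;> rfl
  · refine N.sum_ext (N.sum_ext ?_ ?_) ?_
    · refine (congrArg _ (N.res_inl_pair _ _)).trans ((N.res_inl_pair _ _).trans ?_)
      rw [N.res_res, N.res_res]
      exact (N.res_inl_pair _ _).symm
    · refine (congrArg _ (N.res_inl_pair _ _)).trans ((N.res_inr_pair _ _).trans ?_)
      rw [N.res_res, N.res_res]
      exact ((N.res_comp (inl _ _) (inr _ _) _).trans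
        ((congrArg _ (N.res_inr_pair _ _)).trans (N.res_inl_pair _ _))).symm
    · refine (N.res_inr_pair _ _).trans ?_
      rw [N.res_res]
      exact ((N.res_comp (inr _ _) (inr _ _) _).trans
        ((congrArg _ (N.res_inr_pair _ _)).trans (N.res_inr_pair _ _))).symm

theorem sum_comm (x y : PairOver N X) : Iso (x.sum y) (y.sum x) := by
  refine of_inverse (desc (inr _ _) (inl _ _)) Sum.swap ?_ ?_ ?_ ?_
  · rintro (a | a) <;> rfl
  · rintro (a | a) <;> rfl
  · rintro (a | a) <;> rfl
  · refine N.sum_ext ?_ ?_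
    · rw [N.res_res]
      exact (N.res_inl_pair _ _).trans (N.res_inr_pair _ _).symm
    · rw [N.res_res]
      exact (N.res_inr_pair _ _).trans (N.res_inl_pair _ _).symm

theorem zero_sum (x : PairOver N X) : Iso x ((zero N X).sum x) := by
  refine of_inverse (inr _ _) (Sum.elim (fun a : PEmpty => a.elim) id) (fun _ => rfl) ?_
    (fun _ => rfl) (N.res_inr_pair _ _).symm
  rintro (a | a)
  · exact PEmpty.elim a
  · rfl

theorem of_isEmpty (x y : PairOver N X) [h : IsEmpty x.set] [h' : IsEmpty y.set] : Iso x y :=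
  of_inverse (elim _ _) (fun z => h'.elim z) (fun z => h.elim z) (fun z => h'.elim z)
    (fun z => h.elim z) (N.eq_of_isEmpty _ _)

theorem mul_assoc (x y z : PairOver N X) : Iso ((x.mul y).mul z) (x.mul (y.mul z)) := by
  refine of_inverse
    (pbLift ((pbFst x.proj y.proj).comp (pbFst (x.mul y).proj z.proj))
      (pbLift ((pbSnd x.proj y.proj).comp (pbFst (x.mul y).proj z.proj))
        (pbSnd (x.mul y).proj z.proj) (fun w => w.1.1.2.symm.trans w.2)) (fun w => w.1.1.2))
    (fun w => ⟨(⟨(w.1.1, w.1.2.1.1), w.2⟩, w.1.2.1.2), w.2.trans w.1.2.2⟩)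
    (fun _ => rfl) (fun _ => rfl) (fun _ => rfl) ?_
  change N.res _ (N.res _ _ * N.res _ _) * N.res _ _ =
    N.res _ (N.res _ _ * N.res _ (N.res _ _ * N.res _ _))
  simp only [map_mul, N.res_res, _root_.mul_assoc]
  rfl

theorem mul_comm (x y : PairOver N X) : Iso (x.mul y) (y.mul x) := by
  refine of_inverse (pbLift (pbSnd _ _) (pbFst _ _) (fun w => w.2.symm))
    (fun w => ⟨(w.1.2, w.1.1), w.2.symm⟩) (fun _ => rfl) (fun _ => rfl) (fun w => w.2.symm) ?_
  change N.res _ _ * N.res _ _ = N.res _ (N.res _ _ * N.res _ _)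
  rw [map_mul, N.res_res, N.res_res, _root_.mul_comm]
  rfl

theorem one_mul (x : PairOver N X) : Iso ((one N X).mul x) x := by
  refine of_inverse (pbSnd _ _) (fun a => ⟨(x.proj a, a), rfl⟩) ?_ (fun _ => rfl)
    (fun w => w.2.symm) ?_
  · rintro ⟨⟨a, b⟩, h : a = x.proj b⟩
    subst h
    rfl
  · change N.res _ 1 * N.res _ _ = _
    rw [map_one, _root_.one_mul]

theorem mul_sum (x y z : PairOver N X) : Iso ((x.mul y).sum (x.mul z)) (x.mul (y.sum z)) := by
  refine of_inverse (desc
      (pbLift (pbFst _ _) ((inl _ _).comp (pbSnd _ _)) (fun w => w.2))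
      (pbLift (pbFst _ _) ((inr _ _).comp (pbSnd _ _)) (fun w => w.2)))
    (fun w => match w with
      | ⟨(a, Sum.inl b), h⟩ => Sum.inl ⟨(a, b), h⟩
      | ⟨(a, Sum.inr b), h⟩ => Sum.inr ⟨(a, b), h⟩) ?_ ?_ ?_ ?_
  · rintro (w | w) <;> rfl
  · rintro ⟨⟨a, b | b⟩, h⟩ <;> rfl
  · rintro (w | w) <;> rfl
  · refine N.sum_ext ?_ ?_
    · refine (N.res_inl_pair _ _).trans ?_
      change N.res _ _ * N.res _ _ = N.res _ (N.res _ (N.res _ _ * N.res _ (N.pair _ _)))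
      simp only [map_mul, N.res_res]
      refine congrArg₂ (· * ·) rfl ?_
      exact (congrArg _ (N.res_inl_pair y.coeff z.coeff).symm).trans (N.res_res _ _ _)
    · refine (N.res_inr_pair _ _).trans ?_
      change N.res _ _ * N.res _ _ = N.res _ (N.res _ (N.res _ _ * N.res _ (N.pair _ _)))
      simp only [map_mul, N.res_res]
      refine congrArg₂ (· * ·) rfl ?_
      exact (congrArg _ (N.res_inr_pair y.coeff z.coeff).symm).trans (N.res_res _ _ _)

theorem zero_mul (x : PairOver N X) : Iso ((zero N X).mul x) (zero N X) :=
  have : IsEmpty ((zero N X).mul x).set := ⟨fun w => PEmpty.elim w.1.1⟩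
  have : IsEmpty (zero N X).set := inferInstanceAs (IsEmpty (empty G))
  of_isEmpty _ _

theorem res_id (x : PairOver N X) : Iso (res (MulActionHom.id G) x) x := by
  refine of_inverse (pbSnd _ _) (fun a => ⟨(x.proj a, a), rfl⟩) ?_ (fun _ => rfl)
    (fun w => w.2.symm) rfl
  rintro ⟨⟨a, b⟩, h : a = x.proj b⟩
  subst h
  rfl

theorem res_comp (f : X →[G] Y) (g : Y →[G] Z) (z : PairOver N Z) :
    Iso (res (g.comp f) z) (res f (res g z)) := by
  refine of_inverse
    (pbLift (pbFst _ _) (pbLift (f.comp (pbFst _ _)) (pbSnd _ _) (fun w => w.2)) (fun _ => rfl))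
    (fun w => ⟨(w.1.1, w.1.2.1.2), (congrArg g w.2).trans w.1.2.2⟩)
    (fun _ => rfl) ?_ (fun _ => rfl) ?_
  · rintro ⟨⟨a, ⟨b, c⟩, h'⟩, h : f a = b⟩
    subst h
    rfl
  · change N.res _ _ = N.res _ (N.res _ (N.res _ _))
    rw [N.res_res, N.res_res]
    rfl

theorem res_sum (f : X →[G] Y) (y z : PairOver N Y) :
    Iso ((res f y).sum (res f z)) (res f (y.sum z)) := by
  refine of_inverse (desc
      (pbLift (pbFst _ _) ((inl _ _).comp (pbSnd _ _)) (fun w => w.2))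
      (pbLift (pbFst _ _) ((inr _ _).comp (pbSnd _ _)) (fun w => w.2)))
    (fun w => match w with
      | ⟨(a, Sum.inl b), h⟩ => Sum.inl ⟨(a, b), h⟩
      | ⟨(a, Sum.inr b), h⟩ => Sum.inr ⟨(a, b), h⟩) ?_ ?_ ?_ ?_
  · rintro (w | w) <;> rfl
  · rintro ⟨⟨a, b | b⟩, h⟩ <;> rfl
  · rintro (w | w) <;> rfl
  · refine N.sum_ext ?_ ?_
    · refine (N.res_inl_pair _ _).trans ?_
      change N.res _ _ = N.res _ (N.res _ (N.res _ (N.pair _ _)))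
      simp only [N.res_res]
      exact (congrArg _ (N.res_inl_pair y.coeff z.coeff).symm).trans (N.res_res _ _ _)
    · refine (N.res_inr_pair _ _).trans ?_
      change N.res _ _ = N.res _ (N.res _ (N.res _ (N.pair _ _)))
      simp only [N.res_res]
      exact (congrArg _ (N.res_inr_pair y.coeff z.coeff).symm).trans (N.res_res _ _ _)

theorem res_zero (f : X →[G] Y) : Iso (res f (zero N Y)) (zero N X) :=
  have : IsEmpty (res f (zero N Y)).set := ⟨fun w => PEmpty.elim w.1.2⟩
  have : IsEmpty (zero N X).set := inferInstanceAs (IsEmpty (empty G))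
  of_isEmpty _ _

theorem res_mul (f : X →[G] Y) (y z : PairOver N Y) :
    Iso (res f (y.mul z)) ((res f y).mul (res f z)) := by
  refine of_inverse
    (pbLift (pbLift (pbFst _ _) ((pbFst _ _).comp (pbSnd _ _)) (fun w => w.2))
      (pbLift (pbFst _ _) ((pbSnd _ _).comp (pbSnd _ _)) (fun w => w.2.trans w.1.2.2))
      (fun _ => rfl))
    (fun w => ⟨(w.1.1.1.1, ⟨(w.1.1.1.2, w.1.2.1.2), w.1.1.2.symm.trans
      ((congrArg f w.2).trans w.1.2.2)⟩), w.1.1.2⟩)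
    (fun _ => rfl) ?_ (fun _ => rfl) ?_
  · rintro ⟨⟨⟨⟨a, b⟩, h⟩, ⟨⟨a', c⟩, h'⟩⟩, (h'' : a = a')⟩
    subst h''
    rfl
  · change N.res _ (N.res _ _ * N.res _ _) =
      N.res _ (N.res _ (N.res _ _) * N.res _ (N.res _ _))
    simp only [map_mul, N.res_res]
    rfl

theorem res_one (f : X →[G] Y) : Iso (res f (one N Y)) (one N X) := by
  refine of_inverse (pbFst _ _) (fun a => ⟨(a, f a), rfl⟩) ?_ (fun _ => rfl)
    (fun _ => rfl) ((map_one _).trans (map_one _).symm)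
  rintro ⟨⟨a, b⟩, h : f a = b⟩
  subst h
  rfl

theorem tr_sum (f : X →[G] Y) (x y : PairOver N X) :
    Iso (tr f (x.sum y)) ((tr f x).sum (tr f y)) := by
  refine of_inverse (MulActionHom.id G) id (fun _ => rfl) (fun _ => rfl) ?_ ?_
  · rintro (w | w) <;> rfl
  · exact (N.res_id _ _).symm

theorem tr_zero (f : X →[G] Y) : Iso (tr f (zero N X)) (zero N Y) :=
  have : IsEmpty (tr f (zero N X)).set := inferInstanceAs (IsEmpty (empty G))
  have : IsEmpty (zero N Y).set := inferInstanceAs (IsEmpty (empty G))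
  of_isEmpty _ _

theorem tr_id (x : PairOver N X) : Iso (tr (MulActionHom.id G) x) x :=
  of_inverse (MulActionHom.id G) id (fun _ => rfl) (fun _ => rfl) (fun _ => rfl)
    (N.res_id _ _).symm

theorem tr_comp (f : X →[G] Y) (g : Y →[G] Z) (x : PairOver N X) :
    Iso (tr (g.comp f) x) (tr g (tr f x)) :=
  of_inverse (MulActionHom.id G) id (fun _ => rfl) (fun _ => rfl) (fun _ => rfl)
    (N.res_id _ _).symm

/-- A pair over `X ⊔ Y` is the disjoint union of its restrictions. -/
theorem tr_res_sum (x : PairOver N (X.sum Y)) :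
    Iso ((tr (inl X Y) (res (inl X Y) x)).sum (tr (inr X Y) (res (inr X Y) x))) x := by
  refine ⟨desc (pbSnd _ _) (pbSnd _ _), ⟨?_, ?_⟩, ?_, ?_⟩
  · rintro (⟨⟨a, b⟩, h⟩ | ⟨⟨a, b⟩, h⟩) (⟨⟨a', b'⟩, h'⟩ | ⟨⟨a', b'⟩, h'⟩) (hb : b = b')
    · subst hb
      obtain rfl : a = a' := Sum.inl_injective (h.trans h'.symm)
      rfl
    · subst hb
      exact (Sum.inl_ne_inr (h.trans h'.symm)).elim
    · subst hb
      exact (Sum.inr_ne_inl (h.trans h'.symm)).elim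
    · subst hb
      obtain rfl : a = a' := Sum.inr_injective (h.trans h'.symm)
      rfl
  · intro b
    rcases h : x.proj b with a | a
    · exact ⟨Sum.inl ⟨(a, b), h.symm⟩, rfl⟩
    · exact ⟨Sum.inr ⟨(a, b), h.symm⟩, rfl⟩
  · ext w
    rcases w with w | w
    · exact w.2.symm
    · exact w.2.symm
  · refine N.sum_ext ?_ ?_
    · exact (N.res_inl_pair _ _).trans (N.res_res_of (fun _ => rfl) _).symm
    · exact (N.res_inr_pair _ _).trans (N.res_res_of (fun _ => rfl) _).symm

theorem tr_mackey {X' Y' : FinGSet G} {f' : X' →[G] Y'} {x : X' →[G] X} {y : Y' →[G] Y}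
    {f : X →[G] Y} (h : IsPullbackSquare f' x y f) (m : PairOver N Y') :
    Iso (tr x (res f' m)) (res f (tr y m)) := by
  refine ⟨pbLift (x.comp (pbFst _ _)) (pbSnd _ _)
    (fun w => (h.1 _).trans (congrArg y w.2)), ⟨?_, ?_⟩, rfl,
    (N.res_res_of (fun _ => rfl) _).symm⟩
  · rintro ⟨⟨a, b⟩, hab⟩ ⟨⟨a', b'⟩, hab'⟩ hw
    have h1 : x a = x a' := congrArg (fun z => z.1.1) hw
    obtain rfl : b = b' := congrArg (fun z => z.1.2) hw
    obtain rfl : a = a' := h.hom_ext h1 (hab.trans hab'.symm)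
    rfl
  · rintro ⟨⟨a, b⟩, hab⟩
    obtain ⟨c, ⟨rfl, hc⟩, -⟩ := h.2 a (m.proj b) hab
    exact ⟨⟨(c, b), hc⟩, rfl⟩

theorem nm_id (x : PairOver N X) : Iso x (nm (MulActionHom.id G) x) := by
  have h := nm_of_isExponential (N := N) (x := x) (isExponential_id x.proj)
  rwa [N.tr_id, N.res_id] at h

theorem nm_comp (f : X →[G] Y) (g : Y →[G] Z) (x : PairOver N X) :
    Iso (nm g (nm f x)) (nm (g.comp f) x) := by
  have h := nm_of_isExponential (N := N) (x := x)
    ((isExponential_piSet f x.proj).comp (isExponential_piSet g (piProj f x.proj)))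
  rw [N.tr_comp, N.res_comp, N.mackey _ _ _ _ (isPullbackSquare_pb _ _).symm] at h
  exact h

theorem nm_mul (f : X →[G] Y) (x y : PairOver N X) :
    Iso ((nm f x).mul (nm f y)) (nm f (x.mul y)) := by
  -- `Π_f` preserves fibre products, so both sides have the same underlying `G`-set
  have h := nm_of_isExponential (N := N) (x := x.mul y) (isExponential_pb f x.proj y.proj)
  refine (congrArg (fun c => Iso (N := N) ⟨_, _, c⟩ _) ?_).mp h
  change N.tr _ (N.res _ (N.res _ _ * N.res _ _)) = N.res _ (N.tr _ _) * N.res _ (N.tr _ _)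
  rw [map_mul, map_mul]
  congr 1
  -- the coefficients agree by base change along the two projections of the fibre product
  · have sq : IsPullbackSquare (pbLift (pbFst _ _) ((pbFst _ _).comp (pbSnd _ _))
        (fun z => z.2) : pb f ((piProj f x.proj).comp
          (pbFst (piProj f x.proj) (piProj f y.proj))) →[G] pb f (piProj f x.proj))
        (pbSnd _ _) (piPull f x.proj) (pbFst (piProj f x.proj) (piProj f y.proj)) := by
      refine ⟨fun _ => rfl, ?_⟩
      rintro w ⟨⟨a, s⟩, ha⟩ (hs : _ = s)
      subst hs
      refine ⟨⟨(a, w), ha⟩, ⟨rfl, rfl⟩, ?_⟩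
      rintro ⟨⟨a', w'⟩, ha'⟩ ⟨h1, h2⟩
      exact Subtype.ext (Prod.ext (congrArg (fun z => z.1.1) h2) h1)
    rw [← N.mackey _ _ _ _ sq, N.res_res, N.res_res]
    rfl
  · have sq : IsPullbackSquare (pbLift (pbFst _ _) ((pbSnd _ _).comp (pbSnd _ _))
        (fun z => z.2.trans z.1.2.2) : pb f ((piProj f x.proj).comp
          (pbFst (piProj f x.proj) (piProj f y.proj))) →[G] pb f (piProj f y.proj))
        (pbSnd _ _) (piPull f y.proj) (pbSnd (piProj f x.proj) (piProj f y.proj)) := by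
      refine ⟨fun _ => rfl, ?_⟩
      rintro w ⟨⟨a, s⟩, ha⟩ (hs : _ = s)
      subst hs
      refine ⟨⟨(a, w), ha.trans w.2.symm⟩, ⟨rfl, rfl⟩, ?_⟩
      rintro ⟨⟨a', w'⟩, ha'⟩ ⟨h1, h2⟩
      exact Subtype.ext (Prod.ext (congrArg (fun z => z.1.1) h2) h1)
    rw [← N.mackey _ _ _ _ sq, N.res_res, N.res_res]
    rfl

theorem nm_one (f : X →[G] Y) : Iso (one N Y) (nm f (one N X)) := by
  have h := nm_of_isExponential (N := N) (x := one N X) (isExponential_proj_id f)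
  refine (congrArg (fun c => Iso (N := N) ⟨_, _, c⟩ _) ?_).mp h
  exact (congrArg _ (map_one _)).trans (map_one _)

theorem nm_mackey {X' Y' : FinGSet G} {f' : X' →[G] Y'} {x : X' →[G] X} {y : Y' →[G] Y}
    {f : X →[G] Y} (h : IsPullbackSquare f' x y f) (m : PairOver N Y') :
    Iso (res f (nm y m)) (nm x (res f' m)) := by
  have h' := nm_of_isExponential (N := N) (x := res f' m) (isExponential_baseChange h m.proj)
  refine (congrArg (fun c => Iso (N := N) ⟨_, _, c⟩ _) ?_).mp h'
  change N.tr _ (N.res _ (N.res _ _)) = N.res _ (N.tr _ _)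
  have sq : IsPullbackSquare (pbLift (f'.comp (pbFst _ _)) ((pbSnd _ _).comp (pbSnd _ _))
      (fun z => (h.1 _).symm.trans ((congrArg f z.2).trans z.1.2.2)) :
        pb x (pbFst f (piProj y m.proj)) →[G] pb y (piProj y m.proj))
      (pbSnd _ _) (piPull y m.proj) (pbSnd f (piProj y m.proj)) := by
    refine ⟨fun _ => rfl, ?_⟩
    rintro ⟨⟨a, s⟩, has⟩ ⟨⟨b, t⟩, hb⟩ (hs : s = t)
    subst hs
    obtain ⟨c, ⟨rfl, rfl⟩, hu⟩ := h.2 a b (has.trans hb.symm)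
    refine ⟨⟨(c, ⟨(x c, s), has⟩), rfl⟩, ⟨rfl, rfl⟩, ?_⟩
    rintro ⟨⟨c', ⟨⟨a', s'⟩, has'⟩⟩, hc' : x c' = a'⟩ ⟨h1, h2⟩
    have h3 : c' = c := hu c' ⟨hc'.trans (congrArg (fun z => z.1.1) h1),
      congrArg (fun z => z.1.1) h2⟩
    exact Subtype.ext (Prod.ext h3 h1)
  rw [← N.mackey _ _ _ _ sq, N.res_res, N.res_res]
  rfl

theorem distrib {A : FinGSet G} (f : X →[G] Y) (p : A →[G] X) (m : PairOver N A) :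
    Iso (tr (piProj f p) (nm (piPull f p) (res (piEval f p) m))) (nm f (tr p m)) := by
  have h := nm_of_isExponential (N := N) (x := tr p m)
    ((isExponential_piSet f p).comp_proj
      (isExponential_piSet (piPull f p) (pbFst (piEval f p) m.proj)))
  rw [N.res_comp] at h
  exact h

end Iso

end PairOver

/-! ### The Tambara functor of a Tambara functor and a semi-Mackey functor -/

/-- A finite `G`-set over `X` with coefficients in a Tambara functor `T` and in a semi-Mackey
functor `M`. -/
abbrev BiPair (T : Tambara G) (M : SemiMackey G) (X : FinGSet G) : Type (u + 1) :=
  PairOver (T.mu.prod M) X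

namespace BiPair

variable {T : Tambara G} {M : SemiMackey G} {X Y : FinGSet G}

/-- The coefficient in `T`. -/
def fst (x : BiPair T M X) : T.obj x.set := x.coeff.1

/-- The coefficient in `M`. -/
def snd (x : BiPair T M X) : M.obj x.set := x.coeff.2

/-- The pair `(p : A → X, t, m)`. -/
abbrev of {A : FinGSet G} (p : A →[G] X) (t : T.obj A) (m : M.obj A) : BiPair T M X :=
  ⟨A, p, (t, m)⟩

/-- The relation `(q ∘ a, t, a^* m) ∼ (q, a_+ t, m)` that makes the values of the tensor
product. -/
inductive Rel : BiPair T M X → BiPair T M X → Prop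
  | push {A B : FinGSet G} (q : B →[G] X) (a : A →[G] B) (t : T.obj A) (m : M.obj B) :
      Rel (of (q.comp a) t (M.res a m)) (of q (T.tr a t) m)

namespace Rel

theorem intro {A B : FinGSet G} {p : A →[G] X} {q : B →[G] X} (a : A →[G] B)
    {t : T.obj A} {t' : T.obj B} {m : M.obj A} {m' : M.obj B} (hp : ∀ x, q (a x) = p x)
    (ht : T.tr a t = t') (hm : M.res a m' = m) : Rel (of p t m) (of q t' m') := by
  obtain rfl : q.comp a = p := MulActionHom.ext hp
  subst ht hm
  exact .push q a t m'

theorem of_iso {x y : BiPair T M X} (h : PairOver.Iso x y) : Rel x y := by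
  rcases x with ⟨A, p, t, m⟩
  rcases y with ⟨B, q, t', m'⟩
  obtain ⟨(a : A →[G] B), ha, hp, hc⟩ := h
  obtain rfl : t = T.res a t' := congrArg Prod.fst hc
  exact intro (t := T.res a t') (t' := t') (m := m) (m' := m') a
    (fun x => DFunLike.congr_fun hp x)
    (T.tr_res_of_bijective a ha t') (congrArg Prod.snd hc).symm

theorem sum_left {x x' : BiPair T M X} (y : BiPair T M X) (h : Rel x x') :
    Rel (PairOver.sum x y) (PairOver.sum x' y) := by
  rcases y with ⟨C, r, s, n⟩
  rcases h with ⟨q, a, t, m⟩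
  refine intro (t := T.mu.pair t s) (t' := T.mu.pair (T.tr a t) s)
    (m := M.pair (M.res a m) n) (m' := M.pair m n) (sumMap a (MulActionHom.id G)) ?_ ?_ ?_
  · rintro (x | x) <;> rfl
  · rw [T.mu_pair, T.mu_pair, sumMap, T.tr_desc, T.res_inl_pair, T.res_inr_pair,
      T.tr_comp, T.tr_comp, T.tr_id, Tambara.pair]
  · refine M.sum_ext ?_ ?_
    · exact (M.res_res_eq (f := inl _ C) (g := sumMap a (MulActionHom.id G)) (f' := a)
        (g' := inl _ C) (fun _ => rfl) _).trans
        ((congrArg _ (M.res_inl_pair _ _)).trans (M.res_inl_pair _ _).symm)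
    · rw [M.res_inr_pair, M.res_res_of (k := inr _ _) (fun _ => rfl), M.res_inr_pair]

theorem mul_left {x x' : BiPair T M X} (y : BiPair T M X) (h : Rel x x') :
    Rel (PairOver.mul x y) (PairOver.mul x' y) := by
  rcases y with ⟨C, r, s, n⟩
  rcases h with ⟨q, a, t, m⟩
  let a' : pb (q.comp a) r →[G] pb q r :=
    pbLift (a.comp (pbFst (q.comp a) r)) (pbSnd (q.comp a) r) (fun w => w.2)
  have sq : IsPullbackSquare (pbFst (q.comp a) r) a' a (pbFst q r) := by
    refine ⟨fun _ => rfl, ?_⟩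
    rintro ⟨⟨b, c⟩, hbc⟩ d (hd : b = a d)
    subst hd
    refine ⟨⟨(d, c), hbc⟩, ⟨rfl, rfl⟩, ?_⟩
    rintro ⟨⟨d', c'⟩, h'⟩ ⟨h1, (h2 : d' = d)⟩
    exact Subtype.ext (Prod.ext h2 (congrArg (fun z => z.1.2) h1))
  refine intro (t := T.res (pbFst (q.comp a) r) t * T.res (pbSnd (q.comp a) r) s)
    (t' := T.res (pbFst q r) (T.tr a t) * T.res (pbSnd q r) s)
    (m := M.res (pbFst (q.comp a) r) (M.res a m) * M.res (pbSnd (q.comp a) r) n)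
    (m' := M.res (pbFst q r) m * M.res (pbSnd q r) n) a' (fun _ => rfl) ?_ ?_
  · rw [← T.tr_mackey _ _ _ _ sq, ← T.tr_mul_res, T.res_res]
    rfl
  · rw [map_mul, M.res_res, M.res_res, M.res_res]
    rfl

theorem res (f : X →[G] Y) {y y' : BiPair T M Y} (h : Rel y y') :
    Rel (PairOver.res f y) (PairOver.res f y') := by
  rcases h with ⟨q, a, t, m⟩
  let a' : pb f (q.comp a) →[G] pb f q :=
    pbLift (pbFst f (q.comp a)) (a.comp (pbSnd f (q.comp a))) (fun w => w.2)
  have sq : IsPullbackSquare (pbSnd f (q.comp a)) a' a (pbSnd f q) := by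
    refine ⟨fun _ => rfl, ?_⟩
    rintro ⟨⟨b, c⟩, hbc⟩ d (hd : c = a d)
    subst hd
    refine ⟨⟨(b, d), hbc⟩, ⟨rfl, rfl⟩, ?_⟩
    rintro ⟨⟨b', d'⟩, h'⟩ ⟨h1, (h2 : d' = d)⟩
    exact Subtype.ext (Prod.ext (congrArg (fun z => z.1.1) h1) h2)
  refine intro (t := T.res (pbSnd f (q.comp a)) t) (t' := T.res (pbSnd f q) (T.tr a t))
    (m := M.res (pbSnd f (q.comp a)) (M.res a m)) (m' := M.res (pbSnd f q) m)
    a' (fun _ => rfl) (T.tr_mackey _ _ _ _ sq t) ?_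
  rw [M.res_res, M.res_res]
  rfl

theorem tr (f : X →[G] Y) {x x' : BiPair T M X} (h : Rel x x') :
    Rel (PairOver.tr f x) (PairOver.tr f x') := by
  rcases h with ⟨q, a, t, m⟩
  exact .push (f.comp q) a t m

theorem nm (f : X →[G] Y) {x x' : BiPair T M X} (h : Rel x x') :
    Rel (PairOver.nm f x) (PairOver.nm f x') := by
  rcases h with ⟨q, a, t, m⟩
  refine intro (t := T.nm (piPull f (q.comp a)) (T.res (piEval f (q.comp a)) t))
    (t' := T.nm (piPull f q) (T.res (piEval f q) (T.tr a t)))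
    (m := M.tr (piPull f (q.comp a)) (M.res (piEval f (q.comp a)) (M.res a m)))
    (m' := M.tr (piPull f q) (M.res (piEval f q) m)) (piMap f q a) (fun _ => rfl) ?_ ?_
  · rw [T.res_tr, T.distrib_of_isExponential (isExponential_piMap f q a), T.res_res]
    rfl
  · rw [← M.mackey _ _ _ _ (isPullbackSquare_piMap f q a), M.res_res, M.res_res]
    rfl

end Rel

end BiPair

/-- The value at `X` of `T[M]`: the colimit of the sets `T(A)` over all `(p : A → X, m ∈ M(A))`.
As the index category has finite coproducts, this is also the colimit of abelian groups. -/
def Ext (T : Tambara G) (M : SemiMackey G) (X : FinGSet G) : Type (u + 1) :=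
  Quot (BiPair.Rel (T := T) (M := M) (X := X))

namespace Ext

variable {T : Tambara G} {M : SemiMackey G} {X Y Z : FinGSet G}

/-- The class of a pair. -/
def cls (x : BiPair T M X) : Ext T M X := Quot.mk _ x

/-- The class `[t, m]_{(A, p)}`. -/
def mk {A : FinGSet G} (p : A →[G] X) (t : T.obj A) (m : M.obj A) : Ext T M X :=
  cls (BiPair.of p t m)

@[elab_as_elim]
theorem ind {P : Ext T M X → Prop} (h : ∀ x : BiPair T M X, P (cls x)) (z : Ext T M X) : P z :=
  Quot.ind h z

@[elab_as_elim]
theorem ind_mk {P : Ext T M X → Prop}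
    (h : ∀ {A : FinGSet G} (p : A →[G] X) (t : T.obj A) (m : M.obj A), P (mk p t m))
    (z : Ext T M X) : P z :=
  Quot.ind (fun x => h x.proj x.fst x.snd) z

theorem sound {x y : BiPair T M X} (h : x.Rel y) : cls x = cls y := Quot.sound h

theorem sound_iso {x y : BiPair T M X} (h : PairOver.Iso x y) : cls x = cls y :=
  sound (.of_iso h)

theorem mk_eq {A B : FinGSet G} (p : A →[G] X) (q : B →[G] X) (a : A →[G] B)
    (h : ∀ x, q (a x) = p x) (t : T.obj A) (m : M.obj B) :
    mk p t (M.res a m) = mk q (T.tr a t) m :=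
  sound (.intro a h rfl rfl)

instance : Add (Ext T M X) :=
  ⟨Quot.lift₂ (fun x y => cls (PairOver.sum x y))
    (fun x _ _ h => (sound_iso (.sum_comm x _)).trans
      ((sound (.sum_left x h)).trans (sound_iso (.sum_comm _ x))))
    (fun _ _ y h => sound (.sum_left y h))⟩

instance : Mul (Ext T M X) :=
  ⟨Quot.lift₂ (fun x y => cls (PairOver.mul x y))
    (fun x _ _ h => (sound_iso (.mul_comm x _)).trans
      ((sound (.mul_left x h)).trans (sound_iso (.mul_comm _ x))))
    (fun _ _ y h => sound (.mul_left y h))⟩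

instance : Zero (Ext T M X) := ⟨cls (PairOver.zero _ X)⟩

instance : One (Ext T M X) := ⟨cls (PairOver.one _ X)⟩

instance : Neg (Ext T M X) :=
  ⟨Quot.map (fun x => BiPair.of x.proj (-x.fst) x.snd) (by
    rintro _ _ ⟨q, a, t, m⟩
    exact .intro (t := -t) (t' := -T.tr a t) a (fun _ => rfl) (map_neg (T.tr a) t) rfl)⟩

theorem neg_mk {A : FinGSet G} (p : A →[G] X) (t : T.obj A) (m : M.obj A) :
    -mk p t m = mk p (-t) m := rfl

theorem mk_zero {A : FinGSet G} (p : A →[G] X) (m : M.obj A) : mk p (0 : T.obj A) m = 0 := by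
  have h := mk_eq (T := T) (elim (empty G) X) p (elim (empty G) A) (fun x => PEmpty.elim x) 0 m
  rw [map_zero] at h
  rw [← h]
  exact sound_iso ⟨MulActionHom.id G, Function.bijective_id, rfl,
    (T.mu.prod M).eq_of_isEmpty (X := empty G) _ _⟩

/-- The class is additive in the coefficient from `T`. -/
theorem mk_add {A : FinGSet G} (p : A →[G] X) (s t : T.obj A) (m : M.obj A) :
    mk p (s + t) m = mk p s m + mk p t m := by
  symm
  refine sound (.intro (t := T.mu.pair s t) (t' := s + t) (m := M.pair m m) (m' := m)
    (desc (MulActionHom.id G) (MulActionHom.id G)) ?_ ?_ ?_)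
  · rintro (x | x) <;> rfl
  · rw [T.mu_pair, T.tr_desc, T.res_inl_pair, T.res_inr_pair, T.tr_id, T.tr_id]
  · refine M.sum_ext ?_ ?_
    · rw [M.res_inl_pair, M.res_res_of (k := MulActionHom.id G) (fun _ => rfl), M.res_id]
    · rw [M.res_inr_pair, M.res_res_of (k := MulActionHom.id G) (fun _ => rfl), M.res_id]

instance : CommRing (Ext T M X) where
  add_assoc x y z := by
    induction x using ind; induction y using ind; induction z using ind
    exact sound_iso (.sum_assoc _ _ _)
  zero_add x := by
    induction x using ind
    exact (sound_iso (.zero_sum _)).symm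
  add_zero x := by
    induction x using ind
    exact ((sound_iso (.zero_sum _)).trans (sound_iso (.sum_comm _ _))).symm
  add_comm x y := by
    induction x using ind; induction y using ind
    exact sound_iso (.sum_comm _ _)
  neg_add_cancel x := by
    induction x using ind_mk with
    | h p t m => rw [neg_mk, ← mk_add, neg_add_cancel, mk_zero]
  mul_assoc x y z := by
    induction x using ind; induction y using ind; induction z using ind
    exact sound_iso (.mul_assoc _ _ _)
  mul_comm x y := by
    induction x using ind; induction y using ind
    exact sound_iso (.mul_comm _ _)
  one_mul x := by
    induction x using ind
    exact sound_iso (.one_mul _)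
  mul_one x := by
    induction x using ind
    exact (sound_iso (.mul_comm _ _)).trans (sound_iso (.one_mul _))
  left_distrib x y z := by
    induction x using ind; induction y using ind; induction z using ind
    exact (sound_iso (.mul_sum _ _ _)).symm
  right_distrib x y z := by
    induction x using ind with | h x
    induction y using ind with | h y
    induction z using ind with | h z
    change cls (PairOver.mul (PairOver.sum x y) z) =
      cls (PairOver.mul x z) + cls (PairOver.mul y z)
    rw [sound_iso (.mul_comm _ z), sound_iso (.mul_comm x z), sound_iso (.mul_comm y z)]
    exact (sound_iso (.mul_sum _ _ _)).symm
  zero_mul x := by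
    induction x using ind
    exact sound_iso (.zero_mul _)
  mul_zero x := by
    induction x using ind
    exact (sound_iso (.mul_comm _ _)).trans (sound_iso (.zero_mul _))
  nsmul := nsmulRec
  zsmul := zsmulRec
  npow := npowRec

/-- Restriction in `T[M]`. -/
def res (f : X →[G] Y) : Ext T M Y →+* Ext T M X where
  toFun := Quot.map (PairOver.res f) fun _ _ h => h.res f
  map_one' := sound_iso (.res_one f)
  map_mul' x y := by
    induction x using ind; induction y using ind
    exact sound_iso (.res_mul f _ _)
  map_zero' := sound_iso (.res_zero f)
  map_add' x y := by
    induction x using ind; induction y using ind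
    exact (sound_iso (.res_sum f _ _)).symm

/-- Additive transfer in `T[M]`. -/
def tr (f : X →[G] Y) : Ext T M X →+ Ext T M Y where
  toFun := Quot.map (PairOver.tr f) fun _ _ h => h.tr f
  map_zero' := sound_iso (.tr_zero f)
  map_add' x y := by
    induction x using ind; induction y using ind
    exact sound_iso (.tr_sum f _ _)

/-- Multiplicative transfer in `T[M]`. -/
def nm (f : X →[G] Y) : Ext T M X →* Ext T M Y where
  toFun := Quot.map (PairOver.nm f) fun _ _ h => h.nm f
  map_one' := (sound_iso (.nm_one f)).symm
  map_mul' x y := by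
    induction x using ind; induction y using ind
    exact (sound_iso (.nm_mul f _ _)).symm

theorem tr_mackey {X' Y' : FinGSet G} (f' : X' →[G] Y') (x : X' →[G] X) (y : Y' →[G] Y)
    (f : X →[G] Y) (h : IsPullbackSquare f' x y f) (m : Ext T M Y') :
    tr x (res f' m) = res f (tr y m) := by
  induction m using ind
  exact sound_iso (.tr_mackey h _)

theorem eq_of_isEmpty (hX : IsEmpty X) (x y : Ext T M X) : x = y := by
  induction x using ind with | h x
  induction y using ind with | h y
  have : IsEmpty x.set := ⟨fun z => hX.elim (x.proj z)⟩
  have : IsEmpty y.set := ⟨fun z => hX.elim (y.proj z)⟩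
  exact sound_iso (.of_isEmpty x y)

theorem tr_res_sum (z : Ext T M (X.sum Y)) :
    tr (inl X Y) (res (inl X Y) z) + tr (inr X Y) (res (inr X Y) z) = z := by
  induction z using ind
  exact sound_iso (.tr_res_sum _)

theorem res_id (z : Ext T M X) : res (MulActionHom.id G) z = z := by
  induction z using ind
  exact sound_iso (.res_id _)

theorem tr_id (z : Ext T M X) : tr (MulActionHom.id G) z = z := by
  induction z using ind
  exact sound_iso (.tr_id _)

theorem res_tr_of_injective (a : X →[G] Y) (ha : Function.Injective a) (z : Ext T M X) :
    res a (tr a z) = z := by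
  rw [← tr_mackey _ _ _ _ (isPullbackSquare_of_injective a ha), tr_id, res_id]

theorem res_tr_of_disjoint (a : X →[G] Z) (b : Y →[G] Z) (h : ∀ x y, a x ≠ b y)
    (z : Ext T M Y) : res a (tr b z) = 0 := by
  rw [← tr_mackey _ _ _ _ (isPullbackSquare_of_disjoint a b h),
    eq_of_isEmpty (inferInstanceAs (IsEmpty (empty G))) (res _ z) 0, map_zero]

end Ext

/-- The Tambara functor `T[M]`. -/
def ext (T : Tambara G) (M : SemiMackey G) : Tambara G where
  obj := Ext T M
  res := Ext.res
  tr := Ext.tr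
  nm := Ext.nm
  res_id _ := Ext.res_id
  res_comp f g z := by
    induction z using Ext.ind
    exact Ext.sound_iso (.res_comp f g _)
  tr_id _ := Ext.tr_id
  tr_comp f g z := by
    induction z using Ext.ind
    exact Ext.sound_iso (.tr_comp f g _)
  nm_id _ z := by
    induction z using Ext.ind
    exact (Ext.sound_iso (.nm_id _)).symm
  nm_comp f g z := by
    induction z using Ext.ind
    exact (Ext.sound_iso (.nm_comp f g _)).symm
  additive_empty X hX := ⟨Ext.eq_of_isEmpty hX⟩
  additive_sum X Y := by
    constructor
    · intro x y h
      rw [← Ext.tr_res_sum x, ← Ext.tr_res_sum y]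
      rw [show Ext.res (inl X Y) x = Ext.res (inl X Y) y from congrArg Prod.fst h,
        show Ext.res (inr X Y) x = Ext.res (inr X Y) y from congrArg Prod.snd h]
    · rintro ⟨x, y⟩
      refine ⟨Ext.tr (inl X Y) x + Ext.tr (inr X Y) y, Prod.ext ?_ ?_⟩
      · change Ext.res _ (_ + _) = _
        rw [map_add, Ext.res_tr_of_injective _ (SemiMackey.inl_injective X Y),
          Ext.res_tr_of_disjoint _ _ (fun _ _ h => Sum.inl_ne_inr h), add_zero]
      · change Ext.res _ (_ + _) = _
        rw [map_add, Ext.res_tr_of_injective _ (SemiMackey.inr_injective X Y),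
          Ext.res_tr_of_disjoint _ _ (fun _ _ h => Sum.inr_ne_inl h), zero_add]
  tr_mackey := Ext.tr_mackey
  nm_mackey f' x y f h z := by
    induction z using Ext.ind
    exact (Ext.sound_iso (.nm_mackey h _)).symm
  distrib f p z := by
    induction z using Ext.ind
    exact (Ext.sound_iso (.distrib f p _)).symm

/-! ### The universal property of `T[M]` -/

namespace PairOver.Iso

variable {N : SemiMackey G} {X Y : FinGSet G}

theorem mul_id (m n : N.obj X) :
    Iso (PairOver.mul ⟨X, MulActionHom.id G, m⟩ ⟨X, MulActionHom.id G, n⟩)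
      (⟨X, MulActionHom.id G, m * n⟩ : PairOver N X) := by
  refine of_inverse (pbFst _ _) (fun x => ⟨(x, x), rfl⟩) ?_ (fun _ => rfl) (fun _ => rfl) ?_
  · rintro ⟨⟨x, y⟩, h : x = y⟩
    subst h
    rfl
  · exact (congrArg (N.res _ m * ·) (N.res_congr
      (f := pbSnd (MulActionHom.id G) (MulActionHom.id G))
      (g := pbFst (MulActionHom.id G) (MulActionHom.id G)) (fun w => w.2.symm) n)).trans
      (map_mul _ m n).symm

theorem res_mk_id (f : X →[G] Y) (n : N.obj Y) :
    Iso (PairOver.res f ⟨Y, MulActionHom.id G, n⟩)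
      (⟨X, MulActionHom.id G, N.res f n⟩ : PairOver N X) := by
  refine of_inverse (pbFst _ _) (fun x => ⟨(x, f x), rfl⟩) ?_ (fun _ => rfl) (fun _ => rfl) ?_
  · rintro ⟨⟨x, y⟩, h : f x = y⟩
    subst h
    rfl
  · exact (N.res_res_of (fun w : pb f (MulActionHom.id G) => w.2) n).symm

theorem nm_mk_id (f : X →[G] Y) (n : N.obj X) :
    Iso ⟨Y, MulActionHom.id G, N.tr f n⟩ (PairOver.nm f ⟨X, MulActionHom.id G, n⟩) := by
  have h := nm_of_isExponential (N := N) (x := ⟨X, MulActionHom.id G, n⟩)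
    (isExponential_proj_id f)
  rwa [N.res_id] at h

end PairOver.Iso

namespace Ext

variable {T : Tambara G} {M : SemiMackey G} {X Y : FinGSet G}

theorem mk_id_mul (s t : T.obj X) (m n : M.obj X) :
    mk (MulActionHom.id G) s m * mk (MulActionHom.id G) t n =
      mk (MulActionHom.id G) (s * t) (m * n) :=
  sound_iso (.mul_id (N := T.mu.prod M) (s, m) (t, n))

theorem res_mk_id (f : X →[G] Y) (t : T.obj Y) (m : M.obj Y) :
    res f (mk (MulActionHom.id G) t m) = mk (MulActionHom.id G) (T.res f t) (M.res f m) :=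
  sound_iso (.res_mk_id (N := T.mu.prod M) f (t, m))

theorem nm_mk_id (f : X →[G] Y) (t : T.obj X) (m : M.obj X) :
    nm f (mk (MulActionHom.id G) t m) = mk (MulActionHom.id G) (T.nm f t) (M.tr f m) :=
  (sound_iso (.nm_mk_id (N := T.mu.prod M) f (t, m))).symm

end Ext

/-- The coprojection `T ⟶ T[M]`, `t ↦ [t, 1]`. -/
def extCoeff (T : Tambara G) (M : SemiMackey G) : T ⟶ ext T M where
  app X :=
    { toFun := fun t => Ext.mk (MulActionHom.id G) t 1
      map_one' := rfl
      map_mul' := fun s t =>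
        Eq.trans (by rw [mul_one]) (Ext.mk_id_mul s t (1 : M.obj X) 1).symm
      map_zero' := Ext.mk_zero _ _
      map_add' := fun s t => Ext.mk_add _ s t 1 }
  res_app f t := by
    refine Eq.trans ?_ (Ext.res_mk_id f t 1).symm
    rw [map_one]
    rfl
  tr_app f t := by
    have h := Ext.mk_eq f (MulActionHom.id G) f (fun _ => rfl) t (1 : M.obj _)
    rw [map_one] at h
    exact h.symm
  nm_app f t := by
    refine Eq.trans ?_ (Ext.nm_mk_id f t 1).symm
    rw [map_one]
    rfl

/-- The coprojection `M ⟶ T[M]^μ`, `m ↦ [1, m]`. -/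
def extUnit (T : Tambara G) (M : SemiMackey G) : M ⟶ (ext T M).mu where
  app X :=
    { toFun := fun m => Ext.mk (MulActionHom.id G) 1 m
      map_one' := rfl
      map_mul' := fun s t =>
        Eq.trans (by rw [mul_one]) (Ext.mk_id_mul (1 : T.obj X) 1 s t).symm }
  res_app f m := by
    refine Eq.trans ?_ (Ext.res_mk_id f 1 m).symm
    rw [map_one]
    rfl
  tr_app f m := by
    refine Eq.trans ?_ (Ext.nm_mk_id f 1 m).symm
    rw [map_one]
    rfl

theorem extUnit_apply (T : Tambara G) (M : SemiMackey G) {X : FinGSet G} (m : M.obj X) :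
    (extUnit T M).app X m = Ext.mk (MulActionHom.id G) 1 m := rfl

/-- Every class is a transfer of a product of elements from `T` and from `M`. -/
theorem Ext.mk_eq_tr {T : Tambara G} {M : SemiMackey G} {A X : FinGSet G} (p : A →[G] X)
    (t : T.obj A) (m : M.obj A) :
    Ext.mk p t m = (ext T M).tr p ((extCoeff T M).app A t * (extUnit T M).app A m) := by
  refine Eq.symm ((congrArg (Ext.tr p) (Ext.mk_id_mul t 1 1 m)).trans ?_)
  rw [mul_one, one_mul]
  rfl

/-- Morphisms out of `T[M]` agree if they agree on `T` and on `M`. -/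
theorem ext_hom_ext {T S : Tambara G} {M : SemiMackey G} {φ ψ : ext T M ⟶ S}
    (h₁ : extCoeff T M ≫ φ = extCoeff T M ≫ ψ)
    (h₂ : ∀ (X : FinGSet G) (m : M.obj X),
      φ.app X ((extUnit T M).app X m) = ψ.app X ((extUnit T M).app X m)) : φ = ψ := by
  refine Tambara.Hom.ext (funext fun X => RingHom.ext fun z => ?_)
  induction z using Ext.ind_mk with
  | h p t m =>
    have h3 := congrArg (fun χ : T ⟶ S => χ.app _ t) h₁
    have h4 : φ.app _ ((extCoeff T M).app _ t) = ψ.app _ ((extCoeff T M).app _ t) := h3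
    rw [Ext.mk_eq_tr, φ.tr_app, ψ.tr_app, RingHom.map_mul, RingHom.map_mul, h4, h₂]

section lift

variable {T S : Tambara G} {M : SemiMackey G} (σ : T ⟶ S) (θ : M ⟶ S.mu)

/-- The values of the morphism `T[M] ⟶ S` on pairs. -/
def liftFun {X : FinGSet G} (x : BiPair T M X) : S.obj X :=
  S.tr x.proj (σ.app x.set x.fst * θ.app x.set x.snd)

theorem liftFun_rel {X : FinGSet G} {x y : BiPair T M X} (h : x.Rel y) :
    liftFun σ θ x = liftFun σ θ y := by
  rcases h with ⟨q, a, t, m⟩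
  change S.tr (q.comp a) (σ.app _ t * θ.app _ (M.res a m)) =
    S.tr q (σ.app _ (T.tr a t) * θ.app _ m)
  have h1 : θ.app _ (M.res a m) = S.res a (θ.app _ m) := θ.res_app a m
  rw [S.tr_comp, h1, S.tr_mul_res, σ.tr_app]

/-- The morphism `T[M] ⟶ S` given by a morphism `T ⟶ S` and a morphism `M ⟶ S^μ`. -/
def extLift : ext T M ⟶ S where
  app X :=
    { toFun := Quot.lift (liftFun σ θ) fun _ _ h => liftFun_rel σ θ h
      map_one' := by
        change S.tr _ (σ.app X 1 * θ.app X 1) = 1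
        rw [map_one, map_one, mul_one, S.tr_id]
      map_mul' := fun x y => by
        induction x using Ext.ind_mk with | h p t m
        induction y using Ext.ind_mk with | h q s n
        change S.tr (p.comp (pbFst p q))
            (σ.app (pb p q) (T.res (pbFst p q) t * T.res (pbSnd p q) s) *
              θ.app (pb p q) (M.res (pbFst p q) m * M.res (pbSnd p q) n)) =
          S.tr p (σ.app _ t * θ.app _ m) * S.tr q (σ.app _ s * θ.app _ n)
        have h1 := θ.res_app (pbFst p q) m
        have h2 := θ.res_app (pbSnd p q) n
        change _ = S.res _ _ at h1
        change _ = S.res _ _ at h2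
        rw [S.tr_mul_tr, RingHom.map_mul, MonoidHom.map_mul, RingHom.map_mul, RingHom.map_mul,
          σ.res_app, σ.res_app, h1, h2,
          mul_mul_mul_comm]
      map_zero' := by
        exact (congrArg (S.tr (elim (empty G) X)) (S.eq_of_isEmpty (X := empty G) _ 0)).trans
          (map_zero _)
      map_add' := fun x y => by
        induction x using Ext.ind_mk with | h p t m
        induction y using Ext.ind_mk with | h q s n
        change S.tr (desc p q) (σ.app (_ : FinGSet G) (T.mu.pair t s) * θ.app _ (M.pair m n)) =
          S.tr p (σ.app _ t * θ.app _ m) + S.tr q (σ.app _ s * θ.app _ n)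
        have h1 := θ.res_app (inl _ _) (M.pair m n)
        have h2 := θ.res_app (inr _ _) (M.pair m n)
        change _ = S.res _ _ at h1
        change _ = S.res _ _ at h2
        rw [T.mu_pair, S.tr_desc, RingHom.map_mul, RingHom.map_mul, ← σ.res_app, ← σ.res_app, ← h1, ← h2,
          T.res_inl_pair, T.res_inr_pair, M.res_inl_pair, M.res_inr_pair] }
  res_app {X Y} f z := by
    induction z using Ext.ind_mk with | h q t m
    change S.tr (pbFst f q) (σ.app (pb f q) (T.res (pbSnd f q) t) *
        θ.app (pb f q) (M.res (pbSnd f q) m)) =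
      S.res f (S.tr q (σ.app _ t * θ.app _ m))
    have h1 := θ.res_app (pbSnd f q) m
    change _ = S.res _ _ at h1
    rw [S.res_tr, RingHom.map_mul, σ.res_app, h1]
  tr_app f z := by
    induction z using Ext.ind_mk with | h p t m
    exact S.tr_comp p f _
  nm_app f z := by
    induction z using Ext.ind_mk with | h p t m
    change S.tr (piProj f p) (σ.app (piSet f p) (T.nm (piPull f p) (T.res (piEval f p) t)) *
        θ.app (piSet f p) (M.tr (piPull f p) (M.res (piEval f p) m))) =
      S.nm f (S.tr p (σ.app _ t * θ.app _ m))
    have h1 := θ.res_app (piEval f p) m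
    change _ = S.res _ _ at h1
    have h2 := θ.tr_app (piPull f p) (M.res (piEval f p) m)
    change _ = S.nm _ _ at h2
    rw [S.distrib, RingHom.map_mul, MonoidHom.map_mul, h2, h1, σ.nm_app, σ.res_app]

theorem extCoeff_lift : extCoeff T M ≫ extLift σ θ = σ := by
  refine Tambara.Hom.ext (funext fun X => RingHom.ext fun t => ?_)
  change S.tr _ (σ.app X t * θ.app X 1) = σ.app X t
  rw [map_one, mul_one, S.tr_id]

theorem extLift_unit {X : FinGSet G} (m : M.obj X) :
    (extLift σ θ).app X ((extUnit T M).app X m) = θ.app X m := by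
  change S.tr _ (σ.app X 1 * θ.app X m) = θ.app X m
  rw [map_one, one_mul, S.tr_id]

end lift

/-- The functoriality of `T[M]` in `T` and `M`. -/
def extMap {T T' : Tambara G} {M M' : SemiMackey G} (τ : T ⟶ T') (φ : M ⟶ M') :
    ext T M ⟶ ext T' M' :=
  extLift (τ ≫ extCoeff T' M') (φ ≫ extUnit T' M')

theorem extMap_mk {T T' : Tambara G} {M M' : SemiMackey G} (τ : T ⟶ T') (φ : M ⟶ M')
    {A X : FinGSet G} (p : A →[G] X) (t : T.obj A) (m : M.obj A) :
    (extMap τ φ).app X (Ext.mk p t m) = Ext.mk p (τ.app A t) (φ.app A m) :=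
  (Ext.mk_eq_tr p (τ.app A t) (φ.app A m)).symm

/-- The functor `(T, M) ↦ T[M]`. -/
def extFunctor (G : Type u) [Group G] : Tambara G × SemiMackey G ⥤ Tambara G where
  obj P := ext P.1 P.2
  map φ := extMap φ.1 φ.2
  map_id _ := by
    refine Tambara.Hom.ext (funext fun X => RingHom.ext fun z => ?_)
    induction z using Ext.ind_mk
    exact extMap_mk _ _ _ _ _
  map_comp φ ψ := by
    refine Tambara.Hom.ext (funext fun X => RingHom.ext fun z => ?_)
    induction z using Ext.ind_mk
    refine (extMap_mk _ _ _ _ _).trans (Eq.symm ?_)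
    exact (congrArg ((extMap ψ.1 ψ.2).app X) (extMap_mk φ.1 φ.2 _ _ _)).trans
      (extMap_mk _ _ _ _ _)

/-- The coprojections `T ⟶ T[M]` form a natural transformation. -/
def extIncl (G : Type u) [Group G] :
    CategoryTheory.Prod.fst (Tambara G) (SemiMackey G) ⟶ extFunctor G where
  app P := extCoeff P.1 P.2
  naturality _ Q φ := (extCoeff_lift (φ.1 ≫ extCoeff Q.1 Q.2) (φ.2 ≫ extUnit Q.1 Q.2)).symm

/-- `T[-]` is left adjoint to the multiplicative part on `T`-Tambara functors. -/
def extAdjunction (T : Tambara G) : coeffFunctor (extIncl G) T ⊣ underMu T :=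
  Adjunction.mkOfHomEquiv
    { homEquiv := fun M S =>
        { toFun := fun g => extUnit T M ≫ (muFunctor G).map g.right
          invFun := fun θ => Under.homMk (extLift S.hom θ) (extCoeff_lift S.hom θ)
          left_inv := fun g => by
            apply Under.UnderMorphism.ext
            refine ext_hom_ext ((extCoeff_lift _ _).trans (Under.w g).symm) fun X m => ?_
            exact extLift_unit S.hom (extUnit T M ≫ (muFunctor G).map g.right) m
          right_inv := fun θ => SemiMackey.Hom.ext (funext fun X => MonoidHom.ext fun m =>
            extLift_unit S.hom θ m) }
      homEquiv_naturality_left_symm := fun {M M' S} φ θ => by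
        apply Under.UnderMorphism.ext
        refine ext_hom_ext ?_ fun X m => ?_
        · refine (extCoeff_lift _ _).trans ?_
          have h := Under.w ((coeffFunctor (extIncl G) T).map φ ≫
            Under.homMk (U := Under.mk (extCoeff T M')) (extLift S.hom θ)
              (extCoeff_lift S.hom θ))
          exact h.symm
        · refine (extLift_unit S.hom (φ ≫ θ) m).trans (Eq.symm ?_)
          refine (congrArg ((extLift S.hom θ).app X)
            (extLift_unit (𝟙 T ≫ extCoeff T M') (φ ≫ extUnit T M') m)).trans ?_
          exact extLift_unit S.hom θ (φ.app X m)
      homEquiv_naturality_right := fun _ _ => rfl }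

/-! ### Orbits and functions multiplicative in disjoint unions -/

/-- The orbit of a point, as a point of the orbit space. -/
def orb {K : FinGSet G} (x : K) : MulAction.orbitRel.Quotient G K := Quotient.mk'' x

theorem orb_smul {K : FinGSet G} (g : G) (x : K) : orb (g • x) = orb x :=
  Quotient.sound' ⟨g, rfl⟩

theorem orb_eq_iff {K : FinGSet G} {x y : K} : orb x = orb y ↔ ∃ g : G, g • y = x :=
  Quotient.eq''

theorem orb_surjective {K : FinGSet G} (c : MulAction.orbitRel.Quotient G K) :
    ∃ x, orb x = c := Quotient.exists_rep c

instance {K : FinGSet G} : Finite (MulAction.orbitRel.Quotient G K) :=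
  Finite.of_surjective orb orb_surjective

/-- The map of orbit spaces induced by an equivariant map. -/
def orbMap {K L : FinGSet G} (a : K →[G] L) :
    MulAction.orbitRel.Quotient G K → MulAction.orbitRel.Quotient G L :=
  Quotient.lift (fun x => orb (a x)) (by
    rintro x y ⟨g, rfl⟩
    exact (congrArg orb (map_smul a g y)).trans (orb_smul g (a y)))

theorem orbMap_orb {K L : FinGSet G} (a : K →[G] L) (x : K) : orbMap a (orb x) = orb (a x) := rfl

theorem orbMap_bijective {K L : FinGSet G} (a : K →[G] L) (ha : Function.Bijective a) :
    Function.Bijective (orbMap a) := by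
  constructor
  · intro c d h
    obtain ⟨x, rfl⟩ := orb_surjective c
    obtain ⟨y, rfl⟩ := orb_surjective d
    obtain ⟨g, hg⟩ := orb_eq_iff.1 h
    rw [← map_smul] at hg
    exact orb_eq_iff.2 ⟨g, ha.1 hg⟩
  · intro c
    obtain ⟨y, rfl⟩ := orb_surjective c
    obtain ⟨x, rfl⟩ := ha.2 y
    exact ⟨orb x, rfl⟩

/-- A transitive finite `G`-set over `X`. -/
structure Orbit (X : FinGSet G) : Type (u + 1) where
  set : FinGSet G
  map : set →[G] X
  [trans : MulAction.IsPretransitive G set]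
  [nonempty : Nonempty set]

attribute [instance] Orbit.trans Orbit.nonempty

/-- The orbit `c` of `K`, as a `G`-set over `X`. -/
def orbitOver {K X : FinGSet G} (k : K →[G] X) (c : MulAction.orbitRel.Quotient G K) :
    Orbit X where
  set := K.sub (fun x => orb x = c) (fun g x h => (orb_smul g x).trans h)
  map := k.comp (subVal _ _ _)
  trans := ⟨by
    rintro ⟨x, hx⟩ ⟨y, hy⟩
    obtain ⟨g, hg⟩ := orb_eq_iff.1 (hy.trans hx.symm)
    exact ⟨g, Subtype.ext hg⟩⟩
  nonempty := by
    obtain ⟨x, hx⟩ := orb_surjective c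
    exact ⟨⟨x, hx⟩⟩

/-- The composition of an orbit over `X` with a map `X → Y`. -/
def Orbit.push {X Y : FinGSet G} (f : X →[G] Y) (K : Orbit X) : Orbit Y where
  set := K.set
  map := f.comp K.map

/-- A lift `l` of the structure map of an orbit along `f`. -/
def Orbit.withMap {X Y : FinGSet G} (K : Orbit Y) (l : K.set →[G] X) : Orbit X where
  set := K.set
  map := l

/-- Induction on finite `G`-sets: they are built from orbits by disjoint unions. -/
theorem orbit_induction {P : FinGSet G → Prop} (empty : ∀ K : FinGSet G, IsEmpty K → P K)
    (orbit : ∀ K : FinGSet G, MulAction.IsPretransitive G K → Nonempty K → P K)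
    (sum : ∀ K L : FinGSet G, P K → P L → P (K.sum L))
    (iso : ∀ (K L : FinGSet G) (a : K →[G] L), Function.Bijective a → P K → P L) (K : FinGSet G) : P K := by
  induction hn : Nat.card K using Nat.strong_induction_on generalizing K with
  | _ n ih =>
    rcases isEmpty_or_nonempty K with hK | ⟨⟨x⟩⟩
    · exact empty K hK
    · let K₁ := orbitOver (MulActionHom.id G) (orb x)
      let K₂ : FinGSet G := K.sub (fun y => orb y ≠ orb x) (fun g y h => by rwa [orb_smul])
      have h₂ : Nat.card K₂ < n := by
        rw [← hn]
        exact Finite.card_subtype_lt (p := fun y => orb y ≠ orb x) (x := x) (by simp)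
      refine iso (K₁.set.sum K₂) K (desc K₁.map (subVal _ _ _)) ⟨?_, ?_⟩
        (sum _ _ (orbit _ K₁.trans K₁.nonempty) (ih _ h₂ K₂ rfl))
      · rintro (⟨y, hy⟩ | ⟨y, hy⟩) (⟨z, hz⟩ | ⟨z, hz⟩) (h : y = z)
        · subst h; rfl
        · subst h; exact (hz hy).elim
        · subst h; exact (hy hz).elim
        · subst h; rfl
      · intro y
        by_cases hy : orb y = orb x
        · exact ⟨Sum.inl ⟨y, hy⟩, rfl⟩
        · exact ⟨Sum.inr ⟨y, hy⟩, rfl⟩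

/-- Functions of `G`-sets over `X` that are invariant under isomorphism and take disjoint unions
to products. -/
structure IsMult {X : FinGSet G} (Φ : ∀ {K : FinGSet G}, (K →[G] X) → ℤ) : Prop where
  iso : ∀ {K L : FinGSet G} (k : K →[G] X) (l : L →[G] X) (a : K →[G] L),
    Function.Bijective a → (∀ x, l (a x) = k x) → Φ k = Φ l
  empty : ∀ {K : FinGSet G} (k : K →[G] X), IsEmpty K → Φ k = 1
  sum : ∀ {K L : FinGSet G} (k : K →[G] X) (l : L →[G] X), Φ (desc k l) = Φ k * Φ l

/-- Multiplicative functions are determined by their values on orbits. -/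
theorem IsMult.ext {X : FinGSet G} {Φ Ψ : ∀ {K : FinGSet G}, (K →[G] X) → ℤ} (hΦ : IsMult Φ)
    (hΨ : IsMult Ψ) (h : ∀ K : Orbit X, Φ K.map = Ψ K.map) {K : FinGSet G} (k : K →[G] X) :
    Φ k = Ψ k := by
  induction K using orbit_induction with
  | empty K hK => rw [hΦ.empty k hK, hΨ.empty k hK]
  | orbit K h₁ h₂ => exact h ⟨K, k⟩
  | sum K L hK hL =>
    have : k = desc (k.comp (inl K L)) (k.comp (inr K L)) := sum_hom_ext rfl rfl
    rw [this, hΦ.sum, hΨ.sum, hK, hL]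
  | iso K L a ha hK =>
    rw [← hΦ.iso (k.comp a) k a ha (fun _ => rfl), ← hΨ.iso (k.comp a) k a ha (fun _ => rfl), hK]

/-- Functions of orbits over `X`. -/
abbrev Ghost (X : FinGSet G) : Type (u + 1) := Orbit X → ℤ

namespace Ghost

variable {X Y Z : FinGSet G}

/-- Invariance under isomorphism. -/
def Invariant (φ : Ghost X) : Prop :=
  ∀ (K L : Orbit X) (a : K.set →[G] L.set), Function.Bijective a →
    (∀ x, L.map (a x) = K.map x) → φ K = φ L

/-- The multiplicative extension of a function of orbits. -/
def prodExt (φ : Ghost X) {K : FinGSet G} (k : K →[G] X) : ℤ := ∏ᶠ c, φ (orbitOver k c)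

theorem prodExt_orbit {φ : Ghost X} (hφ : φ.Invariant) (K : Orbit X) :
    φ.prodExt K.map = φ K := by
  have x : K.set := Classical.choice K.nonempty
  have hx : ∀ y : K.set, orb y = orb x := fun y =>
    orb_eq_iff.2 (MulAction.exists_smul_eq G x y)
  have : Unique (MulAction.orbitRel.Quotient G K.set) :=
    ⟨⟨orb x⟩, fun c => by
      obtain ⟨y, rfl⟩ := orb_surjective c
      exact hx y⟩
  rw [prodExt, finprod_unique]
  refine hφ _ _ (subVal _ _ _) ⟨Subtype.val_injective, fun y => ⟨⟨y, ?_⟩, rfl⟩⟩ (fun _ => rfl)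
  exact Subsingleton.elim _ _

/-- The orbits of a disjoint union are the orbits of its summands. -/
theorem prodExt_isMult {φ : Ghost X} (hφ : φ.Invariant) : IsMult (fun k => φ.prodExt k) where
  iso {K L} k l a ha h := by
    refine finprod_eq_of_bijective (orbMap a) (orbMap_bijective a ha) fun c => ?_
    refine hφ _ _ ⟨fun x => ⟨a x.1, (orbMap_orb a x.1).symm.trans (congrArg (orbMap a) x.2)⟩,
      fun g x => Subtype.ext (map_smul a g x.1)⟩ ⟨?_, ?_⟩ (fun x => h x.1)
    · intro x y hxy
      exact Subtype.ext (ha.1 (congrArg Subtype.val hxy))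
    · rintro ⟨y, hy⟩
      obtain ⟨x, rfl⟩ := ha.2 y
      exact ⟨⟨x, (orbMap_bijective a ha).1 hy⟩, rfl⟩
  empty k hK := by
    have : IsEmpty (MulAction.orbitRel.Quotient G _) :=
      ⟨fun c => hK.elim (orb_surjective c).choose⟩
    exact finprod_of_isEmpty _
  sum {K L} k l := by
    have hb : Function.Bijective (Sum.elim (orbMap (inl K L)) (orbMap (inr K L))) := by
      constructor
      · rintro (c | c) (d | d) h
        all_goals
          obtain ⟨x, rfl⟩ := orb_surjective c
          obtain ⟨y, rfl⟩ := orb_surjective d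
          obtain ⟨g, hg⟩ := orb_eq_iff.1 h
        · exact congrArg Sum.inl (orb_eq_iff.2 ⟨g, Sum.inl_injective hg⟩)
        · exact (Sum.inr_ne_inl hg).elim
        · exact (Sum.inl_ne_inr hg).elim
        · exact congrArg Sum.inr (orb_eq_iff.2 ⟨g, Sum.inr_injective hg⟩)
      · intro c
        obtain ⟨x, rfl⟩ := orb_surjective c
        rcases x with x | x
        · exact ⟨Sum.inl (orb x), rfl⟩
        · exact ⟨Sum.inr (orb x), rfl⟩
    have hl : ∀ c, φ (orbitOver k c) = φ (orbitOver (desc k l) (orbMap (inl K L) c)) := by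
      intro c
      refine hφ _ _ ⟨fun x => ⟨inl K L x.1, congrArg (orbMap (inl K L)) x.2⟩,
        fun g x => rfl⟩ ⟨?_, ?_⟩ (fun _ => rfl)
      · intro x y hxy
        exact Subtype.ext (Sum.inl_injective (congrArg Subtype.val hxy))
      · rintro ⟨y | y, hy⟩
        · exact ⟨⟨y, Sum.inl_injective (hb.1 (a₁ := Sum.inl (orb y)) (a₂ := Sum.inl c) hy)⟩, rfl⟩
        · exact (Sum.inr_ne_inl (hb.1 (a₁ := Sum.inr (orb y)) (a₂ := Sum.inl c) hy)).elim
    have hr : ∀ c, φ (orbitOver l c) = φ (orbitOver (desc k l) (orbMap (inr K L) c)) := by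
      intro c
      refine hφ _ _ ⟨fun x => ⟨inr K L x.1, congrArg (orbMap (inr K L)) x.2⟩,
        fun g x => rfl⟩ ⟨?_, ?_⟩ (fun _ => rfl)
      · intro x y hxy
        exact Subtype.ext (Sum.inr_injective (congrArg Subtype.val hxy))
      · rintro ⟨y | y, hy⟩
        · exact (Sum.inl_ne_inr (hb.1 (a₁ := Sum.inl (orb y)) (a₂ := Sum.inr c) hy)).elim
        · exact ⟨⟨y, Sum.inr_injective (hb.1 (a₁ := Sum.inr (orb y)) (a₂ := Sum.inr c) hy)⟩, rfl⟩
    let _ := Fintype.ofFinite (MulAction.orbitRel.Quotient G K)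
    let _ := Fintype.ofFinite (MulAction.orbitRel.Quotient G L)
    rw [prodExt, prodExt, prodExt, ← finprod_eq_of_bijective (f := Sum.elim
      (fun c => φ (orbitOver k c)) (fun c => φ (orbitOver l c))) _ hb]
    · rw [finprod_eq_prod_of_fintype, finprod_eq_prod_of_fintype, finprod_eq_prod_of_fintype,
        Fintype.prod_sum_type]
      rfl
    · rintro (c | c)
      · exact hl c
      · exact hr c

theorem prodExt_mul (φ ψ : Ghost X) {K : FinGSet G} (k : K →[G] X) :
    (φ * ψ).prodExt k = φ.prodExt k * ψ.prodExt k :=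
  finprod_mul_distrib (Set.toFinite _) (Set.toFinite _)

theorem prodExt_one {K : FinGSet G} (k : K →[G] X) : (1 : Ghost X).prodExt k = 1 := finprod_one

end Ghost

/-! ### Lifts -/

/-- The lifts of `k : K → X` along `p : A → X`. -/
abbrev Lift {K A X : FinGSet G} (k : K →[G] X) (p : A →[G] X) : Type u :=
  {l : K →[G] A // ∀ x, p (l x) = k x}

instance {K A X : FinGSet G} (k : K →[G] X) (p : A →[G] X) : Finite (Lift k p) :=
  inferInstanceAs (Finite {l : K →[G] A // ∀ x, p (l x) = k x})

theorem finsum_mul_finsum {α β : Type*} [Finite α] [Finite β] (f : α → ℤ) (g : β → ℤ) :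
    (∑ᶠ a, f a) * ∑ᶠ b, g b = ∑ᶠ m : α × β, f m.1 * g m.2 := by
  let _ := Fintype.ofFinite α
  let _ := Fintype.ofFinite β
  rw [finsum_eq_sum_of_fintype, finsum_eq_sum_of_fintype, finsum_eq_sum_of_fintype,
    Fintype.sum_mul_sum, Fintype.sum_prod_type]

/-- Sums of multiplicative functions over lifts are multiplicative. -/
theorem IsMult.lift_sum {X Y : FinGSet G} {Φ : ∀ {K : FinGSet G}, (K →[G] X) → ℤ}
    (hΦ : IsMult Φ) (f : X →[G] Y) : IsMult (fun k => ∑ᶠ l : Lift k f, Φ l.1) where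
  iso {K L} k l a ha h := by
    symm
    refine finsum_eq_of_bijective (fun m => ⟨m.1.comp a, fun x => (m.2 _).trans (h x)⟩)
      ⟨?_, ?_⟩ (fun m => (hΦ.iso _ _ a ha (fun _ => rfl)).symm)
    · intro m n hmn
      refine Subtype.ext (MulActionHom.ext fun y => ?_)
      obtain ⟨x, rfl⟩ := ha.2 y
      exact DFunLike.congr_fun (congrArg Subtype.val hmn) x
    · rintro ⟨m, hm⟩
      refine ⟨⟨m.comp (inv a ha), fun y => ?_⟩, Subtype.ext (MulActionHom.ext fun x => ?_)⟩
      · obtain ⟨x, rfl⟩ := ha.2 y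
        rw [MulActionHom.comp_apply, inv_apply, hm, h]
      · exact congrArg m (inv_apply a ha x)
  empty {K} k hK := by
    have : Unique (Lift k f) :=
      ⟨⟨⟨elim K X, fun x => hK.elim x⟩⟩, fun l => Subtype.ext (MulActionHom.ext fun x =>
        hK.elim x)⟩
    rw [finsum_unique, hΦ.empty _ hK]
  sum {K L} k l := by
    rw [finsum_mul_finsum]
    symm
    refine finsum_eq_of_bijective (fun m => ⟨desc m.1.1 m.2.1, ?_⟩) ⟨?_, ?_⟩
      (fun m => (hΦ.sum _ _).symm)
    · rintro (x | x)
      · exact m.1.2 x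
      · exact m.2.2 x
    · rintro ⟨⟨m, hm⟩, ⟨n, hn⟩⟩ ⟨⟨m', hm'⟩, ⟨n', hn'⟩⟩ h
      have h' : desc m n = desc m' n' := congrArg Subtype.val h
      refine Prod.ext (Subtype.ext (MulActionHom.ext fun x => ?_))
        (Subtype.ext (MulActionHom.ext fun x => ?_))
      · exact DFunLike.congr_fun h' (Sum.inl x)
      · exact DFunLike.congr_fun h' (Sum.inr x)
    · rintro ⟨m, hm⟩
      exact ⟨(⟨m.comp (inl K L), fun x => hm (Sum.inl x)⟩,
        ⟨m.comp (inr K L), fun x => hm (Sum.inr x)⟩), Subtype.ext (sum_hom_ext rfl rfl)⟩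

/-- Multiplicative functions pull back along base change. -/
theorem IsMult.baseChange {X Y : FinGSet G} {Φ : ∀ {K : FinGSet G}, (K →[G] X) → ℤ}
    (hΦ : IsMult Φ) (f : X →[G] Y) : IsMult (fun k => Φ (pbFst f k)) where
  iso {K L} k l a ha h := by
    refine hΦ.iso _ _ (pbLift (pbFst _ _) (a.comp (pbSnd _ _))
      (fun w => w.2.trans (h _).symm)) ⟨?_, ?_⟩ (fun _ => rfl)
    · rintro ⟨⟨x, y⟩, hxy⟩ ⟨⟨x', y'⟩, hxy'⟩ hw
      refine Subtype.ext (Prod.ext (congrArg (fun z => z.1.1) hw) (ha.1 ?_))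
      exact congrArg (fun z => z.1.2) hw
    · rintro ⟨⟨x, y⟩, hxy⟩
      obtain ⟨y, rfl⟩ := ha.2 y
      exact ⟨⟨(x, y), hxy.trans (h y)⟩, rfl⟩
  empty k hK := hΦ.empty _ ⟨fun w => hK.elim w.1.2⟩
  sum {K L} k l := by
    refine Eq.trans ?_ (hΦ.sum (pbFst f k) (pbFst f l))
    symm
    refine hΦ.iso _ _ (desc
      (pbLift (pbFst _ _) ((inl _ _).comp (pbSnd _ _)) (fun w => w.2))
      (pbLift (pbFst _ _) ((inr _ _).comp (pbSnd _ _)) (fun w => w.2))) ?_ ?_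
    · refine bijective_of_inverse _ (fun w => match w with
        | ⟨(a, Sum.inl b), h⟩ => Sum.inl ⟨(a, b), h⟩
        | ⟨(a, Sum.inr b), h⟩ => Sum.inr ⟨(a, b), h⟩) ?_ ?_
      · rintro (w | w) <;> rfl
      · rintro ⟨⟨a, b | b⟩, h⟩ <;> rfl
    · rintro (w | w) <;> rfl

/-! ### The ghost Tambara functor -/

theorem finsum_sigma_of_finite {α : Type*} {β : α → Type*} [Finite α] [∀ a, Finite (β a)]
    {B : Type*} [AddCommMonoid B] (f : (Σ a, β a) → B) : ∑ᶠ s, f s = ∑ᶠ a, ∑ᶠ b, f ⟨a, b⟩ := by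
  let _ := Fintype.ofFinite α
  let _ := fun a => Fintype.ofFinite (β a)
  simp only [finsum_eq_sum_of_fintype, Fintype.sum_sigma]

theorem IsMult.invariant {X : FinGSet G} {Φ : ∀ {K : FinGSet G}, (K →[G] X) → ℤ}
    (hΦ : IsMult Φ) : Ghost.Invariant fun K : Orbit X => Φ K.map :=
  fun _ _ a ha h => hΦ.iso _ _ a ha h

theorem IsMult.prodExt_eq {X : FinGSet G} {Φ : ∀ {K : FinGSet G}, (K →[G] X) → ℤ}
    (hΦ : IsMult Φ) {φ : Ghost X} (h : ∀ K, φ K = Φ K.map) {K : FinGSet G} (k : K →[G] X) :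
    φ.prodExt k = Φ k := by
  have hφ : φ.Invariant := by
    rw [show φ = fun K => Φ K.map from funext h]
    exact hΦ.invariant
  exact (Ghost.prodExt_isMult hφ).ext hΦ (fun K => (Ghost.prodExt_orbit hφ K).trans (h K)) k

namespace Ghost

variable {X Y Z : FinGSet G}

/-- The ring of isomorphism invariant integer functions of orbits over `X`. -/
def ring (X : FinGSet G) : Subring (Ghost X) where
  carrier := {φ | φ.Invariant}
  zero_mem' _ _ _ _ _ := rfl
  one_mem' _ _ _ _ _ := rfl
  add_mem' hφ hψ K L a ha h := congrArg₂ (· + ·) (hφ K L a ha h) (hψ K L a ha h)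
  mul_mem' hφ hψ K L a ha h := congrArg₂ (· * ·) (hφ K L a ha h) (hψ K L a ha h)
  neg_mem' hφ K L a ha h := congrArg Neg.neg (hφ K L a ha h)

/-- Restriction of a function of orbits. -/
def res (f : X →[G] Y) (φ : Ghost Y) : Ghost X := fun K => φ (K.push f)

/-- The additive transfer: the sum of the values on all lifts of an orbit. -/
def tr (f : X →[G] Y) (φ : Ghost X) : Ghost Y :=
  fun K => ∑ᶠ l : Lift K.map f, φ (K.withMap l.1)

/-- The multiplicative transfer: the product of the values on all orbits of the fibre product. -/
def nm (f : X →[G] Y) (φ : Ghost X) : Ghost Y := fun K => φ.prodExt (pbFst f K.map)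

theorem tr_eq (f : X →[G] Y) {φ : Ghost X} (hφ : φ.Invariant) (K : Orbit Y) :
    tr f φ K = ∑ᶠ l : Lift K.map f, φ.prodExt l.1 :=
  finsum_congr fun l => (prodExt_orbit hφ (K.withMap l.1)).symm

theorem res_invariant (f : X →[G] Y) {φ : Ghost Y} (hφ : φ.Invariant) : (res f φ).Invariant :=
  fun _ _ a ha h => hφ _ _ a ha fun x => congrArg f (h x)

theorem tr_invariant (f : X →[G] Y) {φ : Ghost X} (hφ : φ.Invariant) : (tr f φ).Invariant := by
  rw [show tr f φ = fun K => _ from funext (tr_eq f hφ)]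
  exact ((prodExt_isMult hφ).lift_sum f).invariant

theorem nm_invariant (f : X →[G] Y) {φ : Ghost X} (hφ : φ.Invariant) : (nm f φ).Invariant :=
  ((prodExt_isMult hφ).baseChange f).invariant

theorem prodExt_tr (f : X →[G] Y) {φ : Ghost X} (hφ : φ.Invariant) {K : FinGSet G}
    (k : K →[G] Y) : (tr f φ).prodExt k = ∑ᶠ l : Lift k f, φ.prodExt l.1 :=
  ((prodExt_isMult hφ).lift_sum f).prodExt_eq (tr_eq f hφ) k

theorem prodExt_nm (f : X →[G] Y) {φ : Ghost X} (hφ : φ.Invariant) {K : FinGSet G}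
    (k : K →[G] Y) : (nm f φ).prodExt k = φ.prodExt (pbFst f k) :=
  ((prodExt_isMult hφ).baseChange f).prodExt_eq (fun _ => rfl) k

theorem tr_id (φ : Ghost X) : tr (MulActionHom.id G) φ = φ := by
  funext K
  let _ : Unique (Lift K.map (MulActionHom.id G)) :=
    ⟨⟨⟨K.map, fun _ => rfl⟩⟩, fun l => Subtype.ext (MulActionHom.ext fun x => l.2 x)⟩
  exact finsum_unique fun l : Lift K.map (MulActionHom.id G) => φ (K.withMap l.1)

theorem tr_comp (f : X →[G] Y) (g : Y →[G] Z) (φ : Ghost X) :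
    tr (g.comp f) φ = tr g (tr f φ) := by
  funext K
  refine Eq.trans ?_ (finsum_sigma_of_finite
    (fun s : (Σ m : Lift K.map g, Lift m.1 f) => φ (K.withMap s.2.1)))
  symm
  refine finsum_eq_of_bijective (fun s => ⟨s.2.1, fun x => ?_⟩) ⟨?_, ?_⟩ (fun _ => rfl)
  · exact (congrArg g (s.2.2 x)).trans (s.1.2 x)
  · rintro ⟨⟨m, hm⟩, ⟨l, hl⟩⟩ ⟨⟨m', hm'⟩, ⟨l', hl'⟩⟩ h
    obtain rfl : l = l' := congrArg Subtype.val h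
    obtain rfl : m = m' := MulActionHom.ext fun x => (hl x).symm.trans (hl' x)
    rfl
  · rintro ⟨l, hl⟩
    exact ⟨⟨⟨f.comp l, hl⟩, ⟨l, fun _ => rfl⟩⟩, rfl⟩

theorem nm_id {φ : Ghost X} (hφ : φ.Invariant) : nm (MulActionHom.id G) φ = φ := by
  funext K
  refine Eq.trans ?_ (prodExt_orbit hφ K)
  exact (prodExt_isMult hφ).iso _ _ (pbSnd (MulActionHom.id G) K.map)
    (bijective_of_inverse _ (fun x => ⟨(K.map x, x), rfl⟩)
      (fun w => Subtype.ext (Prod.ext w.2.symm rfl)) (fun _ => rfl)) (fun w => w.2.symm)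

theorem nm_comp (f : X →[G] Y) (g : Y →[G] Z) {φ : Ghost X} (hφ : φ.Invariant) :
    nm (g.comp f) φ = nm g (nm f φ) := by
  funext K
  refine Eq.trans ?_ (prodExt_nm f hφ (pbFst g K.map)).symm
  symm
  exact (prodExt_isMult hφ).iso _ _
    (pbLift (pbFst _ _) ((pbSnd _ _).comp (pbSnd _ _))
      (fun w => (congrArg g w.2).trans (w.1.2.2 : _)) :
      pb f (pbFst g K.map) →[G] pb (g.comp f) K.map)
    (bijective_of_inverse _ (fun w => ⟨(w.1.1, ⟨(f w.1.1, w.1.2), w.2⟩), rfl⟩)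
      (fun w => by
        obtain ⟨⟨x, ⟨⟨y, c⟩, h₁⟩⟩, h₂⟩ := w
        obtain rfl : f x = y := h₂
        rfl) (fun _ => rfl)) (fun _ => rfl)

theorem tr_mackey {X' Y' : FinGSet G} {f' : X' →[G] Y'} {x : X' →[G] X} {y : Y' →[G] Y}
    {f : X →[G] Y} (h : IsPullbackSquare f' x y f) (φ : Ghost Y') :
    tr x (res f' φ) = res f (tr y φ) := by
  funext K
  refine finsum_eq_of_bijective
    (fun l => ⟨f'.comp l.1, fun c => (h.1 _).symm.trans (congrArg f (l.2 c))⟩) ⟨?_, ?_⟩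
    (fun _ => rfl)
  · intro l m hlm
    refine Subtype.ext (MulActionHom.ext fun c => h.hom_ext ((l.2 c).trans (m.2 c).symm) ?_)
    exact DFunLike.congr_fun (congrArg Subtype.val hlm) c
  · rintro ⟨l, hl⟩
    choose m hm using fun c => h.2 (K.map c) (l c) (hl c).symm
    refine ⟨⟨⟨m, fun g c => h.hom_ext ?_ ?_⟩, fun c => (hm c).1.1⟩,
      Subtype.ext (MulActionHom.ext fun c => (hm c).1.2)⟩
    · exact (hm _).1.1.trans ((map_smul K.map g c).trans
        ((congrArg (g • ·) (hm c).1.1.symm).trans (map_smul x g _).symm))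
    · exact (hm _).1.2.trans ((map_smul l g c).trans
        ((congrArg (g • ·) (hm c).1.2.symm).trans (map_smul f' g _).symm))

theorem nm_mackey {X' Y' : FinGSet G} {f' : X' →[G] Y'} {x : X' →[G] X} {y : Y' →[G] Y}
    {f : X →[G] Y} (h : IsPullbackSquare f' x y f) {φ : Ghost Y'} (hφ : φ.Invariant) :
    nm x (res f' φ) = res f (nm y φ) := by
  funext K
  refine (prodExt_isMult hφ).iso (f'.comp (pbFst x K.map)) (pbFst y (f.comp K.map))
    (pbLift (f'.comp (pbFst _ _)) (pbSnd _ _)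
      (fun w => (h.1 _).symm.trans (congrArg f w.2))) ⟨?_, ?_⟩ (fun _ => rfl)
  · rintro ⟨⟨a, c⟩, e⟩ ⟨⟨b, d⟩, e'⟩ hw
    obtain rfl : c = d := congrArg (fun w => w.1.2) hw
    obtain rfl : a = b := h.hom_ext (e.trans e'.symm) (congrArg (fun w => w.1.1) hw)
    rfl
  · rintro ⟨⟨b, c⟩, e⟩
    obtain ⟨a, ⟨ha, rfl⟩, -⟩ := h.2 (K.map c) b e.symm
    exact ⟨⟨(a, c), ha⟩, rfl⟩

theorem distrib {A : FinGSet G} (f : X →[G] Y) (p : A →[G] X) {φ : Ghost A}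
    (hφ : φ.Invariant) :
    nm f (tr p φ) = tr (piProj f p) (nm (piPull f p) (res (piEval f p) φ)) := by
  funext K
  refine (prodExt_tr p hφ (pbFst f K.map)).trans ?_
  symm
  refine finsum_eq_of_bijective (fun m : Lift K.map (piProj f p) =>
    (⟨⟨fun w => FibreSection.sec (m.1 w.1.2) w.1.1 (w.2.trans (m.2 _).symm), ?_⟩, ?_⟩ :
      Lift (pbFst f K.map) p)) ⟨?_, ?_⟩ ?_
  -- a lift of `K` to `Π_f(A)` is the same as a lift of `X ×_Y K` to `A`
  · intro g w
    have key : ∀ (s : piSet f p) (hs : s = g • m.1 w.1.2) h,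
        FibreSection.sec s (g • w.1.1) h =
          g • FibreSection.sec (m.1 w.1.2) w.1.1 (w.2.trans (m.2 _).symm) := by
      rintro s rfl h
      exact congrArg (g • ·) (FibreSection.sec_congr _ (inv_smul_smul g _) _ _)
    exact key _ (map_smul m.1 g w.1.2) _
  · exact fun w => FibreSection.proj_sec _ _ _
  · intro m m' h
    refine Subtype.ext (MulActionHom.ext fun c => FibreSection.ext'
      ((m.2 c).trans (m'.2 c).symm) fun x hx hx' => ?_)
    exact DFunLike.congr_fun (congrArg Subtype.val h)
      (⟨(x, c), hx.trans (m.2 c)⟩ : pb f K.map)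
  · rintro ⟨l, hl⟩
    refine ⟨⟨⟨fun c => (⟨K.map c, fun x hx => l ⟨(x, c), hx⟩, fun x hx => hl _⟩ :
      FibreSection f p), fun g c => ?_⟩, fun c => rfl⟩, ?_⟩
    · refine FibreSection.ext' (map_smul K.map g c) fun x hx hx' => ?_
      have hx₂ : f (g⁻¹ • x) = K.map c := by
        rw [map_smul]
        exact (congrArg (g⁻¹ • ·) (hx.trans (map_smul K.map g c))).trans (inv_smul_smul g _)
      refine Eq.trans (congrArg l ?_) (l.map_smul' g ⟨(g⁻¹ • x, c), hx₂⟩)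
      exact Subtype.ext (Prod.ext (smul_inv_smul g x).symm rfl)
    · rfl
  · intro m
    refine (prodExt_orbit (nm_invariant _ (res_invariant _ hφ)) (K.withMap m.1)).symm.trans ?_
    refine (prodExt_nm (piPull f p) (res_invariant _ hφ) m.1).trans ?_
    refine (prodExt_isMult hφ).iso ((piEval f p).comp (pbFst (piPull f p) m.1)) _
      (pbLift ((pbFst _ _).comp (pbFst _ _)) (pbSnd _ _)
        (fun w => w.1.1.2.trans ((congrArg (piProj f p) w.2).trans (m.2 _))))
      (bijective_of_inverse _ (fun w => ⟨(⟨(w.1.1, m.1 w.1.2), w.2.trans (m.2 _).symm⟩, w.1.2),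
        rfl⟩) ?_ (fun _ => rfl)) ?_
    · rintro ⟨⟨⟨⟨x, s⟩, h₁⟩, c⟩, h₂⟩
      obtain rfl : s = m.1 c := h₂
      rfl
    · rintro ⟨⟨⟨⟨x, s⟩, h₁⟩, c⟩, h₂⟩
      obtain rfl : s = m.1 c := h₂
      rfl

end Ghost

/-- The Tambara functor of isomorphism invariant integer functions of orbits. It contains the
Burnside ring functor, which is mapped to it by taking marks. -/
def ghostTambara (G : Type u) [Group G] : Tambara G where
  obj X := Ghost.ring X
  res f :=
    { toFun := fun φ => ⟨Ghost.res f φ.1, Ghost.res_invariant f φ.2⟩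
      map_one' := rfl
      map_mul' := fun _ _ => rfl
      map_zero' := rfl
      map_add' := fun _ _ => rfl }
  tr f :=
    { toFun := fun φ => ⟨Ghost.tr f φ.1, Ghost.tr_invariant f φ.2⟩
      map_zero' := Subtype.ext (funext fun _ => finsum_zero)
      map_add' := fun _ _ => Subtype.ext (funext fun _ =>
        finsum_add_distrib (Set.toFinite _) (Set.toFinite _)) }
  nm f :=
    { toFun := fun φ => ⟨Ghost.nm f φ.1, Ghost.nm_invariant f φ.2⟩
      map_one' := Subtype.ext (funext fun _ => Ghost.prodExt_one _)
      map_mul' := fun _ _ => Subtype.ext (funext fun _ => Ghost.prodExt_mul _ _ _) }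
  res_id _ _ := rfl
  res_comp _ _ _ := rfl
  tr_id _ φ := Subtype.ext (Ghost.tr_id φ.1)
  tr_comp f g φ := Subtype.ext (Ghost.tr_comp f g φ.1)
  nm_id _ φ := Subtype.ext (Ghost.nm_id φ.2)
  nm_comp f g φ := Subtype.ext (Ghost.nm_comp f g φ.2)
  additive_empty X hX := ⟨fun φ ψ => Subtype.ext (funext fun K =>
    hX.elim (K.map (Classical.choice K.nonempty)))⟩
  additive_sum X Y := by
    constructor
    · intro φ ψ h
      have hl : ∀ K : Orbit X, φ.1 (K.push (inl X Y)) = ψ.1 (K.push (inl X Y)) := fun K =>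
        congrFun (congrArg Subtype.val (congrArg Prod.fst h)) K
      have hr : ∀ K : Orbit Y, φ.1 (K.push (inr X Y)) = ψ.1 (K.push (inr X Y)) := fun K =>
        congrFun (congrArg Subtype.val (congrArg Prod.snd h)) K
      refine Subtype.ext (funext fun K => ?_)
      -- an orbit over a disjoint union lies over one of the two parts
      have x : K.set := Classical.choice K.nonempty
      rcases hx : K.map x with z | z
      · have hK : ∀ y, ∃ w, inl X Y w = K.map y := by
          intro y
          obtain ⟨g, rfl⟩ := MulAction.exists_smul_eq G x y
          exact ⟨g • z, by rw [map_smul, map_smul, hx]; rfl⟩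
        choose w hw using hK
        have hw' : ∀ (g : G) y, w (g • y) = g • w y := fun g y =>
          SemiMackey.inl_injective X Y (by rw [hw, map_smul, map_smul, hw])
        have := hl (K.withMap ⟨w, hw'⟩)
        rwa [show (K.withMap ⟨w, hw'⟩).push (inl X Y) = K from
          congrArg K.withMap (MulActionHom.ext hw)] at this
      · have hK : ∀ y, ∃ w, inr X Y w = K.map y := by
          intro y
          obtain ⟨g, rfl⟩ := MulAction.exists_smul_eq G x y
          exact ⟨g • z, by rw [map_smul, map_smul, hx]; rfl⟩
        choose w hw using hK
        have hw' : ∀ (g : G) y, w (g • y) = g • w y := fun g y =>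
          SemiMackey.inr_injective X Y (by rw [hw, map_smul, map_smul, hw])
        have := hr (K.withMap ⟨w, hw'⟩)
        rwa [show (K.withMap ⟨w, hw'⟩).push (inr X Y) = K from
          congrArg K.withMap (MulActionHom.ext hw)] at this
    · rintro ⟨φ, ψ⟩
      refine ⟨⟨fun K => Ghost.tr (inl X Y) φ.1 K + Ghost.tr (inr X Y) ψ.1 K,
        (Ghost.ring _).add_mem (Ghost.tr_invariant _ φ.2) (Ghost.tr_invariant _ ψ.2)⟩, ?_⟩
      have hll := Ghost.tr_mackey (isPullbackSquare_of_injective _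
        (SemiMackey.inl_injective X Y)) φ.1
      have hrr := Ghost.tr_mackey (isPullbackSquare_of_injective _
        (SemiMackey.inr_injective X Y)) ψ.1
      have hE : ∀ {Z : FinGSet G} (χ : Ghost (empty G)) (K : Orbit Z),
          Ghost.tr (elim (empty G) Z) χ K = 0 := by
        intro Z χ K
        have : IsEmpty (Lift K.map (elim (empty G) Z)) :=
          ⟨fun l => isEmptyElim (l.1 (Classical.choice K.nonempty))⟩
        exact finsum_of_isEmpty _
      have hlr := Ghost.tr_mackey (isPullbackSquare_of_disjoint (inl X Y) (inr X Y)
        (fun _ _ => Sum.inl_ne_inr)) ψ.1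
      have hrl := Ghost.tr_mackey (isPullbackSquare_of_disjoint (inr X Y) (inl X Y)
        (fun _ _ => Sum.inr_ne_inl)) φ.1
      refine Prod.ext (Subtype.ext (funext fun K => ?_)) (Subtype.ext (funext fun K => ?_))
      · refine (congrArg₂ (· + ·) (congrFun hll K).symm (congrFun hlr K).symm).trans ?_
        rw [Ghost.tr_id, hE, add_zero]
        rfl
      · refine (congrArg₂ (· + ·) (congrFun hrl K).symm (congrFun hrr K).symm).trans ?_
        rw [Ghost.tr_id, hE, zero_add]
        rfl
  tr_mackey _ _ _ _ h φ := Subtype.ext (Ghost.tr_mackey h φ.1)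
  nm_mackey _ _ _ _ h φ := Subtype.ext (Ghost.nm_mackey h φ.2)
  distrib f p φ := Subtype.ext (Ghost.distrib f p φ.2)

/-! ### The sub-Tambara functor generated by the units -/

namespace Tambara

variable (T : Tambara G)

/-- Multiplicative transfers of differences are integer linear combinations, with universal
coefficients, of transfers of sums: multiplicative transfers are polynomial maps. -/
theorem exists_nm_sub (d : ℕ) : ∃ c : ℕ → ℤ, ∀ (T : Tambara G) {X Y : FinGSet G} (f : X →[G] Y),
    (∀ y, Nat.card {x : X // f x = y} ≤ d) → ∀ a b : T.obj X,
      T.nm f (a - b) = ∑ k ∈ Finset.range (d + 1), c k • T.nm f (a + k • b) := by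
  refine ⟨fun k => (-1) ^ d * ((-1) ^ (d + 1 - (k + 1)) * ((d + 1).choose (k + 1) : ℤ)),
    fun T X Y f hf a b => ?_⟩
  -- the difference of order `d + 1` at `a - b` involves the values at `a - b + k b`, `k ≤ d + 1`,
  -- and the value at `a - b` itself has coefficient `± 1`
  have h := T.fwdDiff_nm d f hf b (a - b)
  rw [fwdDiff_iter_eq_sum_shift, Finset.sum_range_succ'] at h
  have hz : a - b + 0 • b = a - b := by rw [zero_smul, add_zero]
  have hk : ∀ k : ℕ, a - b + (k + 1) • b = a + k • b := fun k => by
    rw [add_smul, one_smul]; abel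
  simp only [hz, hk] at h
  have h2 := congrArg (fun x => ((-1 : ℤ) ^ d) • x) h
  simp only [smul_add, smul_zero, Finset.smul_sum, smul_smul] at h2
  have h3 : (-1 : ℤ) ^ d * ((-1) ^ (d + 1 - 0) * ((d + 1).choose 0 : ℤ)) = -1 := by
    rw [Nat.choose_zero_right, Nat.sub_zero, pow_succ]
    rcases neg_one_pow_eq_or ℤ d with h | h <;> rw [h] <;> norm_num
  rw [h3, neg_one_smul, ← sub_eq_add_neg, sub_eq_zero] at h2
  exact h2.symm

theorem card_fibre_le {X Y : FinGSet G} (f : X →[G] Y) (y : Y) :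
    Nat.card {x : X // f x = y} ≤ Nat.card X :=
  Nat.card_le_card_of_injective _ Subtype.val_injective

theorem pair_eq_tr_add_tr {A B : FinGSet G} (s : T.obj A) (t : T.obj B) :
    T.pair s t = T.tr (inl A B) s + T.tr (inr A B) t := rfl

theorem tr_desc_one {A B X : FinGSet G} (p : A →[G] X) (q : B →[G] X) :
    T.tr (desc p q) 1 = T.tr p 1 + T.tr q 1 := by
  rw [tr_desc, map_one (T.res _), map_one (T.res _)]

theorem tr_one_mul_tr_one {A B X : FinGSet G} (p : A →[G] X) (q : B →[G] X) :
    T.tr p 1 * T.tr q 1 = T.tr (p.comp (pbFst p q)) 1 := by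
  rw [tr_mul_tr, map_one, map_one, mul_one]

theorem res_tr_one {X Y B : FinGSet G} (f : X →[G] Y) (q : B →[G] Y) :
    T.res f (T.tr q 1) = T.tr (pbFst f q) 1 := by
  rw [res_tr, map_one]

theorem nm_tr_one {X Y A : FinGSet G} (f : X →[G] Y) (p : A →[G] X) :
    T.nm f (T.tr p 1) = T.tr (piProj f p) 1 := by
  rw [distrib, map_one, map_one]

theorem tr_comp_one_of_bijective {A B X : FinGSet G} (q : B →[G] X) (a : A →[G] B)
    (ha : Function.Bijective a) : T.tr (q.comp a) 1 = T.tr q 1 := by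
  rw [T.tr_comp, ← map_one (T.res a), T.tr_res_of_bijective a ha]

/-- The elements `p_+(1)`. -/
def IsMark {X : FinGSet G} (a : T.obj X) : Prop :=
  ∃ (A : FinGSet G) (p : A →[G] X), a = T.tr p 1

variable {T} in
theorem IsMark.add {X : FinGSet G} {a b : T.obj X} (ha : T.IsMark a) (hb : T.IsMark b) :
    T.IsMark (a + b) := by
  obtain ⟨A, p, rfl⟩ := ha
  obtain ⟨B, q, rfl⟩ := hb
  exact ⟨_, _, (T.tr_desc_one p q).symm⟩

variable {T} in
theorem IsMark.mul {X : FinGSet G} {a b : T.obj X} (ha : T.IsMark a) (hb : T.IsMark b) :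
    T.IsMark (a * b) := by
  obtain ⟨A, p, rfl⟩ := ha
  obtain ⟨B, q, rfl⟩ := hb
  exact ⟨_, _, T.tr_one_mul_tr_one p q⟩

theorem isMark_one (X : FinGSet G) : T.IsMark (1 : T.obj X) := ⟨X, _, (T.tr_id X 1).symm⟩

theorem isMark_zero (X : FinGSet G) : T.IsMark (0 : T.obj X) :=
  ⟨empty G, elim _ _, by rw [T.eq_of_isEmpty 1 0, map_zero]⟩

variable {T} in
theorem IsMark.nsmul {X : FinGSet G} {a : T.obj X} (ha : T.IsMark a) (n : ℕ) :
    T.IsMark (n • a) := by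
  induction n with
  | zero => rw [zero_smul]; exact T.isMark_zero X
  | succ n ih => rw [succ_nsmul]; exact ih.add ha

variable {T} in
theorem IsMark.nm {X Y : FinGSet G} (f : X →[G] Y) {a : T.obj X} (ha : T.IsMark a) :
    T.IsMark (T.nm f a) := by
  obtain ⟨A, p, rfl⟩ := ha
  exact ⟨_, _, T.nm_tr_one f p⟩

/-- The ring of the differences of elements `p_+(1)`. -/
def markRing (X : FinGSet G) : Subring (T.obj X) where
  carrier := {x | ∃ a b, T.IsMark a ∧ T.IsMark b ∧ x = a - b}
  zero_mem' := ⟨0, 0, T.isMark_zero X, T.isMark_zero X, (sub_zero 0).symm⟩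
  one_mem' := ⟨1, 0, T.isMark_one X, T.isMark_zero X, (sub_zero 1).symm⟩
  add_mem' := by
    rintro _ _ ⟨a, b, ha, hb, rfl⟩ ⟨c, d, hc, hd, rfl⟩
    exact ⟨_, _, ha.add hc, hb.add hd, by ring⟩
  mul_mem' := by
    rintro _ _ ⟨a, b, ha, hb, rfl⟩ ⟨c, d, hc, hd, rfl⟩
    exact ⟨_, _, (ha.mul hc).add (hb.mul hd), (ha.mul hd).add (hb.mul hc), by ring⟩
  neg_mem' := by
    rintro _ ⟨a, b, ha, hb, rfl⟩
    exact ⟨b, a, hb, ha, neg_sub a b⟩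

variable {T} in
theorem IsMark.mem {X : FinGSet G} {a : T.obj X} (ha : T.IsMark a) : a ∈ T.markRing X :=
  ⟨a, 0, ha, T.isMark_zero X, (sub_zero a).symm⟩

theorem res_mem_markRing {X Y : FinGSet G} (f : X →[G] Y) {x : T.obj Y}
    (hx : x ∈ T.markRing Y) : T.res f x ∈ T.markRing X := by
  obtain ⟨_, _, ⟨A, p, rfl⟩, ⟨B, q, rfl⟩, rfl⟩ := hx
  rw [map_sub, res_tr_one, res_tr_one]
  exact ⟨_, _, ⟨_, _, rfl⟩, ⟨_, _, rfl⟩, rfl⟩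

theorem tr_mem_markRing {X Y : FinGSet G} (f : X →[G] Y) {x : T.obj X}
    (hx : x ∈ T.markRing X) : T.tr f x ∈ T.markRing Y := by
  obtain ⟨_, _, ⟨A, p, rfl⟩, ⟨B, q, rfl⟩, rfl⟩ := hx
  rw [map_sub, tr_tr, tr_tr]
  exact ⟨_, _, ⟨_, _, rfl⟩, ⟨_, _, rfl⟩, rfl⟩

theorem nm_mem_markRing {X Y : FinGSet G} (f : X →[G] Y) {x : T.obj X}
    (hx : x ∈ T.markRing X) : T.nm f x ∈ T.markRing Y := by
  obtain ⟨a, b, ha, hb, rfl⟩ := hx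
  obtain ⟨c, hc⟩ := exists_nm_sub (G := G) (Nat.card X)
  rw [hc T f (card_fibre_le f)]
  exact sum_mem fun k _ => zsmul_mem ((ha.add (hb.nsmul k)).nm f).mem _

/-- The sub-Tambara functor of differences of elements `p_+(1)`. -/
def marks : Tambara G where
  obj X := T.markRing X
  res f :=
    { toFun := fun x => ⟨T.res f x.1, T.res_mem_markRing f x.2⟩
      map_one' := Subtype.ext (map_one (T.res f))
      map_mul' := fun _ _ => Subtype.ext (map_mul (T.res f) _ _)
      map_zero' := Subtype.ext (map_zero (T.res f))
      map_add' := fun _ _ => Subtype.ext (map_add (T.res f) _ _) }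
  tr f :=
    { toFun := fun x => ⟨T.tr f x.1, T.tr_mem_markRing f x.2⟩
      map_zero' := Subtype.ext (map_zero (T.tr f))
      map_add' := fun _ _ => Subtype.ext (map_add (T.tr f) _ _) }
  nm f :=
    { toFun := fun x => ⟨T.nm f x.1, T.nm_mem_markRing f x.2⟩
      map_one' := Subtype.ext (map_one (T.nm f))
      map_mul' := fun _ _ => Subtype.ext (map_mul (T.nm f) _ _) }
  res_id X x := Subtype.ext (T.res_id X x.1)
  res_comp f g x := Subtype.ext (T.res_comp f g x.1)
  tr_id X x := Subtype.ext (T.tr_id X x.1)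
  tr_comp f g x := Subtype.ext (T.tr_comp f g x.1)
  nm_id X x := Subtype.ext (T.nm_id X x.1)
  nm_comp f g x := Subtype.ext (T.nm_comp f g x.1)
  additive_empty X hX := ⟨fun x y => Subtype.ext ((T.additive_empty X hX).elim x.1 y.1)⟩
  additive_sum X Y := by
    constructor
    · intro x y h
      exact Subtype.ext (T.sum_ext (congrArg Subtype.val (congrArg Prod.fst h))
        (congrArg Subtype.val (congrArg Prod.snd h)))
    · rintro ⟨x, y⟩
      have hp : T.pair x.1 y.1 ∈ T.markRing (X.sum Y) := by
        rw [pair_eq_tr_add_tr]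
        exact add_mem (T.tr_mem_markRing _ x.2) (T.tr_mem_markRing _ y.2)
      exact ⟨⟨_, hp⟩, Prod.ext (Subtype.ext (T.res_inl_pair _ _))
        (Subtype.ext (T.res_inr_pair _ _))⟩
  tr_mackey f' x y f h a := Subtype.ext (T.tr_mackey f' x y f h a.1)
  nm_mackey f' x y f h a := Subtype.ext (T.nm_mackey f' x y f h a.1)
  distrib f p a := Subtype.ext (T.distrib f p a.1)

theorem exists_eq_sub_of_marks {X : FinGSet G} (x : T.marks.obj X) :
    ∃ (A B : FinGSet G) (p : A →[G] X) (q : B →[G] X),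
      x = T.marks.tr p 1 - T.marks.tr q 1 := by
  obtain ⟨x, _, _, ⟨A, p, rfl⟩, ⟨B, q, rfl⟩, rfl⟩ := x
  exact ⟨A, B, p, q, rfl⟩

end Tambara

/-! ### The Burnside ring functor -/

theorem bcls_iso {A B X : FinGSet G} (q : B →[G] X) (a : A →[G] B) (ha : Function.Bijective a) :
    bcls (q.comp a) = bcls q :=
  QuotientAddGroup.eq_iff_sub_mem.2
    (AddSubgroup.subset_closure (BurnsideRel.iso _ _ a ha rfl))

theorem bcls_desc {A B X : FinGSet G} (p : A →[G] X) (q : B →[G] X) :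
    bcls (desc p q) = bcls p + bcls q :=
  QuotientAddGroup.eq_iff_sub_mem.2
    (AddSubgroup.subset_closure (BurnsideRel.sum (desc p q)))

/-- Every element of the Grothendieck group is a difference of classes of finite `G`-sets. -/
theorem exists_bcls_sub {X : FinGSet G} (z : BurnsideGroup X) :
    ∃ (A B : FinGSet G) (p : A →[G] X) (q : B →[G] X), z = bcls p - bcls q := by
  have h0 : (bcls (elim (empty G) X) : BurnsideGroup X) = 0 := by
    have h := bcls_desc (elim (empty G) X) (elim (empty G) X)
    have hb : Function.Bijective (inl (empty G) (empty G)) :=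
      ⟨SemiMackey.inl_injective _ _, by rintro (x | x) <;> exact isEmptyElim x⟩
    rw [← bcls_iso (desc (elim (empty G) X) (elim (empty G) X)) _ hb] at h
    have hc : (desc (elim (empty G) X) (elim (empty G) X)).comp (inl (empty G) (empty G)) =
      elim (empty G) X := rfl
    rw [hc] at h
    exact left_eq_add.1 h
  induction z using QuotientAddGroup.induction_on with
  | H z =>
    induction z using FreeAbelianGroup.induction_on with
    | zero => exact ⟨_, _, elim (empty G) X, elim (empty G) X, (sub_self _).symm⟩
    | of w => exact ⟨_, _, w.2, elim (empty G) X, by rw [h0, sub_zero]; rfl⟩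
    | neg w _ => exact ⟨_, _, elim (empty G) X, w.2, by rw [h0, zero_sub]; rfl⟩
    | add x y hx hy =>
      obtain ⟨A, B, p, q, h⟩ := hx
      obtain ⟨A', B', p', q', h'⟩ := hy
      refine ⟨_, _, desc p p', desc q q', ?_⟩
      rw [bcls_desc, bcls_desc, QuotientAddGroup.mk_add, h, h']
      abel

/-- The additive map `[p] ↦ p_+(1)` of the Grothendieck group of finite `G`-sets over `X`. -/
def burnsideLift (T : Tambara G) (X : FinGSet G) : BurnsideGroup X →+ T.obj X :=
  QuotientAddGroup.lift _ (FreeAbelianGroup.lift fun w => T.tr w.2 1) (by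
    rw [AddSubgroup.closure_le]
    rintro _ (⟨p, q, a, ha, rfl⟩ | ⟨p⟩)
    · rw [SetLike.mem_coe, AddMonoidHom.mem_ker, map_sub, FreeAbelianGroup.lift_apply_of,
        FreeAbelianGroup.lift_apply_of, T.tr_comp_one_of_bijective q a ha, sub_self]
    · rw [SetLike.mem_coe, AddMonoidHom.mem_ker, map_sub, map_add, FreeAbelianGroup.lift_apply_of,
        FreeAbelianGroup.lift_apply_of, FreeAbelianGroup.lift_apply_of, ← T.tr_desc_one]
      exact sub_eq_zero.2 (congrArg (fun p => T.tr p 1) (sum_hom_ext rfl rfl)))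

theorem burnsideLift_bcls (T : Tambara G) {A X : FinGSet G} (p : A →[G] X) :
    burnsideLift T X (bcls p) = T.tr p 1 :=
  FreeAbelianGroup.lift_apply_of _ _

/-- The value of `p_+(1)` at an orbit `K` over `X` is the number of equivariant maps from `K` to `A`
over `X`, the mark of `A` at `K`. -/
theorem ghost_tr_one_apply {A X : FinGSet G} (p : A →[G] X) (K : Orbit X) :
    ((ghostTambara G).tr p 1).1 K = Nat.card (Lift K.map p) := by
  let _ := Fintype.ofFinite (Lift K.map p)
  refine (finsum_eq_sum_of_fintype _).trans ?_
  rw [Nat.card_eq_fintype_card, Fintype.card_eq_sum_ones, Nat.cast_sum]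
  rfl

theorem exists_complement {K A : FinGSet G} (i : K →[G] A) (hi : Function.Injective i) :
    ∃ (C : FinGSet G) (u : C →[G] A), Function.Bijective (desc i u) := by
  have hP : ∀ (g : G) x, x ∉ Set.range i → g • x ∉ Set.range i := by
    rintro g x hx ⟨y, hy⟩
    exact hx ⟨g⁻¹ • y, by rw [map_smul, hy, inv_smul_smul]⟩
  refine ⟨A.sub _ hP, subVal A _ hP, ?_, fun x => ?_⟩
  · rintro (y | ⟨y, hy⟩) (z | ⟨z, hz⟩) h
    · exact congrArg Sum.inl (hi h)
    · exact (hz ⟨y, h⟩).elim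
    · exact (hy ⟨z, h.symm⟩).elim
    · exact congrArg Sum.inr (Subtype.ext h)
  · by_cases hx : x ∈ Set.range i
    · obtain ⟨y, rfl⟩ := hx
      exact ⟨Sum.inl y, rfl⟩
    · exact ⟨Sum.inr ⟨x, hx⟩, rfl⟩

/-- The orbit of a point, with its inclusion. -/
theorem orbitOver_injective {A X : FinGSet G} (p : A →[G] X) (c) :
    ∃ i : Lift (orbitOver p c).map p, Function.Injective i.1 :=
  ⟨⟨subVal _ _ _, fun _ => rfl⟩, Subtype.val_injective⟩

theorem exists_lift_of_tr_one_eq {A B X : FinGSet G} {p : A →[G] X} {q : B →[G] X}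
    (h : (ghostTambara G).tr p 1 = (ghostTambara G).tr q 1) (K : Orbit X)
    (i : Lift K.map p) : Nonempty (Lift K.map q) := by
  have h1 := congrFun (congrArg Subtype.val h) K
  rw [ghost_tr_one_apply, ghost_tr_one_apply, Nat.cast_inj] at h1
  have : Nonempty (Lift K.map p) := ⟨i⟩
  exact (Nat.card_pos_iff.1 (h1 ▸ Nat.card_pos)).1

/-- A lift of an orbit is injective if its image is not smaller. -/
theorem injective_of_card_le {B X : FinGSet G} {q : B →[G] X} (K : Orbit X) (j : Lift K.map q)
    (h : ∀ y : B, Nat.card K.set ≤ Nat.card (orbitOver q (orb y)).set) :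
    Function.Injective j.1 := by
  have x : K.set := Classical.choice K.nonempty
  let F : K.set → (orbitOver q (orb (j.1 x))).set := fun y => ⟨j.1 y, by
    obtain ⟨g, rfl⟩ := MulAction.exists_smul_eq G x y
    rw [map_smul, orb_smul]⟩
  have hF : Function.Surjective F := by
    rintro ⟨y, hy⟩
    obtain ⟨g, hg⟩ := orb_eq_iff.1 hy
    exact ⟨g • x, Subtype.ext ((map_smul j.1 g x).trans hg)⟩
  have hc := hF.bijective_of_nat_card_le (h _)
  exact fun y z hyz => hc.1 (Subtype.ext hyz)

/-- Non-isomorphic `G`-sets over `X` are distinguished by their marks: a smallest orbit of one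
of the two sets embeds into both, and can be cancelled. -/
theorem exists_iso_of_tr_one_eq {X : FinGSet G} {A B : FinGSet G} (p : A →[G] X) (q : B →[G] X)
    (h : (ghostTambara G).tr p 1 = (ghostTambara G).tr q 1) :
    ∃ a : A →[G] B, Function.Bijective a ∧ q.comp a = p := by
  induction hn : Nat.card A using Nat.strong_induction_on generalizing A B with
  | _ n ih =>
    rcases isEmpty_or_nonempty (A ⊕ B) with hAB | hAB
    · rw [isEmpty_sum] at hAB
      have := hAB.1
      have := hAB.2
      exact ⟨elim A B, ⟨fun x => isEmptyElim x, fun y => isEmptyElim y⟩,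
        MulActionHom.ext fun x => isEmptyElim x⟩
    · obtain ⟨K, i, j, hi, hj⟩ : ∃ (K : Orbit X) (i : Lift K.map p) (j : Lift K.map q),
          Function.Injective i.1 ∧ Function.Injective j.1 := by
        obtain ⟨z, hz⟩ := Finite.exists_min fun z : A ⊕ B =>
          Sum.elim (fun x => Nat.card (orbitOver p (orb x)).set)
            (fun y => Nat.card (orbitOver q (orb y)).set) z
        rcases z with x | y
        · obtain ⟨i, hi⟩ := orbitOver_injective p (orb x)
          obtain ⟨j⟩ := exists_lift_of_tr_one_eq h _ i
          exact ⟨_, i, j, hi, injective_of_card_le _ j fun y => hz (Sum.inr y)⟩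
        · obtain ⟨j, hj⟩ := orbitOver_injective q (orb y)
          obtain ⟨i⟩ := exists_lift_of_tr_one_eq h.symm _ j
          exact ⟨_, i, j, injective_of_card_le _ i fun x => hz (Sum.inl x), hj⟩
      obtain ⟨C, u, hu⟩ := exists_complement i.1 hi
      obtain ⟨D, v, hv⟩ := exists_complement j.1 hj
      have hp := (ghostTambara G).tr_comp_one_of_bijective p _ hu
      have hq := (ghostTambara G).tr_comp_one_of_bijective q _ hv
      rw [desc_comp, Tambara.tr_desc_one, show p.comp i.1 = K.map from
        MulActionHom.ext i.2] at hp
      rw [desc_comp, Tambara.tr_desc_one, show q.comp j.1 = K.map from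
        MulActionHom.ext j.2] at hq
      have hC : Nat.card C < n := by
        have h1 := Nat.card_congr (Equiv.ofBijective _ hu)
        rw [hn] at h1
        have h2 : Nat.card (K.set.sum C) = Nat.card K.set + Nat.card C := Nat.card_sum
        have h3 : 0 < Nat.card K.set := Nat.card_pos
        omega
      obtain ⟨a, ha, hqa⟩ := ih _ hC (p.comp u) (q.comp v)
        (add_left_cancel (hp.trans (h.trans hq.symm))) rfl
      refine ⟨(desc j.1 (v.comp a)).comp (inv _ hu), ?_, ?_⟩
      · have hd : Function.Bijective (desc j.1 (v.comp a)) := by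
          have : ⇑(desc j.1 (v.comp a)) = desc j.1 v ∘ Sum.map id a := by
            funext z; rcases z with z | z <;> rfl
          rw [this]
          exact hv.comp (Function.bijective_id.sumMap ha)
        exact hd.comp (bijective_of_inverse _ _ (apply_inv _ hu) (inv_apply _ hu))
      · refine MulActionHom.ext fun x => ?_
        obtain ⟨z, rfl⟩ := hu.2 x
        rw [MulActionHom.comp_apply, MulActionHom.comp_apply, inv_apply]
        rcases z with z | z
        · exact (j.2 z).trans (i.2 z).symm
        · exact DFunLike.congr_fun hqa z

/-- The Burnside ring functor, realised as a Tambara functor of marks. -/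
def burnside (G : Type u) [Group G] : Tambara G := (ghostTambara G).marks

theorem burnsideLift_bijective (X : FinGSet G) :
    Function.Bijective (burnsideLift (burnside G) X) := by
  constructor
  · rw [injective_iff_map_eq_zero]
    intro z hz
    obtain ⟨A, B, p, q, rfl⟩ := exists_bcls_sub z
    rw [map_sub, burnsideLift_bcls, burnsideLift_bcls, sub_eq_zero] at hz
    obtain ⟨a, ha, rfl⟩ := exists_iso_of_tr_one_eq p q (congrArg Subtype.val hz)
    rw [bcls_iso q a ha, sub_self]
  · intro x
    obtain ⟨A, B, p, q, rfl⟩ := (ghostTambara G).exists_eq_sub_of_marks x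
    exact ⟨bcls p - bcls q, by rw [map_sub, burnsideLift_bcls, burnsideLift_bcls]; rfl⟩

/-- The values of the Burnside ring functor are the Grothendieck groups. -/
def burnsideEquiv (X : FinGSet G) : BurnsideGroup X ≃+ (burnside G).obj X :=
  AddEquiv.ofBijective (burnsideLift (burnside G) X) (burnsideLift_bijective X)

theorem burnsideEquiv_bcls {A X : FinGSet G} (p : A →[G] X) :
    burnsideEquiv X (bcls p) = (burnside G).tr p 1 :=
  burnsideLift_bcls (burnside G) p

theorem isBurnside_burnside : IsBurnside (burnside G) burnsideEquiv where
  one X := (burnsideEquiv_bcls _).trans ((burnside G).tr_id X 1)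
  mul p q := by
    rw [burnsideEquiv_bcls, burnsideEquiv_bcls, burnsideEquiv_bcls, Tambara.tr_one_mul_tr_one]
  res f q := by
    rw [burnsideEquiv_bcls, burnsideEquiv_bcls, Tambara.res_tr_one]
  tr f p := by
    rw [burnsideEquiv_bcls, burnsideEquiv_bcls, Tambara.tr_tr]
  nm f p := by
    rw [burnsideEquiv_bcls, burnsideEquiv_bcls, Tambara.nm_tr_one]

/-! ### The Burnside ring functor is initial -/

/-- The components of the morphism from the Burnside ring functor. -/
def fromBurnsideApp (S : Tambara G) (X : FinGSet G) : (burnside G).obj X →+ S.obj X :=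
  (burnsideLift S X).comp (burnsideEquiv X).symm.toAddMonoidHom

theorem fromBurnsideApp_tr_one (S : Tambara G) {A X : FinGSet G} (p : A →[G] X) :
    fromBurnsideApp S X ((burnside G).tr p 1) = S.tr p 1 := by
  rw [← burnsideEquiv_bcls]
  exact (congrArg (burnsideLift S X) ((burnsideEquiv X).symm_apply_apply _)).trans
    (burnsideLift_bcls S p)

theorem exists_burnside_sub {X : FinGSet G} (x : (burnside G).obj X) :
    ∃ (A B : FinGSet G) (p : A →[G] X) (q : B →[G] X),
      x = (burnside G).tr p 1 - (burnside G).tr q 1 :=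
  (ghostTambara G).exists_eq_sub_of_marks x

/-- The morphism from the Burnside ring functor to a Tambara functor. -/
def fromBurnside (S : Tambara G) : burnside G ⟶ S where
  app X :=
    { fromBurnsideApp S X with
      map_one' := by
        have h := fromBurnsideApp_tr_one S (MulActionHom.id G : X →[G] X)
        rwa [Tambara.tr_id, Tambara.tr_id] at h
      map_mul' := fun x y => by
        change fromBurnsideApp S X (x * y) = fromBurnsideApp S X x * fromBurnsideApp S X y
        obtain ⟨A, B, p, q, rfl⟩ := exists_burnside_sub x
        obtain ⟨A', B', p', q', rfl⟩ := exists_burnside_sub y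
        simp only [sub_mul, mul_sub, map_sub, Tambara.tr_one_mul_tr_one, fromBurnsideApp_tr_one] }
  res_app {X Y} f x := by
    change fromBurnsideApp S X _ = S.res f (fromBurnsideApp S Y x)
    obtain ⟨A, B, p, q, rfl⟩ := exists_burnside_sub x
    simp only [map_sub, Tambara.res_tr_one, fromBurnsideApp_tr_one]
  tr_app {X Y} f x := by
    change fromBurnsideApp S Y _ = S.tr f (fromBurnsideApp S X x)
    obtain ⟨A, B, p, q, rfl⟩ := exists_burnside_sub x
    simp only [map_sub, Tambara.tr_tr, fromBurnsideApp_tr_one]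
  nm_app {X Y} f x := by
    change fromBurnsideApp S Y _ = S.nm f (fromBurnsideApp S X x)
    obtain ⟨A, B, p, q, rfl⟩ := exists_burnside_sub x
    obtain ⟨c, hc⟩ := Tambara.exists_nm_sub (G := G) (Nat.card X)
    rw [map_sub (fromBurnsideApp S X), hc _ f (Tambara.card_fibre_le f), hc _ f (Tambara.card_fibre_le f), map_sum]
    refine Finset.sum_congr rfl fun k _ => ?_
    rw [map_zsmul, ← map_nsmul (fromBurnsideApp S X), ← map_add (fromBurnsideApp S X)]
    obtain ⟨C, r, hr⟩ : (burnside G).IsMark ((burnside G).tr p 1 + k • (burnside G).tr q 1) :=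
      Tambara.IsMark.add ⟨_, _, rfl⟩ (Tambara.IsMark.nsmul ⟨_, _, rfl⟩ k)
    rw [hr, Tambara.nm_tr_one, fromBurnsideApp_tr_one, fromBurnsideApp_tr_one,
      Tambara.nm_tr_one]

theorem Tambara.hom_app_tr_one {T S : Tambara G} (σ : T ⟶ S) {A X : FinGSet G} (p : A →[G] X) :
    (Tambara.Hom.app σ X) (T.tr p 1) = S.tr p 1 :=
  (Tambara.Hom.tr_app σ p 1).trans (congrArg (S.tr p) (map_one (Tambara.Hom.app σ A)))

theorem burnside_hom_ext {S : Tambara G} (σ τ : burnside G ⟶ S) : σ = τ := by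
  refine Tambara.Hom.ext (funext fun X => RingHom.ext fun x => ?_)
  obtain ⟨A, B, p, q, rfl⟩ := exists_burnside_sub x
  rw [map_sub, map_sub, Tambara.hom_app_tr_one, Tambara.hom_app_tr_one, Tambara.hom_app_tr_one,
    Tambara.hom_app_tr_one]

/-! ### Tambarization -/

namespace Ext

variable {T : Tambara G} {M : SemiMackey G} {X : FinGSet G} {B : Type*} [AddCommGroup B]

theorem mk_sub {A : FinGSet G} (p : A →[G] X) (s t : T.obj A) (m : M.obj A) :
    mk p (s - t) m = (mk p s m - mk p t m : Ext T M X) :=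
  eq_sub_of_add_eq (by rw [← mk_add, sub_add_cancel])

/-- Additive maps out of the values of `T[M]`. -/
def liftAdd (Φ : ∀ {A : FinGSet G} (_ : A →[G] X) (_ : M.obj A), T.obj A →+ B)
    (h : ∀ {A C : FinGSet G} (q : C →[G] X) (a : A →[G] C) (t : T.obj A) (m : M.obj C),
      Φ (q.comp a) (M.res a m) t = Φ q m (T.tr a t)) : Ext T M X →+ B :=
  AddMonoidHom.mk' (Quot.lift (fun x => Φ x.proj x.snd x.fst) (by
    rintro _ _ ⟨q, a, t, m⟩
    exact h q a t m)) fun x y => by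
      induction x using Ext.ind_mk with | h p t m
      induction y using Ext.ind_mk with | h q s n
      change Φ (desc p q) (M.pair m n) (T.mu.pair t s) = Φ p m t + Φ q n s
      rw [T.mu_pair, T.pair_eq_tr_add_tr, map_add, ← h, ← h, M.res_inl_pair, M.res_inr_pair]
      rfl

theorem liftAdd_mk (Φ : ∀ {A : FinGSet G} (_ : A →[G] X) (_ : M.obj A), T.obj A →+ B) (h)
    {A : FinGSet G} (p : A →[G] X) (t : T.obj A) (m : M.obj A) :
    liftAdd Φ h (mk p t m) = Φ p m t := rfl

end Ext

/-- Additive maps out of the values of `Ω[M]` agree if they agree on the classes `[1, m]`. -/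
theorem ext_burnside_addHom_ext {M : SemiMackey G} {X : FinGSet G} {B : Type*} [AddCommGroup B]
    {φ ψ : (ext (burnside G) M).obj X →+ B}
    (h : ∀ {A : FinGSet G} (p : A →[G] X) (m : M.obj A),
      φ (Ext.mk p 1 m) = ψ (Ext.mk p 1 m)) : φ = ψ := by
  refine AddMonoidHom.ext fun z => ?_
  induction z using Ext.ind_mk with | h p t m
  obtain ⟨C, D, c, d, rfl⟩ := exists_burnside_sub t
  have hs := Ext.mk_sub (T := burnside G) (M := M) p ((burnside G).tr c 1)
    ((burnside G).tr d 1) m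
  have hc := Ext.mk_eq (T := burnside G) (M := M) (p.comp c) p c (fun _ => rfl) 1 m
  have hd := Ext.mk_eq (T := burnside G) (M := M) (p.comp d) p d (fun _ => rfl) 1 m
  rw [← hc, ← hd] at hs
  exact (congrArg φ hs).trans (((map_sub φ _ _).trans
    (congrArg₂ (· - ·) (h _ _) (h _ _))).trans ((map_sub ψ _ _).symm.trans (congrArg ψ hs).symm))

section PairGroup

variable {M : SemiMackey G} {X : FinGSet G}

theorem pcls_iso {A B : FinGSet G} (q : B →[G] X) (a : A →[G] B) (ha : Function.Bijective a)
    (m : M.obj B) : pcls (q.comp a) (M.res a m) = pcls q m :=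
  QuotientAddGroup.eq_iff_sub_mem.2
    (AddSubgroup.subset_closure (PairRel.iso _ _ a ha rfl m))

theorem pcls_sum {A B : FinGSet G} (p : A.sum B →[G] X) (m : M.obj (A.sum B)) :
    pcls p m = pcls (p.comp (inl A B)) (M.res (inl A B) m) +
      pcls (p.comp (inr A B)) (M.res (inr A B) m) :=
  QuotientAddGroup.eq_iff_sub_mem.2
    (AddSubgroup.subset_closure (PairRel.sum p m))

/-- Additive maps out of the Grothendieck group of pairs. -/
def pairLift {B : Type*} [AddCommGroup B]
    (φ : ∀ {A : FinGSet G} (_ : A →[G] X) (_ : M.obj A), B)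
    (iso : ∀ {A C : FinGSet G} (q : C →[G] X) (a : A →[G] C), Function.Bijective a →
      ∀ m : M.obj C, φ (q.comp a) (M.res a m) = φ q m)
    (sum : ∀ {A C : FinGSet G} (p : A.sum C →[G] X) (m : M.obj (A.sum C)),
      φ p m = φ (p.comp (inl A C)) (M.res (inl A C) m) +
        φ (p.comp (inr A C)) (M.res (inr A C) m)) : PairGroup M X →+ B :=
  QuotientAddGroup.lift _ (FreeAbelianGroup.lift fun w => φ w.proj w.coeff) (by
    rw [AddSubgroup.closure_le]
    rintro _ (⟨p, q, a, ha, rfl, m⟩ | ⟨p, m⟩)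
    · rw [SetLike.mem_coe, AddMonoidHom.mem_ker, map_sub, FreeAbelianGroup.lift_apply_of,
        FreeAbelianGroup.lift_apply_of, iso q a ha, sub_self]
    · rw [SetLike.mem_coe, AddMonoidHom.mem_ker, map_sub, map_add, FreeAbelianGroup.lift_apply_of,
        FreeAbelianGroup.lift_apply_of, FreeAbelianGroup.lift_apply_of, ← sum, sub_self])

theorem pairLift_pcls {B : Type*} [AddCommGroup B]
    (φ : ∀ {A : FinGSet G} (_ : A →[G] X) (_ : M.obj A), B) (iso) (sum)
    {A : FinGSet G} (p : A →[G] X) (m : M.obj A) :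
    pairLift φ iso sum (pcls p m) = φ p m := FreeAbelianGroup.lift_apply_of _ _

theorem pairGroup_hom_ext {B : Type*} [AddCommGroup B] {φ ψ : PairGroup M X →+ B}
    (h : ∀ {A : FinGSet G} (p : A →[G] X) (m : M.obj A), φ (pcls p m) = ψ (pcls p m)) :
    φ = ψ :=
  QuotientAddGroup.addMonoidHom_ext _ (FreeAbelianGroup.lift_ext _ _ fun w : PairOver M X => h w.proj w.coeff)

/-- The map `[C → A] ↦ [C → A → X, m|_C]`. -/
def pairOfBurnside {A : FinGSet G} (p : A →[G] X) (m : M.obj A) :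
    (burnside G).obj A →+ PairGroup M X :=
  (QuotientAddGroup.lift _ (FreeAbelianGroup.lift fun w : SetOver A =>
      pcls (p.comp w.2) (M.res w.2 m)) (by
    rw [AddSubgroup.closure_le]
    rintro _ (⟨c, d, a, ha, rfl⟩ | ⟨c⟩)
    · rw [SetLike.mem_coe, AddMonoidHom.mem_ker, map_sub, FreeAbelianGroup.lift_apply_of,
        FreeAbelianGroup.lift_apply_of, sub_eq_zero, M.res_comp]
      exact pcls_iso (p.comp d) a ha (M.res d m)
    · rw [SetLike.mem_coe, AddMonoidHom.mem_ker, map_sub, map_add, FreeAbelianGroup.lift_apply_of,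
        FreeAbelianGroup.lift_apply_of, FreeAbelianGroup.lift_apply_of, sub_eq_zero, M.res_comp,
        M.res_comp]
      exact pcls_sum (p.comp c) (M.res c m))).comp (burnsideEquiv A).symm.toAddMonoidHom

theorem pairOfBurnside_tr_one {A C : FinGSet G} (p : A →[G] X) (m : M.obj A) (c : C →[G] A) :
    pairOfBurnside p m ((burnside G).tr c 1) = pcls (p.comp c) (M.res c m) := by
  rw [← burnsideEquiv_bcls, pairOfBurnside, AddMonoidHom.comp_apply]
  erw [(burnsideEquiv A).symm_apply_apply]
  exact FreeAbelianGroup.lift_apply_of _ _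

variable (M X)

/-- The map `[p, m] ↦ [1, m]_p`. -/
def pairToExt : PairGroup M X →+ (ext (burnside G) M).obj X :=
  pairLift (fun p m => Ext.mk p 1 m)
    (fun q a ha m => (Ext.mk_eq (T := burnside G) (q.comp a) q a (fun _ => rfl) 1 m).trans (by
      rw [← map_one ((burnside G).res a), Tambara.tr_res_of_bijective _ a ha]))
    (fun p m => by
      have h := (ext (burnside G) M).tr_desc (p.comp (inl _ _)) (p.comp (inr _ _))
        ((extCoeff (burnside G) M).app _ 1 * (extUnit (burnside G) M).app _ m)
      have hp : desc (p.comp (inl _ _)) (p.comp (inr _ _)) = p := sum_hom_ext rfl rfl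
      have hl := (extUnit (burnside G) M).res_app (inl _ _) m
      have hr := (extUnit (burnside G) M).res_app (inr _ _) m
      change _ = (ext (burnside G) M).res _ _ at hl
      change _ = (ext (burnside G) M).res _ _ at hr
      rw [hp, RingHom.map_mul, RingHom.map_mul, ← Tambara.Hom.res_app, ← Tambara.Hom.res_app,
        ← hl, ← hr, RingHom.map_one, RingHom.map_one] at h
      rw [Ext.mk_eq_tr, Ext.mk_eq_tr, Ext.mk_eq_tr]
      exact h)

theorem pairToExt_pcls {A : FinGSet G} (p : A →[G] X) (m : M.obj A) :
    pairToExt M X (pcls p m) = Ext.mk p 1 m := pairLift_pcls _ _ _ _ _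

/-- The map `[ω, m]_p ↦ [p, m] · ω`. -/
def pairOfExt : (ext (burnside G) M).obj X →+ PairGroup M X :=
  Ext.liftAdd (fun p m => pairOfBurnside p m) fun q a t m => by
    obtain ⟨C, D, c, d, rfl⟩ := exists_burnside_sub t
    rw [map_sub, map_sub, map_sub, Tambara.tr_tr, Tambara.tr_tr, pairOfBurnside_tr_one,
      pairOfBurnside_tr_one, pairOfBurnside_tr_one, pairOfBurnside_tr_one, M.res_res, M.res_res]
    rfl

theorem pairOfExt_mk {A : FinGSet G} (p : A →[G] X) (m : M.obj A) :
    pairOfExt M X (Ext.mk p 1 m) = pcls p m := by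
  refine (Ext.liftAdd_mk _ _ p 1 m).trans ?_
  have h := pairOfBurnside_tr_one p m (MulActionHom.id G)
  rw [Tambara.tr_id, M.res_id] at h
  exact h

/-- The values of `Ω[M]` are the Grothendieck groups of pairs. -/
def pairEquiv : PairGroup M X ≃+ (ext (burnside G) M).obj X :=
  (pairToExt M X).toAddEquiv (pairOfExt M X)
    (pairGroup_hom_ext fun p m => by
      rw [AddMonoidHom.comp_apply, pairToExt_pcls, pairOfExt_mk]; rfl)
    (ext_burnside_addHom_ext fun p m => by
      refine (congrArg (pairToExt M X) (pairOfExt_mk M X p m)).trans ?_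
      exact pairToExt_pcls M X p m)

theorem pairEquiv_pcls {A : FinGSet G} (p : A →[G] X) (m : M.obj A) :
    pairEquiv M X (pcls p m) = Ext.mk p 1 m := pairToExt_pcls M X p m

end PairGroup

/-- The Tambarization functor `M ↦ Ω[M]`. -/
abbrev tambarization (G : Type u) [Group G] : SemiMackey G ⥤ Tambara G :=
  CategoryTheory.Prod.sectR (burnside G) (SemiMackey G) ⋙ extFunctor G

/-- Tambarization is left adjoint to the multiplicative part. -/
def tambarizationAdjunction (G : Type u) [Group G] : tambarization G ⊣ muFunctor G :=
  Adjunction.mkOfHomEquiv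
    { homEquiv := fun M S =>
        { toFun := fun g => extUnit (burnside G) M ≫ (muFunctor G).map g
          invFun := fun θ => extLift (fromBurnside S) θ
          left_inv := fun g => ext_hom_ext (burnside_hom_ext _ _) fun X m =>
            extLift_unit (fromBurnside S) (extUnit (burnside G) M ≫ (muFunctor G).map g) m
          right_inv := fun θ => SemiMackey.Hom.ext (funext fun X => MonoidHom.ext fun m =>
            extLift_unit (fromBurnside S) θ m) }
      homEquiv_naturality_left_symm := fun {M M' S} φ θ => by
        refine ext_hom_ext (burnside_hom_ext _ _) fun X m => ?_
        refine (extLift_unit (fromBurnside S) (φ ≫ θ) m).trans (Eq.symm ?_)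
        refine (congrArg ((extLift (fromBurnside S) θ).app X)
          (extLift_unit (𝟙 _ ≫ extCoeff _ M') (φ ≫ extUnit _ M') m)).trans ?_
        exact extLift_unit (fromBurnside S) θ (φ.app X m)
      homEquiv_naturality_right := fun _ _ => rfl }

theorem isTambarization_tambarization : IsTambarization (tambarization G) pairEquiv where
  adj := ⟨tambarizationAdjunction G⟩
  map {M N} φ {X A} p m := by
    have h : (extMap (𝟙 (burnside G)) φ).app X (Ext.mk p 1 m) = Ext.mk p 1 (φ.app A m) :=
      (extMap_mk (𝟙 _) φ p 1 m).trans (by rw [RingHom.map_one])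
    exact (congrArg ((extMap (𝟙 (burnside G)) φ).app X) (pairEquiv_pcls M X p m)).trans
      (h.trans (pairEquiv_pcls N X p _).symm)
  one M X := pairEquiv_pcls M X _ _
  mul M {X A B} p m q n := by
    have h : (Ext.mk p 1 m * Ext.mk q 1 n : Ext (burnside G) M X) =
        Ext.mk (p.comp (pbFst p q)) 1 (M.res (pbFst p q) m * M.res (pbSnd p q) n) := by
      change Ext.mk (p.comp (pbFst p q))
        ((burnside G).res (pbFst p q) 1 * (burnside G).res (pbSnd p q) 1) _ = _
      rw [map_one, map_one, mul_one]
      rfl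
    exact (congrArg₂ (fun x y : Ext (burnside G) M X => x * y) (pairEquiv_pcls M X p m)
      (pairEquiv_pcls M X q n)).trans (h.trans (pairEquiv_pcls M X _ _).symm)
  res M {X Y B} f q m := by
    have h : (ext (burnside G) M).res f (Ext.mk q 1 m) =
        Ext.mk (pbFst f q) 1 (M.res (pbSnd f q) m) := by
      change Ext.mk (pbFst f q) ((burnside G).res (pbSnd f q) 1) _ = _
      rw [map_one]
      rfl
    exact (congrArg ((ext (burnside G) M).res f) (pairEquiv_pcls M Y q m)).trans
      (h.trans (pairEquiv_pcls M X _ _).symm)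
  tr M {X Y A} f p m :=
    (congrArg ((ext (burnside G) M).tr f) (pairEquiv_pcls M X p m)).trans
      (pairEquiv_pcls M Y _ _).symm
  nm M {X Y A} f p m := by
    have h : (ext (burnside G) M).nm f (Ext.mk p 1 m) =
        Ext.mk (piProj f p) 1 (M.tr (piPull f p) (M.res (piEval f p) m)) := by
      change Ext.mk (piProj f p)
        ((burnside G).nm (piPull f p) ((burnside G).res (piEval f p) 1)) _ = _
      rw [map_one, map_one]
      rfl
    exact (congrArg ((ext (burnside G) M).nm f) (pairEquiv_pcls M X p m)).trans
      (h.trans (pairEquiv_pcls M Y _ _).symm)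

/-! ### The tensor product -/

section Tensor

variable {T S : Tambara G} {X : FinGSet G}

theorem tcls_add_left {A : FinGSet G} (p : A →[G] X) (t t' : T.obj A) (s : S.obj A) :
    tcls p (t + t') s = tcls p t s + tcls p t' s := by
  rw [tcls, tsum, TensorProduct.add_tmul, map_add]
  rfl

theorem tcls_add_right {A : FinGSet G} (p : A →[G] X) (t : T.obj A) (s s' : S.obj A) :
    tcls p t (s + s') = tcls p t s + tcls p t s' := by
  rw [tcls, tsum, TensorProduct.tmul_add, map_add]
  rfl

theorem tcls_left {A B : FinGSet G} (q : B →[G] X) (a : A →[G] B) (t : T.obj B) (s : S.obj A) :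
    tcls (q.comp a) (T.res a t) s = tcls q t (S.tr a s) :=
  QuotientAddGroup.eq_iff_sub_mem.2
    (AddSubgroup.subset_closure (TensorRel.left _ q a rfl t s))

theorem tcls_right {A B : FinGSet G} (q : B →[G] X) (a : A →[G] B) (t : T.obj A) (s : S.obj B) :
    tcls q (T.tr a t) s = tcls (q.comp a) t (S.res a s) :=
  QuotientAddGroup.eq_iff_sub_mem.2
    (AddSubgroup.subset_closure (TensorRel.right _ q a rfl t s))

open Classical in
/-- Additive maps out of the tensor product. -/
def tensorLift {C : Type*} [AddCommGroup C]
    (φ : ∀ {A : FinGSet G} (_ : A →[G] X), T.obj A →+ S.obj A →+ C)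
    (left : ∀ {A B : FinGSet G} (q : B →[G] X) (a : A →[G] B) (t : T.obj B) (s : S.obj A),
      φ (q.comp a) (T.res a t) s = φ q t (S.tr a s))
    (right : ∀ {A B : FinGSet G} (q : B →[G] X) (a : A →[G] B) (t : T.obj A) (s : S.obj B),
      φ q (T.tr a t) s = φ (q.comp a) t (S.res a s)) : TensorGroup T S X →+ C :=
  QuotientAddGroup.lift _ (DirectSum.toAddMonoid fun a : SetOver X =>
      TensorProduct.liftAddHom (φ a.2) fun r t s => by
        rw [map_zsmul, map_zsmul, AddMonoidHom.coe_smul, Pi.smul_apply]) (by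
    rw [AddSubgroup.closure_le]
    rintro _ (⟨p, q, a, rfl, t, s⟩ | ⟨p, q, a, rfl, t, s⟩)
    · rw [SetLike.mem_coe, AddMonoidHom.mem_ker, map_sub, tsum, tsum,
        DirectSum.toAddMonoid_of, DirectSum.toAddMonoid_of]
      exact sub_eq_zero.2 (left q a t s)
    · rw [SetLike.mem_coe, AddMonoidHom.mem_ker, map_sub, tsum, tsum,
        DirectSum.toAddMonoid_of, DirectSum.toAddMonoid_of]
      exact sub_eq_zero.2 (right q a t s))

open Classical in
theorem tensorLift_tcls {C : Type*} [AddCommGroup C]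
    (φ : ∀ {A : FinGSet G} (_ : A →[G] X), T.obj A →+ S.obj A →+ C) (left) (right)
    {A : FinGSet G} (p : A →[G] X) (t : T.obj A) (s : S.obj A) :
    tensorLift φ left right (tcls p t s) = φ p t s := by
  refine (DirectSum.toAddMonoid_of (fun a : SetOver X =>
    TensorProduct.liftAddHom (φ a.2) fun r t s => ?_) ⟨A, p⟩ (t ⊗ₜ[ℤ] s)).trans rfl
  rw [map_zsmul, map_zsmul, AddMonoidHom.coe_smul, Pi.smul_apply]

theorem tensorGroup_hom_ext {C : Type*} [AddCommGroup C] {φ ψ : TensorGroup T S X →+ C}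
    (h : ∀ {A : FinGSet G} (p : A →[G] X) (t : T.obj A) (s : S.obj A),
      φ (tcls p t s) = ψ (tcls p t s)) : φ = ψ := by
  classical
  refine QuotientAddGroup.addMonoidHom_ext _ (DirectSum.addHom_ext fun a z => ?_)
  induction z using TensorProduct.induction_on with
  | zero => rw [map_zero, map_zero, map_zero]
  | add x y hx hy => rw [map_add, map_add, map_add, hx, hy]
  | tmul t s => exact h a.2 t s

end Tensor

section TensorExt

variable (T : Tambara G) (M : SemiMackey G) (X : FinGSet G)

/-- The morphism `Ω[M] ⟶ T[M]`. -/
abbrev burnsideExtMap : ext (burnside G) M ⟶ ext T M := extMap (fromBurnside T) (𝟙 M)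

theorem burnsideExtMap_mk {A : FinGSet G} (p : A →[G] X) (m : M.obj A) :
    (burnsideExtMap T M).app X (Ext.mk p 1 m) = Ext.mk p 1 m :=
  (extMap_mk _ _ p 1 m).trans (by rw [RingHom.map_one]; rfl)

/-- The map `t ⊗ s ↦ p_+(t · s)`. -/
def tensorToExt : TensorGroup T (ext (burnside G) M) X →+ (ext T M).obj X :=
  tensorLift
    (fun {A} p => AddMonoidHom.mk' (fun t =>
      ((ext T M).tr p).comp ((AddMonoidHom.mulLeft ((extCoeff T M).app A t)).comp
        ((burnsideExtMap T M).app A).toAddMonoidHom)) fun t t' => AddMonoidHom.ext fun s => by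
          change (ext T M).tr p ((extCoeff T M).app A (t + t') * (burnsideExtMap T M).app A s) =
            (ext T M).tr p ((extCoeff T M).app A t * (burnsideExtMap T M).app A s) +
            (ext T M).tr p ((extCoeff T M).app A t' * (burnsideExtMap T M).app A s)
          rw [RingHom.map_add, add_mul, AddMonoidHom.map_add])
    (fun {A B} q a t s => by
      change (ext T M).tr (q.comp a) ((extCoeff T M).app A (T.res a t) *
          (burnsideExtMap T M).app A s) =
        (ext T M).tr q ((extCoeff T M).app B t *
          (burnsideExtMap T M).app B ((ext (burnside G) M).tr a s))
      rw [Tambara.tr_comp, (extCoeff T M).res_app, Tambara.tr_res_mul, Tambara.Hom.tr_app])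
    (fun {A B} q a t s => by
      change (ext T M).tr q ((extCoeff T M).app B (T.tr a t) *
          (burnsideExtMap T M).app B s) =
        (ext T M).tr (q.comp a) ((extCoeff T M).app A t *
          (burnsideExtMap T M).app A ((ext (burnside G) M).res a s))
      rw [Tambara.tr_comp, (extCoeff T M).tr_app, Tambara.Hom.res_app, Tambara.tr_mul_res])

theorem tensorToExt_tcls {A : FinGSet G} (p : A →[G] X) (t : T.obj A)
    (s : (ext (burnside G) M).obj A) : tensorToExt T M X (tcls p t s) =
      (ext T M).tr p ((extCoeff T M).app A t * (burnsideExtMap T M).app A s) :=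
  tensorLift_tcls _ _ _ _ _ _

/-- The map `[t, m]_p ↦ [t ⊗ [1, m]]_p`. -/
def tensorOfExt : (ext T M).obj X →+ TensorGroup T (ext (burnside G) M) X :=
  Ext.liftAdd (fun {A} p m => AddMonoidHom.mk'
      (fun t => tcls p t ((extUnit (burnside G) M).app A m))
      fun t t' => tcls_add_left p t t' _) fun {A C} q a t m => by
    have h := (extUnit (burnside G) M).res_app a m
    change _ = (ext (burnside G) M).res _ _ at h
    change tcls (S := ext (burnside G) M) (q.comp a) t ((extUnit (burnside G) M).app A (M.res a m)) =
      tcls (S := ext (burnside G) M) q (T.tr a t) ((extUnit (burnside G) M).app C m)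
    rw [h]
    exact (tcls_right q a t _).symm

theorem tensorOfExt_mk {A : FinGSet G} (p : A →[G] X) (t : T.obj A) (m : M.obj A) :
    tensorOfExt T M X (Ext.mk p t m) = tcls p t ((extUnit (burnside G) M).app A m) := rfl

/-- The values of `T[M]` are those of the tensor product of `T` and `Ω[M]`. -/
def tensorEquiv : TensorGroup T (ext (burnside G) M) X ≃+ (ext T M).obj X :=
  (tensorToExt T M X).toAddEquiv (tensorOfExt T M X)
    (tensorGroup_hom_ext fun {A} p t s => by
      have h : ((tensorOfExt T M X).comp (tensorToExt T M X)).comp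
          (AddMonoidHom.mk' (tcls p t) (tcls_add_right p t)) =
          AddMonoidHom.mk' (tcls (S := ext (burnside G) M) p t) (tcls_add_right p t) := by
        refine ext_burnside_addHom_ext fun {C} c m => ?_
        have hη : (burnsideExtMap T M).app C ((extUnit (burnside G) M).app C m) =
            (extUnit T M).app C m := burnsideExtMap_mk T M C _ m
        change tensorOfExt T M X (tensorToExt T M X (tcls p t
            ((ext (burnside G) M).tr c ((extUnit (burnside G) M).app C m)))) =
          tcls p t ((ext (burnside G) M).tr c ((extUnit (burnside G) M).app C m))
        rw [tensorToExt_tcls, Tambara.Hom.tr_app, hη, ← Tambara.tr_res_mul, Tambara.tr_tr,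
          ← (extCoeff T M).res_app, ← Ext.mk_eq_tr, tensorOfExt_mk, tcls_left]
      exact DFunLike.congr_fun h s)
    (AddMonoidHom.ext fun z => by
      induction z using Ext.ind_mk with | h p t m
      refine (tensorToExt_tcls T M X p t _).trans ?_
      refine Eq.trans ?_ (Ext.mk_eq_tr p t m).symm
      rw [extUnit_apply, burnsideExtMap_mk, extUnit_apply]
      rfl)

theorem tensorEquiv_tcls {A : FinGSet G} (p : A →[G] X) (t : T.obj A)
    (s : (ext (burnside G) M).obj A) : tensorEquiv T M X (tcls p t s) =
      (ext T M).tr p ((extCoeff T M).app A t * (burnsideExtMap T M).app A s) :=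
  tensorToExt_tcls T M X p t s

theorem isTensor_ext : IsTensor T (ext (burnside G) M) (ext T M) (tensorEquiv T M) where
  res f q t s := by
    rw [tensorEquiv_tcls, tensorEquiv_tcls, Tambara.res_tr, RingHom.map_mul,
      (extCoeff T M).res_app, Tambara.Hom.res_app]
  tr f p t s := by
    rw [tensorEquiv_tcls, tensorEquiv_tcls, Tambara.tr_tr]
  nm f p t s := by
    rw [tensorEquiv_tcls, tensorEquiv_tcls, Tambara.distrib, RingHom.map_mul, MonoidHom.map_mul,
      (extCoeff T M).nm_app, (extCoeff T M).res_app, Tambara.Hom.nm_app, Tambara.Hom.res_app]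

theorem isTensorFunctor_ext :
    IsTensorFunctor (tambarization G) (extFunctor G) tensorEquiv (extIncl G) where
  obj T M := isTensor_ext T M
  map {T T' M M'} τ φ {X A} p t s := by
    have h₁ : extCoeff T M ≫ extMap τ φ = τ ≫ extCoeff T' M' := extCoeff_lift _ _
    -- compatibility on `Ω[M]` holds by initiality of `Ω` and by construction on `M`
    have h₂ : burnsideExtMap T M ≫ extMap τ φ =
        extMap (𝟙 (burnside G)) φ ≫ burnsideExtMap T' M' := by
      refine ext_hom_ext (burnside_hom_ext _ _) fun X m => ?_
      change (extMap τ φ).app X ((burnsideExtMap T M).app X (Ext.mk _ 1 m)) =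
        (burnsideExtMap T' M').app X ((extMap (𝟙 (burnside G)) φ).app X (Ext.mk _ 1 m))
      rw [burnsideExtMap_mk, extMap_mk, extMap_mk, RingHom.map_one, RingHom.map_one,
        burnsideExtMap_mk]
    have h₃ : (extMap τ φ).app A ((extCoeff T M).app A t) =
        (extCoeff T' M').app A (τ.app A t) :=
      congrArg (fun χ : T ⟶ ext T' M' => χ.app A t) h₁
    have h₄ : (extMap τ φ).app A ((burnsideExtMap T M).app A s) =
        (burnsideExtMap T' M').app A ((extMap (𝟙 (burnside G)) φ).app A s) :=
      congrArg (fun χ : ext (burnside G) M ⟶ ext T' M' => χ.app A s) h₂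
    refine (congrArg ((extMap τ φ).app X) (tensorEquiv_tcls T M X p t s)).trans
      (Eq.trans ?_ (tensorEquiv_tcls T' M' X p _ _).symm)
    rw [Tambara.Hom.tr_app, RingHom.map_mul, h₃, h₄]
    rfl
  coproj T M X t := by
    refine Eq.trans ?_ (tensorEquiv_tcls T M X _ t 1).symm
    rw [Tambara.tr_id, RingHom.map_one, mul_one]
    rfl

end TensorExt

/-! ### The Dress construction -/

section Dress

/-- A morphism of data with a two-sided inverse is an isomorphism. -/
def TamData.isoOfInverse {T S : TamData G} (φ : TamData.Hom T S) (ψ : ∀ X, S.obj X → T.obj X)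
    (h₁ : ∀ X t, ψ X (φ.app X t) = t) (h₂ : ∀ X s, φ.app X (ψ X s) = s) : T ≅ S where
  hom := φ
  inv :=
    { app := ψ
      res_app := fun {X Y} f s => by rw [← h₁ X (T.res f (ψ Y s)), φ.res_app, h₂]
      tr_app := fun {X Y} f s => by rw [← h₁ Y (T.tr f (ψ X s)), φ.tr_app, h₂]
      nm_app := fun {X Y} f s => by rw [← h₁ Y (T.nm f (ψ X s)), φ.nm_app, h₂] }
  hom_inv_id := TamData.Hom.ext (funext fun X => funext fun t => h₁ X t)
  inv_hom_id := TamData.Hom.ext (funext fun X => funext fun s => h₂ X s)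

/-- The projection `X × Q → Q`, as an element of `𝒫_Q(X × Q)`. -/
def dressCoeff (X : FinGSet G) (Q : FinGMon G) :
    ((fixedPointFunctor G).obj Q).obj (timesSet X Q.toSet) :=
  (⟨fun z => ULift.up z.2, fun _ _ => rfl⟩ : timesSet X Q.toSet →[G] ULift.{u + 1} Q)

/-- The map `A → X × Q` with components `p : A → X` and `m ∈ 𝒫_Q(A)`. -/
def dressPair {A X : FinGSet G} {Q : FinGMon G} (p : A →[G] X)
    (m : ((fixedPointFunctor G).obj Q).obj A) : A →[G] timesSet X Q.toSet where
  toFun x := (p x, (DFunLike.coe (F := A →[G] ULift.{u + 1} Q) m x).down)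
  map_smul' g x := Prod.ext (map_smul p g x)
    (congrArg ULift.down (map_smul (show A →[G] ULift.{u + 1} Q from m) g x))

variable (T : Tambara G) (Q : FinGMon G)

/-- The map `T_Q(X) → T[𝒫_Q](X)`, `t ↦ [t, p_Q]`. -/
def dressTo (X : FinGSet G) (t : T.obj (timesSet X Q.toSet)) :
    (ext T ((fixedPointFunctor G).obj Q)).obj X :=
  Ext.mk (timesFst X Q.toSet) t (dressCoeff X Q)

/-- The map `T[𝒫_Q](X) → T_Q(X)`, `[t, m]_p ↦ (p, m)_+(t)`. -/
def dressFrom (X : FinGSet G) :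
    (ext T ((fixedPointFunctor G).obj Q)).obj X → T.obj (timesSet X Q.toSet) :=
  Quot.lift (fun x => T.tr (dressPair x.proj x.snd) x.fst) (by
    rintro _ _ ⟨q, a, t, m⟩
    exact T.tr_comp a (dressPair q m) t)

theorem dressFrom_dressTo (X : FinGSet G) (t : T.obj (timesSet X Q.toSet)) :
    dressFrom T Q X (dressTo T Q X t) = t := T.tr_id _ t

theorem dressTo_dressFrom (X : FinGSet G) (z : (ext T ((fixedPointFunctor G).obj Q)).obj X) :
    dressTo T Q X (dressFrom T Q X z) = z := by
  induction z using Ext.ind_mk with | h p t m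
  exact (Ext.mk_eq p (timesFst X Q.toSet) (dressPair p m) (fun _ => rfl) t
    (dressCoeff X Q)).symm

theorem dressTo_eq_iff {X : FinGSet G} {t : T.obj (timesSet X Q.toSet)}
    {z : (ext T ((fixedPointFunctor G).obj Q)).obj X} :
    dressTo T Q X t = z ↔ t = dressFrom T Q X z :=
  ⟨fun h => h ▸ (dressFrom_dressTo T Q X t).symm, fun h => h ▸ dressTo_dressFrom T Q X z⟩

/-- The multiplicative transfer of the coefficient `p_Q` is the map `μ_f` of the Dress construction. -/
theorem dressPair_nm {X Y : FinGSet G} (f : X →[G] Y) :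
    dressPair (piProj f (timesFst X Q.toSet))
      (((fixedPointFunctor G).obj Q).tr (piPull f (timesFst X Q.toSet))
        (((fixedPointFunctor G).obj Q).res (piEval f (timesFst X Q.toSet)) (dressCoeff X Q))) =
      dressMu Q f := by
  refine MulActionHom.ext fun s => Prod.ext rfl ?_
  refine (MonoidHom.map_finprod (MulEquiv.ulift : ULift.{u + 1} Q ≃* Q).toMonoidHom (Set.toFinite _)).trans ?_
  refine finprod_eq_of_bijective (fun w => ⟨w.1.1.1, w.1.2.trans
    (congrArg (piProj f (timesFst X Q.toSet)) w.2)⟩) ⟨?_, ?_⟩ ?_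
  · rintro ⟨⟨⟨x, s'⟩, h⟩, hs⟩ ⟨⟨⟨y, s''⟩, h'⟩, hs'⟩ hw
    obtain rfl : x = y := congrArg Subtype.val hw
    obtain rfl : s' = s := hs
    obtain rfl : s'' = s' := hs'
    rfl
  · rintro ⟨x, hx⟩
    exact ⟨⟨⟨(x, s), hx⟩, rfl⟩, rfl⟩
  · rintro ⟨⟨⟨x, s'⟩, h⟩, hs⟩
    obtain rfl : s' = s := hs
    rfl

/-- The isomorphism `T_Q ≅ T[𝒫_Q]`. -/
def dressIso : dress T Q ≅ ((extFunctor G).obj (T, (fixedPointFunctor G).obj Q)).toData :=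
  TamData.isoOfInverse
    { app := dressTo T Q
      res_app := fun {X Y} f (t : T.obj (timesSet Y Q.toSet)) => by
        refine (dressTo_eq_iff T Q).2 ?_
        let b : pb f (timesFst Y Q.toSet) →[G] timesSet X Q.toSet :=
          dressPair (pbFst f (timesFst Y Q.toSet)) (((fixedPointFunctor G).obj Q).res
            (pbSnd f (timesFst Y Q.toSet)) (dressCoeff Y Q))
        have hb : Function.Bijective b := bijective_of_inverse _
          (fun z => ⟨(z.1, (f z.1, z.2)), rfl⟩)
          (by
            rintro ⟨⟨x, ⟨y, c⟩⟩, h⟩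
            obtain rfl : f x = y := h
            rfl) (fun _ => rfl)
        have h := T.tr_res_of_bijective b hb (T.res (timesMap f Q.toSet) t)
        rw [T.res_res, T.res_congr (f := (timesMap f Q.toSet).comp b)
          (g := pbSnd f (timesFst Y Q.toSet)) (fun w => Prod.ext w.2 rfl)] at h
        exact h.symm
      tr_app := fun {X Y} f t => (dressTo_eq_iff T Q).2 rfl
      nm_app := fun {X Y} f t => by
        refine (dressTo_eq_iff T Q).2 ?_
        exact (congrArg (fun g => T.tr g (T.nm (piPull f (timesFst X Q.toSet))
          (T.res (piEval f (timesFst X Q.toSet)) t))) (dressPair_nm Q f)).symm }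
    (dressFrom T Q) (dressFrom_dressTo T Q) (dressTo_dressFrom T Q)

theorem isNaturalDress_dressIso : IsNaturalDress (extFunctor G) dressIso := by
  intro T T' τ Q R φ X t
  refine (Ext.mk_eq (timesFst X Q.toSet) (timesFst X R.toSet) (timesRight X φ) (fun _ => rfl)
    (τ.app _ t) (dressCoeff X R)).symm.trans ?_
  exact (extMap_mk τ ((fixedPointFunctor G).map φ) (timesFst X Q.toSet) t (dressCoeff X Q)).symm

end Dress

/-! ### Semi-Mackey functors on the trivial group -/

section Trivial

variable [Subsingleton G]

theorem smul_eq_of_subsingleton {X : Type*} [MulAction G X] (g : G) (x : X) : g • x = x := by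
  rw [Subsingleton.elim g 1, one_smul]

/-- The map from the one-point set with value `x`. -/
def pt {X : FinGSet G} (x : X) : point G →[G] X where
  toFun _ := x
  map_smul' g _ := (smul_eq_of_subsingleton g x).symm

/-- The map to the one-point set. -/
def toPoint (X : FinGSet G) : X →[G] point G where
  toFun _ := PUnit.unit
  map_smul' _ _ := rfl

theorem bijective_pt {K : FinGSet G} [MulAction.IsPretransitive G K] (x : K) :
    Function.Bijective (pt x) := by
  refine ⟨fun _ _ _ => rfl, fun y => ⟨PUnit.unit, ?_⟩⟩
  obtain ⟨g, rfl⟩ := MulAction.exists_smul_eq G x y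
  exact (smul_eq_of_subsingleton g x).symm

namespace SemiMackey

variable (M : SemiMackey G)

/-- The values of an element at the points of a finite set. -/
def values (X : FinGSet G) : M.obj X →* (X → M.obj (point G)) where
  toFun m x := M.res (pt x) m
  map_one' := funext fun _ => map_one _
  map_mul' _ _ := funext fun _ => map_mul _ _ _

theorem values_res {X Y : FinGSet G} (f : X →[G] Y) (m : M.obj Y) :
    M.values X (M.res f m) = M.values Y m ∘ f :=
  funext fun _ => M.res_res _ _ m

/-- The value at `X` is the product of the values at the points: this is preserved by disjoint unions,
and each orbit is a point. -/
theorem values_bijective (X : FinGSet G) : Function.Bijective (M.values X) := by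
  induction X using orbit_induction with
  | empty X hX =>
    exact ⟨fun m n _ => M.eq_of_isEmpty m n, fun v => ⟨1, funext fun x => hX.elim x⟩⟩
  | orbit X hX hX' =>
    obtain ⟨x⟩ := hX'
    refine ⟨fun m n h => ?_, fun v => ⟨M.tr (pt x) (v x), ?_⟩⟩
    · rw [← M.tr_res_of_bijective _ (bijective_pt x) m,
        ← M.tr_res_of_bijective _ (bijective_pt x) n]
      exact congrArg _ (congrFun h x)
    · funext y
      obtain ⟨z, rfl⟩ := (bijective_pt x).2 y
      exact M.res_tr_of_injective _ (bijective_pt x).1 (v x)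
  | sum X Y hX hY =>
    have hl := fun m => M.values_res (inl X Y) m
    have hr := fun m => M.values_res (inr X Y) m
    constructor
    · intro m n h
      refine M.sum_ext (hX.1 ?_) (hY.1 ?_)
      · rw [hl, hl, h]
      · rw [hr, hr, h]
    · intro v
      obtain ⟨m, hm⟩ := hX.2 (v ∘ inl X Y)
      obtain ⟨n, hn⟩ := hY.2 (v ∘ inr X Y)
      refine ⟨M.pair m n, funext fun z => ?_⟩
      rcases z with x | y
      · have h := congrFun (hl (M.pair m n)) x
        rw [M.res_inl_pair, hm] at h
        exact h.symm
      · have h := congrFun (hr (M.pair m n)) y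
        rw [M.res_inr_pair, hn] at h
        exact h.symm
  | iso X Y a ha hX =>
    have hres : Function.Bijective (M.res a) :=
      ⟨fun m n h => by
        rw [← M.tr_res_of_bijective a ha m, h, M.tr_res_of_bijective a ha n],
        fun m => ⟨M.tr a m, M.res_tr_of_injective a ha.1 m⟩⟩
    have h : (M.values X) ∘ (M.res a) = (fun v => v ∘ a) ∘ M.values Y :=
      funext fun m => M.values_res a m
    have hc : Function.Bijective fun v : Y → M.obj (point G) => v ∘ a :=
      (Equiv.arrowCongr (Equiv.ofBijective a ha).symm (Equiv.refl _)).bijective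
    exact (Function.Bijective.of_comp_iff' hc _).1 (h ▸ hX.comp hres)

/-- Over the trivial group, an element is a family of elements of the value at a point. -/
def valuesEquiv (X : FinGSet G) : M.obj X ≃* (X → M.obj (point G)) :=
  MulEquiv.ofBijective (M.values X) (M.values_bijective X)

theorem point_ext {X : FinGSet G} {m n : M.obj X} (h : ∀ x, M.res (pt x) m = M.res (pt x) n) :
    m = n := (M.values_bijective X).1 (funext h)

theorem res_pt_valuesEquiv_symm {X : FinGSet G} (v : X → M.obj (point G)) (x : X) :
    M.res (pt x) ((M.valuesEquiv X).symm v) = v x :=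
  congrFun ((M.valuesEquiv X).apply_symm_apply v) x

/-- The transfer to a point is the product of the values. -/
theorem tr_toPoint {X : FinGSet G} (m : M.obj X) :
    M.tr (toPoint X) m = ∏ᶠ x : X, M.res (pt x) m := by
  induction X using orbit_induction with
  | empty X hX => rw [finprod_of_isEmpty, M.eq_of_isEmpty m 1, map_one]
  | orbit X hX hX' =>
    obtain ⟨x⟩ := hX'
    have : Unique X := ⟨⟨x⟩, fun y => by
      obtain ⟨z, rfl⟩ := (bijective_pt x).2 y
      rfl⟩
    rw [finprod_unique]
    have hx : (default : X) = x := (Unique.eq_default x).symm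
    rw [hx]
    conv_lhs => rw [← M.tr_res_of_bijective _ (bijective_pt x) m, ← M.tr_comp]
    exact M.tr_id _ _
  | sum X Y hX hY =>
    have hd : toPoint (X.sum Y) = desc (toPoint X) (toPoint Y) := sum_hom_ext rfl rfl
    let _ := Fintype.ofFinite X
    let _ := Fintype.ofFinite Y
    rw [hd, M.tr_desc, hX, hY]
    refine Eq.symm ((finprod_eq_prod_of_fintype
      (fun z : X ⊕ Y => M.res (pt (X := X.sum Y) z) m)).trans ?_)
    rw [Fintype.prod_sum_type, finprod_eq_prod_of_fintype, finprod_eq_prod_of_fintype]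
    refine congrArg₂ (· * ·) (Finset.prod_congr rfl fun x _ => ?_)
      (Finset.prod_congr rfl fun y _ => ?_)
    · exact (M.res_res (pt x) (inl X Y) m).symm
    · exact (M.res_res (pt y) (inr X Y) m).symm
  | iso X Y a ha hX =>
    have h := hX (M.res a m)
    have h2 : M.tr (toPoint X) (M.res a m) = M.tr (toPoint Y) m := by
      rw [show toPoint X = (toPoint Y).comp a from rfl, M.tr_comp, M.tr_res_of_bijective a ha]
    rw [← h2, h]
    exact finprod_eq_of_bijective a ha fun x => M.res_res (pt x) a m

/-- Transfers are fibrewise products. -/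
theorem res_pt_tr {X Y : FinGSet G} (f : X →[G] Y) (m : M.obj X) (y : Y) :
    M.res (pt y) (M.tr f m) = ∏ᶠ w : pb (pt y) f, M.res (pt w.1.2) m := by
  rw [← M.mackey _ _ _ _ (isPullbackSquare_pb (pt y) f)]
  refine (M.tr_toPoint (M.res (pbSnd (pt y) f) m)).trans (finprod_congr fun w => ?_)
  exact M.res_res (pt w) (pbSnd (pt y) f) m

/-- The morphism with a given value at a point. -/
def homOfPoint {M N : SemiMackey G} (g : M.obj (point G) →* N.obj (point G)) : M ⟶ N where
  app X := (N.valuesEquiv X).symm.toMonoidHom.comp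
    ((MonoidHom.pi fun x => g.comp (Pi.evalMonoidHom _ x)).comp (M.values X))
  res_app f m := by
    refine N.point_ext fun x => ?_
    refine (res_pt_valuesEquiv_symm _ _ _).trans ?_
    rw [N.res_res]
    refine Eq.trans ?_ (res_pt_valuesEquiv_symm N _ (f x)).symm
    exact congrArg g (congrFun (M.values_res f m) x)
  tr_app f m := by
    refine N.point_ext fun y => ?_
    refine (res_pt_valuesEquiv_symm _ _ _).trans ?_
    rw [res_pt_tr]
    refine (congrArg g (M.res_pt_tr f m y)).trans ?_
    refine (MonoidHom.map_finprod g (Set.toFinite _)).trans (finprod_congr fun w => ?_)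
    exact (res_pt_valuesEquiv_symm N (fun x => g (M.res (pt x) m)) w.1.2).symm

theorem res_pt_homOfPoint {M N : SemiMackey G} (g : M.obj (point G) →* N.obj (point G))
    {X : FinGSet G} (m : M.obj X) (x : X) :
    N.res (pt x) ((homOfPoint g).app X m) = g (M.res (pt x) m) :=
  res_pt_valuesEquiv_symm N _ _

theorem res_pt_unit (m : M.obj (point G)) (x : point G) : M.res (pt x) m = m :=
  M.res_id _ m

end SemiMackey

theorem evMon_isEquivalence : (evMon G).IsEquivalence where
  faithful := ⟨fun {M N} φ ψ h => by
    refine SemiMackey.Hom.ext (funext fun X => MonoidHom.ext fun m => N.point_ext fun x => ?_)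
    have h1 : φ.app (point G) = ψ.app (point G) := congrArg CommMonCat.Hom.hom h
    exact (φ.res_app (pt x) m).symm.trans
      ((DFunLike.congr_fun h1 _).trans (ψ.res_app (pt x) m))⟩
  full := ⟨fun {M N} g => ⟨SemiMackey.homOfPoint g.hom, CommMonCat.hom_ext (MonoidHom.ext fun m =>
    (N.res_pt_unit _ PUnit.unit).symm.trans ((SemiMackey.res_pt_homOfPoint g.hom m PUnit.unit).trans
      (congrArg g.hom (M.res_pt_unit m PUnit.unit))))⟩⟩
  -- a monoid with trivial action is the value at the point of its fixed point functor
  essSurj := ⟨fun Q => by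
    let _ : MulDistribMulAction G Q :=
      { smul := fun _ x => x
        one_smul := fun _ => rfl
        mul_smul := fun _ _ _ => rfl
        smul_mul := fun _ _ _ => rfl
        smul_one := fun _ => rfl }
    exact ⟨fixedPoint Q, ⟨MulEquiv.toCommMonCatIso
      { toFun := fun α : point G →[G] Q => α PUnit.unit
        invFun := fun q => (⟨fun _ => q, fun _ _ => rfl⟩ : point G →[G] Q)
        left_inv := fun _ => rfl
        right_inv := fun _ => rfl
        map_mul' := fun _ _ => rfl }⟩⟩⟩

end Trivial

/-! ### Tambara functors on the trivial group -/

section TrivialTambara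

@[to_additive]
theorem finprod_fibre_id {X Q : Type*} [CommMonoid Q] (φ : X → Q) (y : X) :
    ∏ᶠ x : {x : X // x = y}, φ x = φ y := by
  have : Unique {x : X // x = y} := ⟨⟨⟨y, rfl⟩⟩, fun x => Subtype.ext x.2⟩
  rw [finprod_unique, (default : {x : X // x = y}).2]

@[to_additive]
theorem finprod_fibre_comp {X Y Z Q : Type*} [Finite X] [Finite Y] [CommMonoid Q] (f : X → Y)
    (g : Y → Z) (φ : X → Q) (z : Z) : ∏ᶠ x : {x : X // g (f x) = z}, φ x =
      ∏ᶠ y : {y : Y // g y = z}, ∏ᶠ x : {x : X // f x = y}, φ x := by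
  classical
  let _ := Fintype.ofFinite X
  let _ := Fintype.ofFinite Y
  simp only [finprod_eq_prod_of_fintype]
  rw [← Fintype.prod_sigma']
  symm
  refine Fintype.prod_bijective
    (fun w : (Σ y : {y : Y // g y = z}, {x : X // f x = y.1}) =>
      (⟨w.2.1, by rw [w.2.2, w.1.2]⟩ : {x : X // g (f x) = z})) ⟨?_, ?_⟩ _ _ (fun _ => rfl)
  · rintro ⟨⟨y, hy⟩, ⟨x, hx⟩⟩ ⟨⟨y', hy'⟩, ⟨x', hx'⟩⟩ h
    obtain rfl : x = x' := congrArg Subtype.val h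
    obtain rfl : y = y' := hx.symm.trans hx'
    rfl
  · rintro ⟨x, hx⟩
    exact ⟨⟨⟨f x, hx⟩, ⟨x, rfl⟩⟩, rfl⟩

@[to_additive]
theorem finprod_fibre_mackey {X Y X' Y' Q : Type*} [CommMonoid Q] {f' : X' → Y'} {x : X' → X}
    {y : Y' → Y} {f : X → Y} (comm : ∀ c, f (x c) = y (f' c))
    (univ : ∀ a b, f a = y b → ∃! c, x c = a ∧ f' c = b) (φ : Y' → Q) (a : X) :
    ∏ᶠ c : {c : X' // x c = a}, φ (f' c) = ∏ᶠ b : {b : Y' // y b = f a}, φ b := by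
  refine finprod_eq_of_bijective (fun c : {c : X' // x c = a} => (⟨f' c.1, by
    rw [← comm, c.2]⟩ : {b : Y' // y b = f a})) ⟨?_, ?_⟩ (fun _ => rfl)
  · rintro ⟨c, rfl⟩ ⟨d, hd⟩ hcd
    exact Subtype.ext ((univ _ _ (comm c)).unique ⟨rfl, rfl⟩
      ⟨hd, (congrArg Subtype.val hcd).symm⟩)
  · rintro ⟨b, hb⟩
    obtain ⟨w, hw, -⟩ := univ a b hb.symm
    exact ⟨⟨w, hw.1⟩, Subtype.ext hw.2⟩

/-- A product of fibrewise sums is the sum over all sections of products. -/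
theorem finprod_finsum_fibre {X Y A : FinGSet G} (f : X →[G] Y) (p : A →[G] X) {R : Type*}
    [CommRing R] (φ : A → R) (y : Y) :
    ∏ᶠ x : {x : X // f x = y}, ∑ᶠ a : {a : A // p a = x}, φ a =
      ∑ᶠ s : {s : piSet f p // piProj f p s = y},
        ∏ᶠ w : {w : pb f (piProj f p) // piPull f p w = s}, φ (piEval f p w) := by
  classical
  let _ := Fintype.ofFinite X
  let _ := Fintype.ofFinite A
  simp only [finsum_eq_sum_of_fintype (α := {a : A // p a = _})]
  rw [finprod_eq_prod_of_fintype, Fintype.prod_sum, ← finsum_eq_sum_of_fintype]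
  let S : (∀ x : {x : X // f x = y}, {a : A // p a = x.1}) → piSet f p := fun σ =>
    (⟨y, fun x hx => (σ ⟨x, hx⟩).1, fun x hx => (σ ⟨x, hx⟩).2⟩ : FibreSection f p)
  refine finsum_eq_of_bijective (fun σ => ⟨S σ, rfl⟩) ⟨?_, ?_⟩ fun σ => ?_
  · intro σ τ h
    have h1 : S σ = S τ := congrArg Subtype.val h
    injection h1 with _ h2
    exact funext fun x => Subtype.ext (congrFun (congrFun h2 x.1) x.2)
  · rintro ⟨s, hs⟩
    subst hs
    exact ⟨fun x => ⟨FibreSection.sec s x.1 x.2, FibreSection.proj_sec s x.1 x.2⟩, rfl⟩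
  · rw [← finprod_eq_prod_of_fintype]
    refine finprod_eq_of_bijective (fun x => ⟨⟨(x.1, S σ), x.2⟩, rfl⟩) ⟨?_, ?_⟩ (fun _ => rfl)
    · intro a b h
      exact Subtype.ext (congrArg (fun w => w.1.1.1) h)
    · rintro ⟨⟨⟨x, s⟩, h⟩, hs⟩
      obtain rfl : s = S σ := hs
      exact ⟨⟨x, h⟩, rfl⟩

/-- The Tambara functor `X ↦ Map(X, R)` of functions on the underlying sets. -/
def functionTambara (G : Type u) [Group G] (R : Type (u + 1)) [CommRing R] : Tambara G where
  obj X := X → R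
  res f :=
    { toFun := fun φ x => φ (f x)
      map_one' := rfl
      map_mul' := fun _ _ => rfl
      map_zero' := rfl
      map_add' := fun _ _ => rfl }
  tr f :=
    { toFun := fun φ y => ∑ᶠ x : {x // f x = y}, φ x
      map_zero' := funext fun _ => finsum_zero
      map_add' := fun _ _ => funext fun _ =>
        finsum_add_distrib (Set.toFinite _) (Set.toFinite _) }
  nm f :=
    { toFun := fun φ y => ∏ᶠ x : {x // f x = y}, φ x
      map_one' := funext fun _ => finprod_one
      map_mul' := fun _ _ => funext fun _ =>
        finprod_mul_distrib (Set.toFinite _) (Set.toFinite _) }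
  res_id _ _ := rfl
  res_comp _ _ _ := rfl
  tr_id _ φ := funext fun y => finsum_fibre_id φ y
  tr_comp f g φ := funext fun z => finsum_fibre_comp f g φ z
  nm_id _ φ := funext fun y => finprod_fibre_id φ y
  nm_comp f g φ := funext fun z => finprod_fibre_comp f g φ z
  additive_empty X hX := ⟨fun φ ψ => funext fun x => hX.elim x⟩
  additive_sum X Y := by
    constructor
    · intro φ ψ h
      funext z
      rcases z with x | y
      · exact congrFun (congrArg Prod.fst h) x
      · exact congrFun (congrArg Prod.snd h) y
    · rintro ⟨φ, ψ⟩
      exact ⟨Sum.elim φ ψ, rfl⟩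
  tr_mackey _ _ _ _ h φ := funext fun a => finsum_fibre_mackey h.1 h.2 φ a
  nm_mackey _ _ _ _ h φ := funext fun a => finprod_fibre_mackey h.1 h.2 φ a
  distrib f p φ := funext fun y => finprod_finsum_fibre f p φ y

/-- The map `R[Q] → T[M](G/G)` for `R = T(G/G)` and `Q = M(G/G)`. -/
def semigroupToExt (T : Tambara G) (M : SemiMackey G) :
    MonoidAlgebra (T.obj (point G)) (M.obj (point G)) →+* (ext T M).obj (point G) :=
  MonoidAlgebra.liftNCRingHom ((extCoeff T M).app (point G)) ((extUnit T M).app (point G))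
    fun _ _ => Commute.all _ _

theorem semigroupToExt_single (T : Tambara G) (M : SemiMackey G) (m : M.obj (point G))
    (t : T.obj (point G)) :
    semigroupToExt T M (MonoidAlgebra.single m t) = Ext.mk (MulActionHom.id G) t m := by
  refine (MonoidAlgebra.liftNCRingHom_single _ _ _ m t).trans ?_
  rw [Ext.mk_eq_tr, Tambara.tr_id]

variable [Subsingleton G]

namespace Tambara

theorem finsum_eq_finprod_multiplicative {α A : Type*} [Finite α] [AddCommMonoid A] (f : α → A) :
    ∑ᶠ a, f a = Multiplicative.toAdd (∏ᶠ a, Multiplicative.ofAdd (f a)) := by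
  let _ := Fintype.ofFinite α
  rw [finsum_eq_sum_of_fintype, finprod_eq_prod_of_fintype]
  rfl

variable (T : Tambara G)

theorem point_ext {X : FinGSet G} {s t : T.obj X} (h : ∀ x, T.res (pt x) s = T.res (pt x) t) :
    s = t := T.mu.point_ext h

theorem tr_toPoint {X : FinGSet G} (t : T.obj X) :
    T.tr (toPoint X) t = ∑ᶠ x : X, T.res (pt x) t :=
  (T.alpha.tr_toPoint t).trans
    (finsum_eq_finprod_multiplicative fun x : X => T.res (pt x) t).symm

theorem res_pt_tr {X Y : FinGSet G} (f : X →[G] Y) (t : T.obj X) (y : Y) :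
    T.res (pt y) (T.tr f t) = ∑ᶠ w : pb (pt y) f, T.res (pt w.1.2) t :=
  (T.alpha.res_pt_tr f t y).trans
    (finsum_eq_finprod_multiplicative fun w : pb (pt y) f => T.res (pt w.1.2) t).symm

theorem res_pt_unit (t : T.obj (point G)) (x : point G) : T.res (pt x) t = t := T.res_id _ t

variable {T} {S : Tambara G} (g : T.obj (point G) →+* S.obj (point G))

/-- The components of the morphism with a given value at a point. -/
def homOfPointApp (X : FinGSet G) : T.obj X → S.obj X :=
  (SemiMackey.homOfPoint (M := T.mu) (N := S.mu) g.toMonoidHom).app X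

theorem res_pt_homOfPointApp {X : FinGSet G} (t : T.obj X) (x : X) :
    S.res (pt x) (homOfPointApp g X t) = g (T.res (pt x) t) :=
  SemiMackey.res_pt_homOfPoint (M := T.mu) (N := S.mu) g.toMonoidHom t x

/-- The morphism with a given value at a point. -/
def homOfPoint : T ⟶ S where
  app X :=
    { (SemiMackey.homOfPoint (M := T.mu) (N := S.mu) g.toMonoidHom).app X with
      map_zero' := S.point_ext fun x => by
        refine (res_pt_homOfPointApp g 0 x).trans ?_
        rw [map_zero, map_zero, map_zero]
      map_add' := fun s t => S.point_ext fun x => by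
        refine (res_pt_homOfPointApp g (s + t) x).trans ?_
        rw [map_add, map_add, map_add]
        exact congrArg₂ (· + ·) (res_pt_homOfPointApp g s x).symm
          (res_pt_homOfPointApp g t x).symm }
  res_app := (SemiMackey.homOfPoint (M := T.mu) (N := S.mu) g.toMonoidHom).res_app
  tr_app f t := by
    refine S.point_ext fun y => ?_
    refine (res_pt_homOfPointApp g _ y).trans ?_
    rw [res_pt_tr, res_pt_tr]
    refine (AddMonoidHom.map_finsum g.toAddMonoidHom (Set.toFinite _)).trans
      (finsum_congr fun w => ?_)
    exact (res_pt_homOfPointApp g t _).symm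
  nm_app := (SemiMackey.homOfPoint (M := T.mu) (N := S.mu) g.toMonoidHom).tr_app

end Tambara

theorem evRing_isEquivalence : (evRing G).IsEquivalence where
  faithful := ⟨fun {T S} φ ψ h => by
    refine Tambara.Hom.ext (funext fun X => RingHom.ext fun t => S.point_ext fun x => ?_)
    have h1 : φ.app (point G) = ψ.app (point G) := congrArg CommRingCat.Hom.hom h
    exact (φ.res_app (pt x) t).symm.trans
      ((DFunLike.congr_fun h1 _).trans (ψ.res_app (pt x) t))⟩
  full := ⟨fun {T S} g => ⟨Tambara.homOfPoint g.hom, CommRingCat.hom_ext (RingHom.ext fun t =>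
    (S.res_pt_unit _ PUnit.unit).symm.trans ((Tambara.res_pt_homOfPointApp g.hom t
      PUnit.unit).trans (congrArg g.hom (T.res_pt_unit t PUnit.unit))))⟩⟩
  essSurj := ⟨fun R => ⟨functionTambara G R, ⟨RingEquiv.toCommRingCatIso
    { toFun := fun φ => (show PUnit.{u + 1} → R from φ) PUnit.unit
      invFun := fun r => fun _ => r
      left_inv := fun _ => rfl
      right_inv := fun _ => rfl
      map_mul' := fun _ _ => rfl
      map_add' := fun _ _ => rfl }⟩⟩⟩

/-! ### Semi-group rings -/

variable (T : Tambara G) (M : SemiMackey G)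

/-- The map `T[M](G/G) → R[Q]`, `[t, m] ↦ ∑_a t(a) · m(a)`. -/
def semigroupOfExt :
    (ext T M).obj (point G) →+ MonoidAlgebra (T.obj (point G)) (M.obj (point G)) :=
  Ext.liftAdd (fun {A} _ m => AddMonoidHom.mk'
      (fun t => ∑ᶠ a : A, MonoidAlgebra.single (M.res (pt a) m) (T.res (pt a) t))
      fun s t => by
        rw [← finsum_add_distrib (Set.toFinite _) (Set.toFinite _)]
        exact finsum_congr fun a => by rw [map_add, MonoidAlgebra.single_add])
    fun {A C} q a t m => by
      change ∑ᶠ x : A, MonoidAlgebra.single (M.res (pt x) (M.res a m)) (T.res (pt x) t) =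
        ∑ᶠ y : C, MonoidAlgebra.single (M.res (pt y) m) (T.res (pt y) (T.tr a t))
      have hF : ∀ y : C, MonoidAlgebra.single (M.res (pt y) m) (T.res (pt y) (T.tr a t)) =
          ∑ᶠ w : pb (pt y) a, MonoidAlgebra.single (M.res (pt w.1.2) (M.res a m))
            (T.res (pt w.1.2) t) := by
        intro y
        rw [T.res_pt_tr]
        refine (AddMonoidHom.map_finsum (MonoidAlgebra.singleAddHom _) (Set.toFinite _)).trans
          (finsum_congr fun w => ?_)
        rw [M.res_res_of (k := pt y) fun _ => w.2.symm]
        rfl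
      rw [finsum_congr hF, ← finsum_sigma_of_finite (fun s : (Σ y : C, pb (pt y) a) =>
        MonoidAlgebra.single (M.res (pt s.2.1.2) (M.res a m)) (T.res (pt s.2.1.2) t))]
      symm
      refine finsum_eq_of_bijective (fun s => s.2.1.2) ⟨?_, fun x => ?_⟩ fun _ => rfl
      · rintro ⟨y, ⟨⟨u, x⟩, h⟩⟩ ⟨y', ⟨⟨u', x'⟩, h'⟩⟩ (hx : x = x')
        subst hx
        obtain rfl : y = a x := h
        obtain rfl : y' = a x := h'
        rfl
      · exact ⟨⟨a x, ⟨(PUnit.unit, x), rfl⟩⟩, rfl⟩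

theorem semigroupOfExt_mk {A : FinGSet G} (p : A →[G] point G) (t : T.obj A) (m : M.obj A) :
    semigroupOfExt T M (Ext.mk p t m) =
      ∑ᶠ a : A, MonoidAlgebra.single (M.res (pt a) m) (T.res (pt a) t) := rfl

theorem semigroupOfExt_semigroupToExt
    (z : MonoidAlgebra (T.obj (point G)) (M.obj (point G))) :
    semigroupOfExt T M (semigroupToExt T M z) = z := by
  have h : (semigroupOfExt T M).comp (semigroupToExt T M).toAddMonoidHom =
      AddMonoidHom.id _ := by
    refine MonoidAlgebra.addMonoidHom_ext fun m t => ?_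
    refine (congrArg (semigroupOfExt T M) (semigroupToExt_single T M m t)).trans ?_
    refine (semigroupOfExt_mk T M _ t m).trans ?_
    have : Unique (point G) := inferInstanceAs (Unique PUnit)
    rw [finsum_unique, T.res_pt_unit, M.res_pt_unit]
    rfl
  exact DFunLike.congr_fun h z

theorem semigroupToExt_semigroupOfExt (z : (ext T M).obj (point G)) :
    semigroupToExt T M (semigroupOfExt T M z) = z := by
  induction z using Ext.ind_mk with | h p t m
  obtain rfl : p = toPoint _ := rfl
  refine (AddMonoidHom.map_finsum (semigroupToExt T M).toAddMonoidHom (Set.toFinite _)).trans ?_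
  refine Eq.trans (finsum_congr fun a => ?_)
    ((Ext.mk_eq_tr (toPoint _) t m).trans (Tambara.tr_toPoint _ _)).symm
  refine (semigroupToExt_single T M _ _).trans ?_
  have h := (extUnit T M).res_app (pt a) m
  change _ = (ext T M).res _ _ at h
  rw [Ext.mk_eq_tr, Tambara.tr_id, RingHom.map_mul, ← (extCoeff T M).res_app, ← h]
  rfl

/-- The value of `T[M]` at a point is a semi-group ring. -/
def semigroupEquiv :
    MonoidAlgebra (T.obj (point G)) (M.obj (point G)) ≃+* (ext T M).obj (point G) :=
  RingEquiv.ofBijective (semigroupToExt T M)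
    (Function.bijective_iff_has_inverse.2 ⟨semigroupOfExt T M, semigroupOfExt_semigroupToExt T M,
      semigroupToExt_semigroupOfExt T M⟩)

/-- Over the trivial group, `T[M]` is the semi-group ring functor. -/
def extEvIso (G : Type u) [Group G] [Subsingleton G] :
    extFunctor G ⋙ evRing G ≅ (evRing G).prod (evMon G) ⋙ semigroupRing :=
  (NatIso.ofComponents (F := (evRing G).prod (evMon G) ⋙ semigroupRing)
    (fun P => (semigroupEquiv P.1 P.2).toCommRingCatIso) fun {P P'} φ => by
      refine CommRingCat.hom_ext (RingHom.coe_addMonoidHom_injective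
        (MonoidAlgebra.addMonoidHom_ext fun m t => ?_))
      change semigroupToExt P'.1 P'.2 (semigroupRingMap (φ.1.app (point G)) (φ.2.app (point G))
          (MonoidAlgebra.single m t)) =
        (extMap φ.1 φ.2).app (point G) (semigroupToExt P.1 P.2 (MonoidAlgebra.single m t))
      refine (congrArg (semigroupToExt P'.1 P'.2) (semigroupRingMap_single _ _ m t)).trans
        ((semigroupToExt_single P'.1 P'.2 _ _).trans ?_)
      exact (extMap_mk φ.1 φ.2 _ t m).symm.trans (congrArg ((extMap φ.1 φ.2).app (point G))
        (semigroupToExt_single P.1 P.2 m t).symm)).symm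

end TrivialTambara

end GBivariant

end

theorem mainTheorem1 (G : Type u) [Group G] [Finite G] :
    ∃ (Ω : Tambara G) (eΩ : ∀ X, BurnsideGroup X ≃+ Ω.obj X)
      (𝒯 : SemiMackey G ⥤ Tambara G) (e𝒯 : ∀ M X, PairGroup M X ≃+ (𝒯.obj M).obj X)
      (F : Tambara G × SemiMackey G ⥤ Tambara G)
      (eF : ∀ T M X, TensorGroup T (𝒯.obj M) X ≃+ (F.obj (T, M)).obj X)
      (ι : CategoryTheory.Prod.fst (Tambara G) (SemiMackey G) ⟶ F),
      -- `Ω` is the Burnside ring functor, `𝒯(M) = Ω[M]` is the Tambarization,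
      -- `F(T, M) = T ⊗_Ω Ω[M]`, and `ι : T ⟶ F(T, M)` is the coprojection
      IsBurnside Ω eΩ ∧ IsTambarization 𝒯 e𝒯 ∧ IsTensorFunctor 𝒯 F eF ι ∧
      -- (i) for trivial `G`, evaluation at the one-point set identifies Tambara functors with
      -- rings and semi-Mackey functors with monoids, and `F` with the semi-group ring functor
      (Subsingleton G → (evRing G).IsEquivalence ∧ (evMon G).IsEquivalence ∧
        Nonempty (F ⋙ evRing G ≅ (evRing G).prod (evMon G) ⋙ semigroupRing)) ∧
      -- (ii) `F(Ω, M) ≅ Ω[M]`, naturally in `M`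
      Nonempty (CategoryTheory.Prod.sectR Ω (SemiMackey G) ⋙ F ≅ 𝒯) ∧
      -- (iii) `F(T, 𝒫_Q) ≅ T_Q`, naturally in `T` and in the finite `G`-monoid `Q`
      (∃ i : ∀ (T : Tambara G) (Q : FinGMon G),
        dress T Q ≅ (F.obj (T, (fixedPointFunctor G).obj Q)).toData, IsNaturalDress F i) ∧
      -- (iv) `F(T, -)`, with values in `T`-Tambara functors, is left adjoint to `(S, σ) ↦ S^μ`
      (∀ T : Tambara G, Nonempty (coeffFunctor ι T ⊣ underMu T)) := by
  exact ⟨burnside G, burnsideEquiv, tambarization G, pairEquiv, extFunctor G, tensorEquiv,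
    extIncl G, isBurnside_burnside, isTambarization_tambarization, isTensorFunctor_ext,
    fun _ => ⟨evRing_isEquivalence, evMon_isEquivalence, ⟨extEvIso G⟩⟩, ⟨Iso.refl _⟩,
    ⟨dressIso, isNaturalDress_dressIso⟩, fun T => ⟨extAdjunction T⟩⟩
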